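/- Fix $n,N\ge 1$. Let $\varphi:[0,\infty)\to[0,\infty)$ be convex with $\varphi\in C^2((0,\infty))\cap C^1([0,\infty))$, $\varphi(0)=\varphi'(0)=0$, $\lim_{t\to\infty}\varphi(t)=\infty$ and $$c_1\,\varphi''(t)\,t\le \varphi'(t)\le c_2\,\varphi''(t)\,t\qquad(t>0)$$ for some constants $c_1,c_2>0$ (the characteristics of $\varphi$). For $a,t\ge 0$ let $\varphi_a(t)=\int_0^t\frac{\varphi'(a+s)}{a+s}\,s\,ds$, and for $P\in\mathbb R^{N\times n}$ (with the Frobenius norm) let $V(P)=\sqrt{\varphi'(|P|)\,|P|}\,\frac{P}{|P|}$, $V(0)=0$. Let $J\subset\mathbb R$ be an open interval, $\Omega\subset\mathbb R^n$ open, and let $u:J\times\Omega\to\mathbb R^N$ be a local weak solution of $\partial_t u-\operatorname{div}\big(\frac{\varphi'(|\nabla u|)}{|\nabla u|}\nabla u\big)=0$, i.e. $u\in L^\infty_{\rm loc}(J;L^2_{\rm loc}(\Omega;\mathbb R^N))$ has a weak spatial gradient $\nabla u$ with $\varphi(|\nabla u|)\in L^1_{\rm loc}(J\times\Omega)$ and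 $$\int_{J\times\Omega} \frac{\varphi'(|\nabla u|)}{|\nabla u|}\nabla u\cdot\nabla\zeta\,dz=\int_{J\times\Omega} u\cdot\partial_t\zeta\,dz\qquad\text{for all }\zeta\in C_0^\infty(J\times\Omega;\mathbb R^N).$$ Assume moreover that $\nabla u\in L^2_{\rm loc}(J\times\Omega)$. (a) There are $q>1$ and $K$, depending only on $c_1,c_2$, such that $$\varphi_a(\lambda^{q-1}t)\le K\lambda^q\varphi_a(t)\quad\text{for all }a,t\ge 0,\ \lambda\in[0,1].\tag{1}$$ (b) $V(\nabla u)$ has a weak spatial gradient $\nabla V(\nabla u)$ on $J\times\Omega$, and $\nabla V(\nabla u)\in L^2_{\rm loc}(J\times\Omega)$. (c) Let $q>1$ be such that (1) holds for some $K$. Then there is a constant $C$, depending only on $n$, $c_1,c_2$ and $q$, such that for all $t_0\in\mathbb R$, $x_0\in\mathbb R^n$, $\alpha,R>0$ the following holds. Write $Q_r=(t_0-\alpha r^2,t_0)\times B_r(x_0)$ and suppose that $\overline{Q_R}\subset J\times\Omega$. Let $\eta$ be a function on $(-\infty,t_0]\times\mathbb R^n$, smooth up to time $t_0$, with $0\le\eta\le1$,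 which vanishes outside a compact subset of $(t_0-\alpha R^2,t_0]\times B_R(x_0)$. Then $$\operatorname*{ess\,sup}_{t\in(t_0-\alpha R^2,t_0)}\frac1\alpha\,-\!\!\!\!\!\int_{B_R(x_0)}|\nabla u(t,x)|^2\eta^q\,dx+R^2\,-\!\!\!\!\!\int_{Q_R}|\nabla V(\nabla u)|^2\eta^q\,dz$$ $$\le C\Big(R^2\,-\!\!\!\!\!\int_{Q_{2R}}|V(\nabla u)|^2\,\|\nabla\eta\|_\infty^2\,dz+R^2\,-\!\!\!\!\!\int_{Q_{2R}}|\nabla u|^2\,\eta^{q-1}\,|\partial_t\eta|\,dz\Big),$$ where $-\!\!\!\!\!\int_E f=\frac1{|E|}\int_E f$ denotes the mean value integral, $\nabla$ acts in the space variables only, and the integrands on the right-hand side are extended by zero outside $J\times\Omega$ (this matters only if $Q_{2R}\not\subset J\times\Omega$; the right-hand side may then be $+\infty$). -/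

import Mathlib

open MeasureTheory Set Filter Topology
open scoped ContDiff ENNReal NNReal

noncomputable section

/-- Space-time `ℝ^{1+n}`: a point is a pair (time, space). -/
abbrev SpaceTime (n : ℕ) : Type := ℝ × EuclideanSpace ℝ (Fin n)

/-- Real matrices with rows indexed by `ι` and `n` columns. The norm is the Frobenius norm and the
inner product is the Frobenius product `P : Q`. -/
abbrev Mat (ι : Type) (n : ℕ) : Type := EuclideanSpace ℝ (ι × Fin n)

/-! ### Orlicz functions -/

/-- The standing assumptions on the Orlicz function `φ : [0,∞) → [0,∞)` (only its values on
`[0,∞)` matter); `c₁, c₂` are the characteristics, i.e. the constants in `φ'(t) ≂ φ''(t) t`. -/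
structure OrliczAssumption (c₁ c₂ : ℝ) (φ : ℝ → ℝ) : Prop where
  nonneg : ∀ t, 0 ≤ t → 0 ≤ φ t
  convex : ConvexOn ℝ (Ici 0) φ
  contDiffOn_two : ContDiffOn ℝ 2 φ (Ioi 0)
  contDiffOn_one : ContDiffOn ℝ 1 φ (Ici 0)
  map_zero : φ 0 = 0
  deriv_zero : derivWithin φ (Ici 0) 0 = 0
  tendsto_atTop : Tendsto φ atTop atTop
  lower : ∀ t, 0 < t → c₁ * (deriv (deriv φ) t * t) ≤ deriv φ t
  upper : ∀ t, 0 < t → deriv φ t ≤ c₂ * (deriv (deriv φ) t * t)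

/-- The shifted function `φ_a`, with `φ_a(0) = 0` and `(φ_a)'(t) = φ'(a+t) / (a+t) * t`. -/
def shifted (φ : ℝ → ℝ) (a t : ℝ) : ℝ :=
  ∫ s in (0 : ℝ)..t, deriv φ (a + s) / (a + s) * s

/-- `φ_a(λ^{q-1} t) ≤ K λ^q φ_a(t)`, uniformly in `a, t ≥ 0` and `0 ≤ λ ≤ 1`. -/
def ShiftedPowerBound (K q : ℝ) (φ : ℝ → ℝ) : Prop :=
  ∀ a t l : ℝ, 0 ≤ a → 0 ≤ t → 0 ≤ l → l ≤ 1 →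
    shifted φ a (l ^ (q - 1) * t) ≤ K * l ^ q * shifted φ a t

/-- `A(P) = φ'(|P|) P / |P|` (and `A(0) = 0`). -/
def fluxA {ι : Type} [Fintype ι] {n : ℕ} (φ : ℝ → ℝ) (P : Mat ι n) : Mat ι n :=
  (deriv φ ‖P‖ / ‖P‖) • P

/-- `V(P) = √(φ'(|P|) |P|) P / |P|` (and `V(0) = 0`). -/
def fieldV {ι : Type} [Fintype ι] {n : ℕ} (φ : ℝ → ℝ) (P : Mat ι n) : Mat ι n :=
  (Real.sqrt (deriv φ ‖P‖ * ‖P‖) / ‖P‖) • P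

/-! ### Derivatives in space-time -/

/-- Classical time derivative. -/
def timeDeriv {n : ℕ} {E : Type} [NormedAddCommGroup E] [NormedSpace ℝ E]
    (ζ : SpaceTime n → E) (z : SpaceTime n) : E :=
  fderiv ℝ ζ z (1, 0)

/-- Classical partial derivative in the `j`-th space direction. -/
def spaceDeriv {n : ℕ} {E : Type} [NormedAddCommGroup E] [NormedSpace ℝ E]
    (ζ : SpaceTime n → E) (j : Fin n) (z : SpaceTime n) : E :=
  fderiv ℝ ζ z (0, EuclideanSpace.single j 1)

/-- Classical spatial gradient of a scalar function. -/
def spaceGrad {n : ℕ} (ζ : SpaceTime n → ℝ) (z : SpaceTime n) : EuclideanSpace ℝ (Fin n) :=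
  WithLp.toLp 2 fun j => spaceDeriv ζ j z

/-- Classical spatial gradient of a vector-valued function. -/
def spaceJac {ι : Type} [Fintype ι] {n : ℕ} (ζ : SpaceTime n → EuclideanSpace ℝ ι)
    (z : SpaceTime n) : Mat ι n :=
  WithLp.toLp 2 fun p => spaceDeriv ζ p.2 z p.1

/-- `ζ ∈ C_0^∞(U; E)`. -/
def IsTestFunction {n : ℕ} {E : Type} [NormedAddCommGroup E] [NormedSpace ℝ E]
    (U : Set (SpaceTime n)) (ζ : SpaceTime n → E) : Prop :=
  ContDiff ℝ ∞ ζ ∧ HasCompactSupport ζ ∧ tsupport ζ ⊆ U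

/-- `G` is the weak spatial gradient of `w` on the open set `U`: both are locally integrable on `U`
and `G_{ij}` is the weak partial derivative `∂_j w_i`. -/
def IsWeakSpaceGradient {ι : Type} [Fintype ι] {n : ℕ} (U : Set (SpaceTime n))
    (w : SpaceTime n → EuclideanSpace ℝ ι) (G : SpaceTime n → Mat ι n) : Prop :=
  LocallyIntegrableOn w U ∧ LocallyIntegrableOn G U ∧
    ∀ ζ : SpaceTime n → ℝ, IsTestFunction U ζ → ∀ (i : ι) (j : Fin n),
      ∫ z in U, w z i * spaceDeriv ζ j z = - ∫ z in U, G z (i, j) * ζ z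

/-- `∫_U |g|² < ∞` locally in `U`. -/
def SqLocallyIntegrableOn {n : ℕ} {E : Type} [NormedAddCommGroup E]
    (g : SpaceTime n → E) (U : Set (SpaceTime n)) : Prop :=
  LocallyIntegrableOn (fun z => ‖g z‖ ^ 2) U

/-- `u` is a local weak solution of `∂_t u - div (φ'(|∇u|) ∇u / |∇u|) = 0` on `J × Ω`, with weak
spatial gradient `∇u = G`. -/
structure IsLocalWeakSolution {n N : ℕ} (φ : ℝ → ℝ) (J : Set ℝ)
    (Ω : Set (EuclideanSpace ℝ (Fin n))) (u : SpaceTime n → EuclideanSpace ℝ (Fin N))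
    (G : SpaceTime n → Mat (Fin N) n) : Prop where
  weakGradient : IsWeakSpaceGradient (J ×ˢ Ω) u G
  /-- `u ∈ L^∞_loc(J; L²_loc(Ω))`. -/
  bounded_sq : ∀ (I : Set ℝ) (K : Set (EuclideanSpace ℝ (Fin n))), IsCompact I → IsCompact K →
    I ⊆ J → K ⊆ Ω → ∃ M : ℝ≥0, ∀ᵐ s ∂(volume.restrict I), ∫⁻ x in K, ‖u (s, x)‖ₑ ^ 2 ≤ M
  /-- `φ(|∇u|) ∈ L¹_loc(J × Ω)`. -/
  energy : LocallyIntegrableOn (fun z => φ ‖G z‖) (J ×ˢ Ω)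
  equation : ∀ ζ : SpaceTime n → EuclideanSpace ℝ (Fin N), IsTestFunction (J ×ˢ Ω) ζ →
    ∫ z in J ×ˢ Ω, inner ℝ (fluxA φ (G z)) (spaceJac ζ z)
      = ∫ z in J ×ˢ Ω, inner ℝ (u z) (timeDeriv ζ z)

/-! ### Cylinders and cut-off functions -/

/-- The cylinder `Q_R = (t₀ - α R², t₀) × B_R(x₀)`. -/
def cyl {n : ℕ} (t₀ : ℝ) (x₀ : EuclideanSpace ℝ (Fin n)) (α R : ℝ) : Set (SpaceTime n) :=
  Ioo (t₀ - α * R ^ 2) t₀ ×ˢ Metric.ball x₀ R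

/-- `η ∈ C_{0,par}^∞(Q_R) = C_0^∞(Q_R ∪ {t₀} × B_R(x₀))`, extended by zero to all times `≤ t₀`, with
`0 ≤ η ≤ 1`: smooth up to the final time `t₀`, where it need not vanish. The values of `η` at
times `> t₀` play no role. -/
structure IsParabolicCutoff {n : ℕ} (t₀ : ℝ) (x₀ : EuclideanSpace ℝ (Fin n)) (α R : ℝ)
    (η : SpaceTime n → ℝ) : Prop where
  smooth : ContDiffOn ℝ ∞ η (Iic t₀ ×ˢ univ)
  support : ∃ K : Set (SpaceTime n), IsCompact K ∧
    K ⊆ Ioc (t₀ - α * R ^ 2) t₀ ×ˢ Metric.ball x₀ R ∧ ∀ z, z.1 ≤ t₀ → z ∉ K → η z = 0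
  nonneg : ∀ z, z.1 ≤ t₀ → 0 ≤ η z
  le_one : ∀ z, z.1 ≤ t₀ → η z ≤ 1

/-- The energy estimate on `Q_R` with cut-off function `η`, for the gradient `G = ∇u` and
`H = ∇V(∇u)`. All terms are `[0,∞]`-valued, `⨍⁻` is the mean value integral, the supremum in time is
the essential one, and on the right-hand side the integrands are extended by zero outside `U`. -/
def EnergyEstimate {n N : ℕ} (C : ℝ≥0) (q : ℝ) (φ : ℝ → ℝ) (U : Set (SpaceTime n))
    (G : SpaceTime n → Mat (Fin N) n) (H : SpaceTime n → Mat (Fin N × Fin n) n)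
    (t₀ : ℝ) (x₀ : EuclideanSpace ℝ (Fin n)) (α R : ℝ) (η : SpaceTime n → ℝ) : Prop :=
  essSup (fun s => ENNReal.ofReal (1 / α) *
        ⨍⁻ x in Metric.ball x₀ R, ‖G (s, x)‖ₑ ^ 2 * ENNReal.ofReal (η (s, x) ^ q) ∂volume)
      (volume.restrict (Ioo (t₀ - α * R ^ 2) t₀))
    + ENNReal.ofReal (R ^ 2) *
        ⨍⁻ z in cyl t₀ x₀ α R, ‖H z‖ₑ ^ 2 * ENNReal.ofReal (η z ^ q) ∂volume
  ≤ C * (ENNReal.ofReal (R ^ 2) *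
        (⨍⁻ z in cyl t₀ x₀ α (2 * R), U.indicator (fun z => ‖fieldV φ (G z)‖ₑ ^ 2 *
          (⨆ y ∈ cyl t₀ x₀ α R, ‖spaceGrad η y‖ₑ) ^ 2) z ∂volume)
    + ENNReal.ofReal (R ^ 2) *
        ⨍⁻ z in cyl t₀ x₀ α (2 * R), U.indicator (fun z => ‖G z‖ₑ ^ 2 *
          ENNReal.ofReal (η z ^ (q - 1) * |timeDeriv η z|)) z ∂volume)

end

set_option linter.unusedSectionVars false

noncomputable section

/-! ### Pointwise properties of Orlicz functions -/

namespace OrliczAssumption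

variable {c₁ c₂ : ℝ} {φ : ℝ → ℝ}

/-! Write `A(P) = φ'(|P|) P/|P|` and let `Δ` be the increment over the shift `r e_k` in space.
Testing the equation for `Δu` with `ζ Δu` gives `∫ ΔA : Δ∇u ζ + ∫ ΔA : (Δu ⊗ ∇ζ) = ½ ∫ |Δu|² ∂_t ζ`.
As `u` has no time derivative, this identity is proved for mollified functions. The passage to the
limit rests on two-point bounds `|B(y)| |g(y')| ≤ Γ(y) + Γ(y')` with integrable `Γ`, which dominate
products of mollifications by `2 Γ_k`, where `Γ_k` is the mollification of `Γ`; for `A` and `∇u`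
such a bound is Young's inequality in terms of `|V|²`.

Two algebraic facts about `A` and `V` carry the estimate. Strong monotonicity, `|V(P) - V(Q)|² ≤ κ
(A(P) - A(Q)) : (P - Q)`, turns the first term into `∫ |ΔV|² ζ`. For the cross term, `Δu` is the
integral of `∂_k u` along the segment, so one has to bound `|A(P) - A(Q)| |R|` with `R = ∇u` at an
intermediate point; the bound is `F (|V(P) - V(Q)| (|V(P)| + |V(Q)|) + |V(R) - V(Q)|²)`. Since
`|∇ζ|² ≤ M² ζ`, the first summand is absorbed into `∫ |ΔV|² ζ` at the price of `r² |V|²`. The second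
one, integrated over the segment, costs `r B`, where `B` bounds the squared `L²` norms of the
shorter increments of `V` on the support of `ζ`.

This gives a bootstrap: `B = O(1)` holds trivially, so `∫ |ΔV|² = O(r)`; inserting this gives
`O(r²)`. Hence the difference quotients of `V(∇u)` are locally bounded in `L²`, and a weak limit
point is the weak derivative. With `B = O(r²)` the bad term is `O(r³)`, so after division by `r²` it
vanishes as `r → 0`, and the estimate survives with a constant that depends only on the
characteristics and `n`.

Finally `ζ = η^q` times a smooth step that falls from `1` to `0` near a time `s < t₀`. The
derivative of the step is an approximate Dirac mass and produces the time slice of `|∇u|² η^q`. The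
condition `|∇ζ|² ≤ M² ζ` needs `2(q-1) ≥ q`. This is the only role of the power bound (1): near `t =
0` the function `φ_1` is quadratic, so (1) forces `q ≥ 2`. -/

theorem hasDerivAt (h : OrliczAssumption c₁ c₂ φ) {t : ℝ} (ht : 0 < t) :
    HasDerivAt φ (deriv φ t) t :=
  ((h.contDiffOn_two.differentiableOn (by norm_num)).differentiableAt (Ioi_mem_nhds ht)).hasDerivAt

theorem hasDerivAt_deriv (h : OrliczAssumption c₁ c₂ φ) {t : ℝ} (ht : 0 < t) :
    HasDerivAt (deriv φ) (deriv (deriv φ) t) t := by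
  have h1 : ContDiffOn ℝ 1 (deriv φ) (Ioi 0) := by
    have := (contDiffOn_succ_iff_deriv_of_isOpen (n := 1) (𝕜 := ℝ) isOpen_Ioi).1
      (by simpa [one_add_one_eq_two] using h.contDiffOn_two)
    exact this.2.2
  exact ((h1.differentiableOn (by norm_num)).differentiableAt (Ioi_mem_nhds ht)).hasDerivAt

theorem deriv_nonneg (h : OrliczAssumption c₁ c₂ φ) {t : ℝ} (ht : 0 < t) : 0 ≤ deriv φ t := by
  have h1 := h.convex.slope_le_of_hasDerivAt (x := 0) (y := t) (by simp) (by simp [ht.le]) ht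
    (h.hasDerivAt ht)
  refine le_trans ?_ h1
  rw [slope_def_field, h.map_zero]
  have := h.nonneg t ht.le
  have : 0 ≤ t - 0 := by linarith
  positivity

theorem deriv_deriv_nonneg (h : OrliczAssumption c₁ c₂ φ) (hc₂ : 0 < c₂) {t : ℝ} (ht : 0 < t) :
    0 ≤ deriv (deriv φ) t := by
  have h1 := (h.deriv_nonneg ht).trans (h.upper t ht)
  by_contra hn
  push Not at hn
  have : c₂ * (deriv (deriv φ) t * t) < 0 :=
    mul_neg_of_pos_of_neg hc₂ (mul_neg_of_neg_of_pos hn ht)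
  linarith

theorem deriv_mono (h : OrliczAssumption c₁ c₂ φ) (hc₂ : 0 < c₂) :
    MonotoneOn (deriv φ) (Ioi 0) := by
  apply monotoneOn_of_deriv_nonneg (convex_Ioi 0)
  · exact fun t ht => (h.hasDerivAt_deriv ht).continuousAt.continuousWithinAt
  · intro t ht
    rw [interior_Ioi] at ht
    exact (h.hasDerivAt_deriv ht).differentiableAt.differentiableWithinAt
  · intro t ht
    rw [interior_Ioi] at ht
    exact h.deriv_deriv_nonneg hc₂ ht

/-- The lower characteristic says exactly that `φ'(x) x^(-1/c₁)` has nonpositive derivative. -/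
theorem deriv_mul_rpow_le (h : OrliczAssumption c₁ c₂ φ) (hc₁ : 0 < c₁) {s t : ℝ} (hs : 0 < s)
    (hst : s ≤ t) : deriv φ t * s ^ (1 / c₁) ≤ deriv φ s * t ^ (1 / c₁) := by
  have hd : ∀ x ∈ Ioi (0 : ℝ), HasDerivAt (fun x => deriv φ x * x ^ (-(1 / c₁)))
      (deriv (deriv φ) x * x ^ (-(1 / c₁)) + deriv φ x * (-(1 / c₁) * x ^ (-(1 / c₁) - 1))) x :=
    fun x hx => (h.hasDerivAt_deriv hx).mul
      (Real.hasDerivAt_rpow_const (Or.inl (ne_of_gt hx)))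
  have hanti : AntitoneOn (fun x => deriv φ x * x ^ (-(1 / c₁))) (Ioi 0) := by
    apply antitoneOn_of_deriv_nonpos (convex_Ioi 0)
    · exact fun x hx => (hd x hx).continuousAt.continuousWithinAt
    · intro x hx
      rw [interior_Ioi] at hx
      exact (hd x hx).differentiableAt.differentiableWithinAt
    · intro x hx
      rw [interior_Ioi] at hx
      rw [(hd x hx).deriv, Real.rpow_sub_one (ne_of_gt hx)]
      have hx' : 0 < x := hx
      have e : deriv (deriv φ) x * x ^ (-(1 / c₁)) +
          deriv φ x * (-(1 / c₁) * (x ^ (-(1 / c₁)) / x)) =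
          x ^ (-(1 / c₁)) * (c₁ * (deriv (deriv φ) x * x) - deriv φ x) / (c₁ * x) := by
        field_simp
        ring
      rw [e]
      have := h.lower x hx
      apply div_nonpos_of_nonpos_of_nonneg _ (by positivity)
      apply mul_nonpos_of_nonneg_of_nonpos (by positivity) (by linarith)
  have ht := hs.trans_le hst
  have := hanti hs ht hst
  simp only at this
  rw [Real.rpow_neg hs.le, Real.rpow_neg ht.le] at this
  have p1 := Real.rpow_pos_of_pos hs (1 / c₁)
  have p2 := Real.rpow_pos_of_pos ht (1 / c₁)
  rw [← div_eq_mul_inv, ← div_eq_mul_inv, div_le_div_iff₀ p2 p1] at this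
  exact this

/-- The upper characteristic says exactly that `φ'(x) x^(-1/c₂)` has nonnegative derivative. This
power growth yields the bound for the shifted functions. -/
theorem rpow_mul_deriv_le (h : OrliczAssumption c₁ c₂ φ) (hc₂ : 0 < c₂) {s t : ℝ} (hs : 0 < s)
    (hst : s ≤ t) : deriv φ s * t ^ (1 / c₂) ≤ deriv φ t * s ^ (1 / c₂) := by
  have hd : ∀ x ∈ Ioi (0 : ℝ), HasDerivAt (fun x => deriv φ x * x ^ (-(1 / c₂)))
      (deriv (deriv φ) x * x ^ (-(1 / c₂)) + deriv φ x * (-(1 / c₂) * x ^ (-(1 / c₂) - 1))) x :=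
    fun x hx => (h.hasDerivAt_deriv hx).mul
      (Real.hasDerivAt_rpow_const (Or.inl (ne_of_gt hx)))
  have hmono : MonotoneOn (fun x => deriv φ x * x ^ (-(1 / c₂))) (Ioi 0) := by
    apply monotoneOn_of_deriv_nonneg (convex_Ioi 0)
    · exact fun x hx => (hd x hx).continuousAt.continuousWithinAt
    · intro x hx
      rw [interior_Ioi] at hx
      exact (hd x hx).differentiableAt.differentiableWithinAt
    · intro x hx
      rw [interior_Ioi] at hx
      rw [(hd x hx).deriv, Real.rpow_sub_one (ne_of_gt hx)]
      have hx' : 0 < x := hx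
      have e : deriv (deriv φ) x * x ^ (-(1 / c₂)) +
          deriv φ x * (-(1 / c₂) * (x ^ (-(1 / c₂)) / x)) =
          x ^ (-(1 / c₂)) * (c₂ * (deriv (deriv φ) x * x) - deriv φ x) / (c₂ * x) := by
        field_simp
        ring
      rw [e]
      have := h.upper x hx
      apply div_nonneg _ (by positivity)
      apply mul_nonneg (by positivity) (by linarith)
  have ht := hs.trans_le hst
  have := hmono hs ht hst
  simp only at this
  rw [Real.rpow_neg hs.le, Real.rpow_neg ht.le] at this
  have p1 := Real.rpow_pos_of_pos hs (1 / c₂)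
  have p2 := Real.rpow_pos_of_pos ht (1 / c₂)
  rw [← div_eq_mul_inv, ← div_eq_mul_inv, div_le_div_iff₀ p1 p2] at this
  exact this

/-- A single zero of `φ'` spreads to the left by monotonicity and to the right by the power bound;
then `φ` would be constant, against `φ → ∞`. -/
theorem deriv_pos (h : OrliczAssumption c₁ c₂ φ) (hc₁ : 0 < c₁) (hc₂ : 0 < c₂) {t : ℝ}
    (ht : 0 < t) : 0 < deriv φ t := by
  by_contra hn
  have h0 : deriv φ t = 0 := le_antisymm (not_lt.1 hn) (h.deriv_nonneg ht)
  have hz : ∀ s, 0 < s → deriv φ s = 0 := by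
    intro s hs
    apply le_antisymm _ (h.deriv_nonneg hs)
    rcases le_total s t with hst | hst
    · exact (h.deriv_mono hc₂ hs ht hst).trans h0.le
    · have := h.deriv_mul_rpow_le hc₁ ht hst
      rw [h0, zero_mul] at this
      by_contra hp
      push Not at hp
      have := mul_pos hp (Real.rpow_pos_of_pos ht (1 / c₁))
      linarith
  have hconst : ∀ s ∈ Ioi (0 : ℝ), ∀ r ∈ Ioi (0 : ℝ), φ s = φ r := by
    intro s hs r hr
    apply (convex_Ioi (0 : ℝ)).is_const_of_fderivWithin_eq_zero (𝕜 := ℝ)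
      (fun x hx => (h.hasDerivAt hx).differentiableAt.differentiableWithinAt) _ hs hr
    intro x hx
    rw [fderivWithin_of_isOpen isOpen_Ioi hx]
    ext
    simp [hz x hx]
  have := h.tendsto_atTop.eventually (eventually_gt_atTop (φ 1))
  obtain ⟨s, hs1, hs2⟩ := (this.and (eventually_gt_atTop 0)).exists
  rw [hconst s hs2 1 (by simp)] at hs1
  exact lt_irrefl _ hs1

theorem deriv_mul_self_mono (h : OrliczAssumption c₁ c₂ φ) (hc₂ : 0 < c₂) {s t : ℝ} (hs : 0 < s)
    (hst : s ≤ t) : deriv φ s * s ≤ deriv φ t * t :=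
  mul_le_mul (h.deriv_mono hc₂ hs (hs.trans_le hst) hst) hst hs.le
    (h.deriv_nonneg (hs.trans_le hst))

theorem deriv_mul_self_nonneg (h : OrliczAssumption c₁ c₂ φ) {t : ℝ} (ht : 0 ≤ t) :
    0 ≤ deriv φ t * t := by
  rcases ht.eq_or_lt with rfl | ht
  · simp
  · exact mul_nonneg (h.deriv_nonneg ht) ht.le

/-- The difference of the two sides is increasing and vanishes at `0`. The bound converts `φ(|∇u|) ∈
L¹_loc` into `V(∇u) ∈ L²_loc`. -/
theorem deriv_mul_self_le (h : OrliczAssumption c₁ c₂ φ) (hc₁ : 0 < c₁) (hc₂ : 0 < c₂) {t : ℝ}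
    (ht : 0 ≤ t) : deriv φ t * t ≤ (1 + 1 / c₁) * φ t := by
  have hd : ∀ x ∈ Ioi (0 : ℝ), HasDerivAt (fun x => (1 + 1 / c₁) * φ x - deriv φ x * x)
      ((1 + 1 / c₁) * deriv φ x - (deriv (deriv φ) x * x + deriv φ x * 1)) x :=
    fun x hx => ((h.hasDerivAt hx).const_mul _).sub ((h.hasDerivAt_deriv hx).mul (hasDerivAt_id x))
  have hcont : ContinuousOn (fun x => (1 + 1 / c₁) * φ x - deriv φ x * x) (Ici 0) := by
    intro x hx
    rcases (show (0 : ℝ) ≤ x from hx).eq_or_lt with rfl | hx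
    · apply ContinuousWithinAt.sub
      · exact ((h.contDiffOn_one.continuousOn) 0 (by simp)).const_mul _
      · have h1 : Tendsto (fun x : ℝ => deriv φ 1 * x) (𝓝[Ici 0] 0) (𝓝 0) := by
          have : Tendsto (fun x : ℝ => deriv φ 1 * x) (𝓝 0) (𝓝 (deriv φ 1 * 0)) :=
            (continuous_const.mul continuous_id).tendsto 0
          rw [mul_zero] at this
          exact this.mono_left nhdsWithin_le_nhds
        rw [ContinuousWithinAt, mul_zero]
        refine squeeze_zero' (f := fun x => deriv φ x * x) ?_ ?_ h1
        · filter_upwards [self_mem_nhdsWithin] with x hx using h.deriv_mul_self_nonneg hx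
        · filter_upwards [self_mem_nhdsWithin, mem_nhdsWithin_of_mem_nhds (Iio_mem_nhds one_pos)]
            with x hx hx1
          rcases (show (0 : ℝ) ≤ x from hx).eq_or_lt with rfl | hx
          · simp
          · exact mul_le_mul_of_nonneg_right (h.deriv_mono hc₂ hx (by simp) (le_of_lt hx1)) hx.le
    · exact (hd x hx).continuousAt.continuousWithinAt
  have hmono : MonotoneOn (fun x => (1 + 1 / c₁) * φ x - deriv φ x * x) (Ici 0) := by
    apply monotoneOn_of_deriv_nonneg (convex_Ici 0) hcont
    · intro x hx
      rw [interior_Ici] at hx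
      exact (hd x hx).differentiableAt.differentiableWithinAt
    · intro x hx
      rw [interior_Ici] at hx
      rw [(hd x hx).deriv]
      have h1 := h.lower x hx
      have h2 : deriv (deriv φ) x * x ≤ 1 / c₁ * deriv φ x := by
        rw [one_div, ← div_eq_inv_mul, le_div_iff₀ hc₁]
        linarith
      linarith
  have := hmono (by simp : (0 : ℝ) ∈ Ici 0) ht ht
  simp only [h.map_zero, mul_zero, sub_zero] at this
  linarith

/-- The Cauchy–Schwarz bound for the increment of `√(φ'(t) t)`. -/
theorem sqrt_sub_sqrt_sq_le (h : OrliczAssumption c₁ c₂ φ) (hc₁ : 0 < c₁) (hc₂ : 0 < c₂)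
    {q p : ℝ} (hq : 0 < q) (hqp : q ≤ p) :
    (Real.sqrt (deriv φ p * p) - Real.sqrt (deriv φ q * q)) ^ 2 ≤
      ((1 + c₂) ^ 2 / (4 * c₁)) * ((deriv φ p - deriv φ q) * (p - q)) := by
  set k : ℝ := (1 + c₂) ^ 2 / (4 * c₁) with hk
  have hk0 : 0 < k := by positivity
  have hv : ∀ x, 0 < x → HasDerivAt (fun x => Real.sqrt (deriv φ x * x))
      ((deriv (deriv φ) x * x + deriv φ x * 1) / (2 * Real.sqrt (deriv φ x * x))) x :=
    fun x hx => ((h.hasDerivAt_deriv hx).mul (hasDerivAt_id x)).sqrt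
      (mul_pos (h.deriv_pos hc₁ hc₂ hx) hx).ne'
  -- Origin of `k`: the numerator is at most `(1 + c₂) φ''(x) x`, and one factor `c₁ φ''(x) x ≤
  -- φ'(x)` cancels the denominator.
  have hvb : ∀ x, 0 < x → ((deriv (deriv φ) x * x + deriv φ x * 1) /
      (2 * Real.sqrt (deriv φ x * x))) ^ 2 ≤ k * deriv (deriv φ) x := by
    intro x hx
    have h0 := h.deriv_pos hc₁ hc₂ hx
    have h1 := h.deriv_deriv_nonneg hc₂ hx
    rw [div_pow, mul_pow, Real.sq_sqrt (by positivity), div_le_iff₀ (by positivity)]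
    have hu := h.upper x hx
    have hl := h.lower x hx
    set d := deriv (deriv φ) x * x with hd
    have hd0 : 0 ≤ d := by positivity
    have e1 : (d + deriv φ x * 1) ^ 2 ≤ ((1 + c₂) * d) ^ 2 := by
      apply pow_le_pow_left₀ (by positivity)
      linarith
    have e2 : k * deriv (deriv φ) x * (2 ^ 2 * (deriv φ x * x)) =
        ((1 + c₂) ^ 2 / c₁) * (d * deriv φ x) := by
      rw [hk, hd]; field_simp; ring
    rw [e2]
    refine e1.trans ?_
    have e3 : ((1 + c₂) * d) ^ 2 = ((1 + c₂) ^ 2 / c₁) * (d * (c₁ * d)) := by field_simp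
    rw [e3]
    gcongr
  -- Integrated form of `2y ≤ m y² + 1/m` with `y = (√(φ'(x) x))'` and `y² ≤ k φ''(x)`. Keeping `m`
  -- free replaces Cauchy–Schwarz for integrals.
  have key : ∀ m : ℝ, 0 < m → 2 * (Real.sqrt (deriv φ p * p) - Real.sqrt (deriv φ q * q)) ≤
      m * k * (deriv φ p - deriv φ q) + (p - q) / m := by
    intro m hm
    have hanti : AntitoneOn (fun x => 2 * Real.sqrt (deriv φ x * x) -
        (m * k * deriv φ x + x / m)) (Ioi 0) := by
      have hd : ∀ x ∈ Ioi (0 : ℝ), HasDerivAt (fun x => 2 * Real.sqrt (deriv φ x * x) -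
          (m * k * deriv φ x + x / m)) (2 * ((deriv (deriv φ) x * x + deriv φ x * 1) /
            (2 * Real.sqrt (deriv φ x * x))) - (m * k * deriv (deriv φ) x + 1 / m)) x :=
        fun x hx => ((hv x hx).const_mul 2).sub
          (((h.hasDerivAt_deriv hx).const_mul _).add ((hasDerivAt_id x).div_const m))
      apply antitoneOn_of_deriv_nonpos (convex_Ioi 0)
      · exact fun x hx => (hd x hx).continuousAt.continuousWithinAt
      · intro x hx
        rw [interior_Ioi] at hx
        exact (hd x hx).differentiableAt.differentiableWithinAt
      · intro x hx
        rw [interior_Ioi] at hx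
        rw [(hd x hx).deriv]
        have hb := hvb x hx
        set y := (deriv (deriv φ) x * x + deriv φ x * 1) / (2 * Real.sqrt (deriv φ x * x))
        have h2 : 2 * y ≤ m * y ^ 2 + 1 / m := by
          have : m * y ^ 2 + 1 / m - 2 * y = m * (y - 1 / m) ^ 2 := by field_simp; ring
          have h3 : 0 ≤ m * (y - 1 / m) ^ 2 := by positivity
          linarith
        have h3 : m * y ^ 2 ≤ m * k * deriv (deriv φ) x := by
          rw [mul_assoc]; exact mul_le_mul_of_nonneg_left hb hm.le
        linarith
    have := hanti hq (hq.trans_le hqp) hqp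
    simp only at this
    have e : (p - q) / m = p / m - q / m := sub_div _ _ _
    rw [e]
    linarith
  have ha : 0 ≤ deriv φ p - deriv φ q :=
    sub_nonneg.2 (h.deriv_mono hc₂ hq (hq.trans_le hqp) hqp)
  have hb : 0 ≤ p - q := sub_nonneg.2 hqp
  have hx : 0 ≤ Real.sqrt (deriv φ p * p) - Real.sqrt (deriv φ q * q) :=
    sub_nonneg.2 (Real.sqrt_le_sqrt (h.deriv_mul_self_mono hc₂ hq hqp))
  generalize Real.sqrt (deriv φ p * p) - Real.sqrt (deriv φ q * q) = X at key hx ⊢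
  generalize deriv φ p - deriv φ q = Y at key ha ⊢
  generalize p - q = Z at key hb ⊢
  rcases hx.eq_or_lt with rfl | hx
  · simp only [ne_eq, OfNat.ofNat_ne_zero, not_false_eq_true, zero_pow]; positivity
  rcases hb.eq_or_lt with rfl | hb
  · exfalso
    rcases ha.eq_or_lt with rfl | ha
    · have := key 1 one_pos; simp at this; linarith
    · have := key (X / (k * Y)) (by positivity)
      have e : X / (k * Y) * k * Y = X := by field_simp
      rw [e] at this; simp at this; linarith
  -- The optimal choice of `m` turns the family of linear inequalities into `X² ≤ k Y Z`.
  · have := key (Z / X) (by positivity)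
    have e : Z / (Z / X) = X := by field_simp
    rw [e] at this
    have e2 : Z / X * k * Y = (k * (Y * Z)) / X := by field_simp
    rw [e2] at this
    have h3 : X ≤ k * (Y * Z) / X := by linarith
    rw [le_div_iff₀ hx] at h3
    nlinarith

/-- One factor of the left side is controlled by the mean value theorem: on `[q, p]` with `p ≤ 2q`
one has `φ''(x) ≤ φ'(x)/(c₁ x) ≤ 2 φ'(p)/(c₁ p)`. The remaining `(φ'(p) - φ'(q))(p - q)` is at most
the squared increment of `√(φ'(t) t)`, by the arithmetic-geometric mean inequality for the mixed
products `φ'(p) q` and `φ'(q) p`. -/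
theorem deriv_sub_sq_le (h : OrliczAssumption c₁ c₂ φ) (hc₁ : 0 < c₁) (hc₂ : 0 < c₂)
    {q p : ℝ} (hq : 0 < q) (hqp : q ≤ p) (hpq : p ≤ 2 * q) :
    (deriv φ p - deriv φ q) ^ 2 * p ≤ (2 / c₁) * deriv φ p *
      (Real.sqrt (deriv φ p * p) - Real.sqrt (deriv φ q * q)) ^ 2 := by
  have hp := hq.trans_le hqp
  have hAp := h.deriv_pos hc₁ hc₂ hp
  have hAq := h.deriv_pos hc₁ hc₂ hq
  have hA := h.deriv_mono hc₂ hq hp hqp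
  have h1 : (deriv φ p - deriv φ q) * (p - q) ≤
      (Real.sqrt (deriv φ p * p) - Real.sqrt (deriv φ q * q)) ^ 2 := by
    have e1 := Real.sq_sqrt (mul_pos hAp hp).le
    have e2 := Real.sq_sqrt (mul_pos hAq hq).le
    have e3 : Real.sqrt (deriv φ p * p) * Real.sqrt (deriv φ q * q) =
        Real.sqrt (deriv φ p * q) * Real.sqrt (deriv φ q * p) := by
      rw [← Real.sqrt_mul (mul_pos hAp hp).le, ← Real.sqrt_mul (mul_pos hAp hq).le]
      congr 1; ring
    have e4 := Real.sq_sqrt (mul_pos hAp hq).le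
    have e5 := Real.sq_sqrt (mul_pos hAq hp).le
    nlinarith [sq_nonneg (Real.sqrt (deriv φ p * q) - Real.sqrt (deriv φ q * p))]
  have h2 : (deriv φ p - deriv φ q) * p ≤ (2 / c₁) * deriv φ p * (p - q) := by
    have := (convex_Icc q p).image_sub_le_mul_sub_of_deriv_le (f := deriv φ)
      (C := 2 / c₁ * deriv φ p / p)
      (fun x hx => (h.hasDerivAt_deriv (hq.trans_le hx.1)).continuousAt.continuousWithinAt)
      (fun x hx => (h.hasDerivAt_deriv
        (hq.trans_le (interior_subset hx).1)).differentiableAt.differentiableWithinAt)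
      (by
        intro x hx
        replace hx := interior_subset hx
        have hx0 := hq.trans_le hx.1
        have h3 := h.lower x hx0
        have h4 := h.deriv_mono hc₂ hx0 hp hx.2
        rw [le_div_iff₀ hp, div_mul_eq_mul_div, le_div_iff₀ hc₁]
        have h5 := h.deriv_deriv_nonneg hc₂ hx0
        have h6 : p ≤ 2 * x := by linarith [hx.1]
        have h7 : deriv (deriv φ) x * p ≤ deriv (deriv φ) x * (2 * x) :=
          mul_le_mul_of_nonneg_left h6 h5
        nlinarith)
      q (left_mem_Icc.2 hqp) p (right_mem_Icc.2 hqp) hqp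
    rw [div_mul_eq_mul_div, le_div_iff₀ hp] at this
    exact this
  have h3 : 0 ≤ deriv φ p - deriv φ q := sub_nonneg.2 hA
  calc (deriv φ p - deriv φ q) ^ 2 * p
      = (deriv φ p - deriv φ q) * ((deriv φ p - deriv φ q) * p) := by ring
    _ ≤ (deriv φ p - deriv φ q) * ((2 / c₁) * deriv φ p * (p - q)) :=
        mul_le_mul_of_nonneg_left h2 h3
    _ = (2 / c₁) * deriv φ p * ((deriv φ p - deriv φ q) * (p - q)) := by ring
    _ ≤ _ := mul_le_mul_of_nonneg_left h1 (by positivity)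

end OrliczAssumption

/-! ### The fields `A` and `V` -/

namespace OrliczAssumption

variable {c₁ c₂ : ℝ} {φ : ℝ → ℝ} {ι : Type} [Fintype ι] {n : ℕ}

theorem norm_fieldV_sq (h : OrliczAssumption c₁ c₂ φ) (P : Mat ι n) :
    ‖fieldV φ P‖ ^ 2 = deriv φ ‖P‖ * ‖P‖ := by
  rcases eq_or_ne P 0 with rfl | hP
  · simp [fieldV]
  have hp : 0 < ‖P‖ := norm_pos_iff.2 hP
  rw [fieldV, norm_smul, Real.norm_of_nonneg (by positivity), div_mul_cancel₀ _ hp.ne',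
    Real.sq_sqrt (h.deriv_mul_self_nonneg hp.le)]

theorem norm_fluxA (h : OrliczAssumption c₁ c₂ φ) {P : Mat ι n} (hP : P ≠ 0) :
    ‖fluxA φ P‖ = deriv φ ‖P‖ := by
  have hp : 0 < ‖P‖ := norm_pos_iff.2 hP
  rw [fluxA, norm_smul, Real.norm_of_nonneg (div_nonneg (h.deriv_nonneg hp) hp.le),
    div_mul_cancel₀ _ hp.ne']

/-- Young's inequality without conjugate functions: replace the smaller of `|P|`, `|Q|` by the
larger one and use that `φ'` is increasing. As `P` and `Q` are unrelated, this yields the two-point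
bounds needed for mollification. -/
theorem norm_fluxA_mul_norm_le (h : OrliczAssumption c₁ c₂ φ) (hc₂ : 0 < c₂) (P Q : Mat ι n) :
    ‖fluxA φ P‖ * ‖Q‖ ≤ ‖fieldV φ P‖ ^ 2 + ‖fieldV φ Q‖ ^ 2 := by
  rcases eq_or_ne P 0 with rfl | hP
  · simp only [fluxA, smul_zero, norm_zero, zero_mul]; positivity
  rcases eq_or_ne Q 0 with rfl | hQ
  · simp only [norm_zero, mul_zero]; positivity
  have hp : 0 < ‖P‖ := norm_pos_iff.2 hP
  have hq : 0 < ‖Q‖ := norm_pos_iff.2 hQ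
  rw [h.norm_fluxA hP, h.norm_fieldV_sq, h.norm_fieldV_sq]
  have h1 := h.deriv_mul_self_nonneg hp.le
  have h2 := h.deriv_mul_self_nonneg hq.le
  rcases le_total ‖Q‖ ‖P‖ with hl | hl
  · have := mul_le_mul_of_nonneg_left hl (h.deriv_nonneg hp)
    linarith
  · have := mul_le_mul_of_nonneg_right (h.deriv_mono hc₂ hp hq hl) hq.le
    linarith

theorem norm_fluxA_le (h : OrliczAssumption c₁ c₂ φ) (hc₂ : 0 < c₂) (P : Mat ι n) :
    ‖fluxA φ P‖ ≤ deriv φ 1 + ‖fieldV φ P‖ ^ 2 := by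
  have h1 := h.deriv_nonneg one_pos
  rcases eq_or_ne P 0 with rfl | hP
  · simp only [fluxA, smul_zero, norm_zero]; positivity
  have hp : 0 < ‖P‖ := norm_pos_iff.2 hP
  rw [h.norm_fluxA hP, h.norm_fieldV_sq]
  rcases le_total ‖P‖ 1 with hl | hl
  · have := h.deriv_mono hc₂ hp (by simp) hl
    have := h.deriv_mul_self_nonneg hp.le
    linarith
  · have := mul_le_mul_of_nonneg_left hl (h.deriv_nonneg hp)
    linarith

/-- Separation of radial and angular parts, the factor `1 - P:Q/(|P||Q|)` being the angular one. The
increments of `A` and of `V` both have this form, so comparing them reduces to scalar inequalities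
for the coefficients. -/
theorem norm_sub_smul_sq {F : Type*} [NormedAddCommGroup F] [InnerProductSpace ℝ F] {P Q : F}
    (hP : P ≠ 0) (hQ : Q ≠ 0) (a b : ℝ) :
    ‖(a / ‖P‖) • P - (b / ‖Q‖) • Q‖ ^ 2 =
      (a - b) ^ 2 + 2 * (a * b) * (1 - inner ℝ P Q / (‖P‖ * ‖Q‖)) := by
  have hp : ‖P‖ ≠ 0 := norm_ne_zero_iff.2 hP
  have hq : ‖Q‖ ≠ 0 := norm_ne_zero_iff.2 hQ
  rw [norm_sub_sq_real, norm_smul, norm_smul, inner_smul_left, inner_smul_right]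
  simp only [mul_pow, norm_div, Real.norm_eq_abs, div_pow, sq_abs, conj_trivial]
  field_simp
  ring

theorem inner_sub_smul {F : Type*} [NormedAddCommGroup F] [InnerProductSpace ℝ F] {P Q : F}
    (hP : P ≠ 0) (hQ : Q ≠ 0) (a b : ℝ) :
    inner ℝ ((a / ‖P‖) • P - (b / ‖Q‖) • Q) (P - Q) =
      (a - b) * (‖P‖ - ‖Q‖) + (a * ‖Q‖ + b * ‖P‖) * (1 - inner ℝ P Q / (‖P‖ * ‖Q‖)) := by
  have hp : ‖P‖ ≠ 0 := norm_ne_zero_iff.2 hP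
  have hq : ‖Q‖ ≠ 0 := norm_ne_zero_iff.2 hQ
  simp only [inner_sub_left, inner_sub_right, inner_smul_left, conj_trivial,
    real_inner_self_eq_norm_sq, real_inner_comm P Q]
  field_simp
  ring

theorem one_sub_inner_div_nonneg {F : Type*} [NormedAddCommGroup F] [InnerProductSpace ℝ F]
    (P Q : F) : 0 ≤ 1 - inner ℝ P Q / (‖P‖ * ‖Q‖) :=
  sub_nonneg.2 (div_le_one_of_le₀ (real_inner_le_norm P Q) (by positivity))

/-- Strong monotonicity of `A` in terms of `V`. -/
theorem norm_fieldV_sub_sq_le (h : OrliczAssumption c₁ c₂ φ) (hc₁ : 0 < c₁) (hc₂ : 0 < c₂)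
    (P Q : Mat ι n) :
    ‖fieldV φ P - fieldV φ Q‖ ^ 2 ≤
      (1 + (1 + c₂) ^ 2 / (4 * c₁)) * inner ℝ (fluxA φ P - fluxA φ Q) (P - Q) := by
  set k : ℝ := (1 + c₂) ^ 2 / (4 * c₁) with hk
  have hk0 : 0 < k := by positivity
  have key0 : ∀ P : Mat ι n, ‖fieldV φ P‖ ^ 2 ≤ (1 + k) * inner ℝ (fluxA φ P) P := by
    intro P
    rw [fluxA, inner_smul_left, real_inner_self_eq_norm_sq, h.norm_fieldV_sq, conj_trivial]
    rcases eq_or_ne P 0 with rfl | hP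
    · simp
    have hp : 0 < ‖P‖ := norm_pos_iff.2 hP
    have e : deriv φ ‖P‖ / ‖P‖ * ‖P‖ ^ 2 = deriv φ ‖P‖ * ‖P‖ := by field_simp
    rw [e]
    nlinarith [h.deriv_mul_self_nonneg hp.le]
  rcases eq_or_ne P 0 with rfl | hP
  · simpa [fluxA, fieldV] using key0 Q
  rcases eq_or_ne Q 0 with rfl | hQ
  · simpa [fluxA, fieldV] using key0 P
  have aux : ∀ P Q : Mat ι n, P ≠ 0 → Q ≠ 0 → ‖Q‖ ≤ ‖P‖ →
      ‖fieldV φ P - fieldV φ Q‖ ^ 2 ≤ (1 + k) * inner ℝ (fluxA φ P - fluxA φ Q) (P - Q) := by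
    intro P Q hP hQ hle
    have hp : 0 < ‖P‖ := norm_pos_iff.2 hP
    have hq : 0 < ‖Q‖ := norm_pos_iff.2 hQ
    unfold fieldV fluxA
    rw [norm_sub_smul_sq hP hQ, inner_sub_smul hP hQ]
    have h1 := h.sqrt_sub_sqrt_sq_le hc₁ hc₂ hq hle
    have h2 := one_sub_inner_div_nonneg P Q
    set κ := 1 - inner ℝ P Q / (‖P‖ * ‖Q‖)
    set p := ‖P‖
    set q := ‖Q‖
    have hAp := h.deriv_pos hc₁ hc₂ hp
    have hAq := h.deriv_pos hc₁ hc₂ hq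
    have hA := h.deriv_mono hc₂ hq hp hle
    -- Comparison of the angular coefficients: the arithmetic-geometric mean inequality after
    -- regrouping the four factors under the roots as `φ'(p) q` and `φ'(q) p`.
    have h3 : 2 * (Real.sqrt (deriv φ p * p) * Real.sqrt (deriv φ q * q)) ≤
        deriv φ p * q + deriv φ q * p := by
      have e3 : Real.sqrt (deriv φ p * p) * Real.sqrt (deriv φ q * q) =
          Real.sqrt (deriv φ p * q) * Real.sqrt (deriv φ q * p) := by
        rw [← Real.sqrt_mul (mul_pos hAp hp).le, ← Real.sqrt_mul (mul_pos hAp hq).le]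
        congr 1; ring
      have e4 := Real.sq_sqrt (mul_pos hAp hq).le
      have e5 := Real.sq_sqrt (mul_pos hAq hp).le
      nlinarith [sq_nonneg (Real.sqrt (deriv φ p * q) - Real.sqrt (deriv φ q * p))]
    have h4 := mul_le_mul_of_nonneg_right h3 h2
    have h5 : 0 ≤ (deriv φ p - deriv φ q) * (p - q) :=
      mul_nonneg (sub_nonneg.2 hA) (sub_nonneg.2 hle)
    have h6 : 0 ≤ (deriv φ p * q + deriv φ q * p) * κ := by positivity
    nlinarith
  rcases le_total ‖Q‖ ‖P‖ with hle | hle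
  · exact aux P Q hP hQ hle
  · have := aux Q P hQ hP hle
    rwa [norm_sub_rev, ← neg_sub (fluxA φ P), ← neg_sub P Q, inner_neg_neg] at this

/-- Doubling the norm at least doubles `|V|² = φ'(t) t`, so `|V(Q)| ≤ ¾ |V(P)|` and the increment of
`V` is comparable to `V(P)` itself. -/
theorem norm_fieldV_le_four_mul (h : OrliczAssumption c₁ c₂ φ) (hc₂ : 0 < c₂) {P Q : Mat ι n}
    (hle : 2 * ‖Q‖ ≤ ‖P‖) : ‖fieldV φ P‖ ≤ 4 * ‖fieldV φ P - fieldV φ Q‖ := by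
  have h1 : 2 * ‖fieldV φ Q‖ ^ 2 ≤ ‖fieldV φ P‖ ^ 2 := by
    rw [h.norm_fieldV_sq, h.norm_fieldV_sq]
    rcases (norm_nonneg Q).eq_or_lt with h0 | h0
    · rw [← h0]; simpa using h.deriv_mul_self_nonneg (norm_nonneg P)
    · have hp : 0 < ‖P‖ := by linarith
      have h2 := h.deriv_mono hc₂ h0 hp (by linarith)
      have h3 := mul_le_mul_of_nonneg_left hle (h.deriv_nonneg hp)
      have h4 := mul_le_mul_of_nonneg_right h2 h0.le
      nlinarith
  have h2 := norm_sub_norm_le (fieldV φ P) (fieldV φ Q)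
  have h3 : ‖fieldV φ Q‖ ≤ 3 / 4 * ‖fieldV φ P‖ := by
    refine (pow_le_pow_iff_left₀ (by positivity) (by positivity) two_ne_zero).1 ?_
    nlinarith [sq_nonneg ‖fieldV φ P‖]
  linarith

theorem norm_fluxA_sub_le_of_two_mul_le (h : OrliczAssumption c₁ c₂ φ) (hc₂ : 0 < c₂)
    {P Q R : Mat ι n} (hP : ‖P‖ ≤ ‖R‖) (hQ : 2 * ‖Q‖ ≤ ‖R‖) :
    ‖fluxA φ P - fluxA φ Q‖ * ‖R‖ ≤ 32 * ‖fieldV φ R - fieldV φ Q‖ ^ 2 := by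
  have h1 : ∀ S : Mat ι n, ‖S‖ ≤ ‖R‖ → ‖fluxA φ S‖ * ‖R‖ ≤ ‖fieldV φ R‖ ^ 2 := by
    intro S hS
    rcases eq_or_ne S 0 with rfl | hS0
    · simp only [fluxA, smul_zero, norm_zero, zero_mul]; positivity
    have hs : 0 < ‖S‖ := norm_pos_iff.2 hS0
    rw [h.norm_fluxA hS0, h.norm_fieldV_sq]
    exact mul_le_mul_of_nonneg_right (h.deriv_mono hc₂ hs (hs.trans_le hS) hS) (norm_nonneg _)
  have h2 := h1 P hP
  have h3 := h1 Q (by linarith [norm_nonneg Q])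
  have h4 := h.norm_fieldV_le_four_mul hc₂ hQ
  have h5 := mul_le_mul_of_nonneg_right (norm_sub_le (fluxA φ P) (fluxA φ Q)) (norm_nonneg R)
  have h6 : ‖fieldV φ R‖ ^ 2 ≤ (4 * ‖fieldV φ R - fieldV φ Q‖) ^ 2 :=
    pow_le_pow_left₀ (norm_nonneg _) h4 2
  nlinarith

/-- The constant in `norm_fluxA_sub_mul_norm_le`. -/
def fluxConst (c₁ : ℝ) : ℝ := 32 + 2 * (8 + 2 / c₁)

theorem fluxConst_pos (hc₁ : 0 < c₁) : 0 < fluxConst c₁ := by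
  unfold fluxConst; positivity

/-- If `2|Q| ≤ |P|`, no cancellation matters: both fluxes are at most `φ'(|P|)` and `|V(P)|` is
bounded by four times the increment. If the norms are within a factor two, the square of the claim
splits into the radial part, bounded by `deriv_sub_sq_le`, and the angular part. -/
theorem norm_fluxA_sub_mul_max_le (h : OrliczAssumption c₁ c₂ φ) (hc₁ : 0 < c₁) (hc₂ : 0 < c₂)
    {P Q : Mat ι n} (hle : ‖Q‖ ≤ ‖P‖) :
    ‖fluxA φ P - fluxA φ Q‖ * ‖P‖ ≤
      (8 + 2 / c₁) * (‖fieldV φ P - fieldV φ Q‖ * ‖fieldV φ P‖) := by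
  rcases eq_or_ne P 0 with rfl | hP
  · simp [fieldV]
  have hp : 0 < ‖P‖ := norm_pos_iff.2 hP
  have hAp := h.deriv_pos hc₁ hc₂ hp
  have hVp : 0 ≤ ‖fieldV φ P‖ := norm_nonneg _
  rcases le_or_gt (2 * ‖Q‖) ‖P‖ with h2 | h2
  · have h3 := h.norm_fieldV_le_four_mul hc₂ h2
    have h1 : ∀ S : Mat ι n, ‖S‖ ≤ ‖P‖ → ‖fluxA φ S‖ * ‖P‖ ≤ ‖fieldV φ P‖ ^ 2 := by
      intro S hS
      rcases eq_or_ne S 0 with rfl | hS0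
      · simp only [fluxA, smul_zero, norm_zero, zero_mul]; positivity
      have hs : 0 < ‖S‖ := norm_pos_iff.2 hS0
      rw [h.norm_fluxA hS0, h.norm_fieldV_sq]
      exact mul_le_mul_of_nonneg_right (h.deriv_mono hc₂ hs hp hS) (norm_nonneg _)
    have h5 := mul_le_mul_of_nonneg_right (norm_sub_le (fluxA φ P) (fluxA φ Q)) hp.le
    have h6 : 0 ≤ 2 / c₁ * (‖fieldV φ P - fieldV φ Q‖ * ‖fieldV φ P‖) := by positivity
    nlinarith [h1 P le_rfl, h1 Q hle]
  · have hQ : Q ≠ 0 := by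
      rintro rfl
      simp at h2; linarith
    have hq : 0 < ‖Q‖ := norm_pos_iff.2 hQ
    have hAq := h.deriv_pos hc₁ hc₂ hq
    have hA := h.deriv_mono hc₂ hq hp hle
    refine (pow_le_pow_iff_left₀ (by positivity) (by positivity) two_ne_zero).1 ?_
    rw [mul_pow, mul_pow, mul_pow, h.norm_fieldV_sq]
    unfold fieldV fluxA
    rw [norm_sub_smul_sq hP hQ, norm_sub_smul_sq hP hQ]
    have h1 := h.deriv_sub_sq_le hc₁ hc₂ hq hle h2.le
    have hκ := one_sub_inner_div_nonneg P Q
    set κ := 1 - inner ℝ P Q / (‖P‖ * ‖Q‖)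
    set p := ‖P‖
    set q := ‖Q‖
    -- The angular coefficient of `A` against that of `V`; here `φ'(q) ≤ φ'(p)` and `p ≤ 2q` enter.
    have h3 : deriv φ q * p ≤ 2 * (Real.sqrt (deriv φ p * p) * Real.sqrt (deriv φ q * q)) := by
      rw [← Real.sqrt_mul (mul_pos hAp hp).le]
      have : Real.sqrt ((deriv φ q * p / 2) ^ 2) ≤
          Real.sqrt (deriv φ p * p * (deriv φ q * q)) := by
        apply Real.sqrt_le_sqrt
        have a1 : deriv φ q * deriv φ q * (p * p) ≤ deriv φ p * deriv φ q * (p * (2 * q)) := by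
          gcongr
        nlinarith [mul_pos (mul_pos hAp hAq) (mul_pos hp hq)]
      rw [Real.sqrt_sq (by positivity)] at this
      linarith
    have hk : 0 < 2 / c₁ := by positivity
    set k := 2 / c₁
    set X := (Real.sqrt (deriv φ p * p) - Real.sqrt (deriv φ q * q)) ^ 2
    set Y := Real.sqrt (deriv φ p * p) * Real.sqrt (deriv φ q * q)
    have hX : 0 ≤ X := sq_nonneg _
    have hY : 0 ≤ Y := by positivity
    have t1 : (deriv φ p - deriv φ q) ^ 2 * p ^ 2 ≤ k * (X * (deriv φ p * p)) := by
      have := mul_le_mul_of_nonneg_right h1 hp.le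
      nlinarith
    have t2 : 2 * (deriv φ p * deriv φ q) * κ * p ^ 2 ≤ 2 * (2 * Y * κ * (deriv φ p * p)) := by
      have := mul_le_mul_of_nonneg_right h3 (by positivity : 0 ≤ 2 * deriv φ p * κ * p)
      nlinarith
    have t3 : 0 ≤ X * (deriv φ p * p) := by positivity
    have t4 : 0 ≤ 2 * Y * κ * (deriv φ p * p) := by positivity
    have t5 : k ≤ (8 + k) ^ 2 := by nlinarith
    have t6 : 2 ≤ (8 + k) ^ 2 := by nlinarith
    calc ((deriv φ p - deriv φ q) ^ 2 + 2 * (deriv φ p * deriv φ q) * κ) * p ^ 2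
        ≤ k * (X * (deriv φ p * p)) + 2 * (2 * Y * κ * (deriv φ p * p)) := by linarith
      _ ≤ (8 + k) ^ 2 * (X * (deriv φ p * p)) + (8 + k) ^ 2 * (2 * Y * κ * (deriv φ p * p)) := by
          gcongr
      _ = _ := by ring

/-- The increment of `A`, tested with a third matrix `R`. -/
theorem norm_fluxA_sub_mul_norm_le (h : OrliczAssumption c₁ c₂ φ) (hc₁ : 0 < c₁) (hc₂ : 0 < c₂)
    (P Q R : Mat ι n) :
    ‖fluxA φ P - fluxA φ Q‖ * ‖R‖ ≤ fluxConst c₁ *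
      (‖fieldV φ P - fieldV φ Q‖ * (‖fieldV φ P‖ + ‖fieldV φ Q‖) +
        ‖fieldV φ R - fieldV φ Q‖ ^ 2) := by
  have hk : 0 < 2 / c₁ := by positivity
  have hX : 0 ≤ ‖fieldV φ P - fieldV φ Q‖ * ‖fieldV φ P‖ := by positivity
  have hX' : 0 ≤ ‖fieldV φ P - fieldV φ Q‖ * ‖fieldV φ Q‖ := by positivity
  have hY : 0 ≤ ‖fieldV φ R - fieldV φ Q‖ ^ 2 := by positivity
  have hZ := norm_nonneg (fluxA φ P - fluxA φ Q)
  unfold fluxConst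
  rw [mul_add]
  -- If `R` dominates, `|V(R) - V(Q)|²` pays for everything, with the constant `32`. Otherwise `|R|
  -- ≤ 2 max(|P|, |Q|)`, and the two-matrix bound applies with its constant doubled.
  by_cases h1 : ‖P‖ ≤ ‖R‖ ∧ 2 * ‖Q‖ ≤ ‖R‖
  · have := h.norm_fluxA_sub_le_of_two_mul_le hc₂ h1.1 h1.2
    refine this.trans ?_
    have : 0 ≤ (32 + 2 * (8 + 2 / c₁)) *
      (‖fieldV φ P - fieldV φ Q‖ * ‖fieldV φ P‖ + ‖fieldV φ P - fieldV φ Q‖ * ‖fieldV φ Q‖) := by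
      positivity
    have : 0 ≤ (2 * (8 + 2 / c₁)) * ‖fieldV φ R - fieldV φ Q‖ ^ 2 := by positivity
    linarith
  · have hR : ‖R‖ ≤ 2 * max ‖P‖ ‖Q‖ := by
      by_contra hn
      push Not at hn
      apply h1
      have a1 := le_max_left ‖P‖ ‖Q‖
      have a2 := le_max_right ‖P‖ ‖Q‖
      have a3 := norm_nonneg P
      constructor <;> linarith
    have hm : ‖fluxA φ P - fluxA φ Q‖ * max ‖P‖ ‖Q‖ ≤ (8 + 2 / c₁) *
        (‖fieldV φ P - fieldV φ Q‖ * ‖fieldV φ P‖ + ‖fieldV φ P - fieldV φ Q‖ * ‖fieldV φ Q‖) := by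
      rcases le_total ‖Q‖ ‖P‖ with hle | hle
      · rw [max_eq_left hle]
        refine (h.norm_fluxA_sub_mul_max_le hc₁ hc₂ hle).trans ?_
        gcongr; linarith
      · rw [max_eq_right hle, norm_sub_rev, norm_sub_rev (fieldV φ P)]
        refine (h.norm_fluxA_sub_mul_max_le hc₁ hc₂ hle).trans ?_
        rw [norm_sub_rev] at hX
        gcongr; linarith
    have := mul_le_mul_of_nonneg_left hR hZ
    have : 0 ≤ 32 *
      (‖fieldV φ P - fieldV φ Q‖ * ‖fieldV φ P‖ + ‖fieldV φ P - fieldV φ Q‖ * ‖fieldV φ Q‖) := by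
      positivity
    have : 0 ≤ (32 + 2 * (8 + 2 / c₁)) * ‖fieldV φ R - fieldV φ Q‖ ^ 2 := by positivity
    linarith

end OrliczAssumption

/-! ### Shifted functions -/

namespace OrliczAssumption

variable {c₁ c₂ : ℝ} {φ : ℝ → ℝ}

theorem intervalIntegrable_shifted (h : OrliczAssumption c₁ c₂ φ) (hc₂ : 0 < c₂) {a t : ℝ}
    (ha : 0 ≤ a) (ht : 0 ≤ t) :
    IntervalIntegrable (fun s => deriv φ (a + s) / (a + s) * s) volume 0 t := by
  rw [intervalIntegrable_iff_integrableOn_Ioc_of_le ht]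
  apply Measure.integrableOn_of_bounded (M := deriv φ (a + t)) (by simp)
  · have := measurable_deriv φ
    exact Measurable.aestronglyMeasurable (by fun_prop)
  · filter_upwards [ae_restrict_mem measurableSet_Ioc] with s hs
    have h1 : 0 < a + s := by linarith [hs.1]
    have h2 := h.deriv_nonneg h1
    have h3 := h.deriv_mono hc₂ h1 (show 0 < a + t by linarith [hs.1, hs.2]) (by linarith [hs.2])
    have h0 := hs.1
    rw [Real.norm_of_nonneg (by positivity), div_mul_eq_mul_div, div_le_iff₀ h1]
    nlinarith

/-- Take `a = t = 1`. Near zero `φ_1(m) ≥ (φ'(1)/4) m²`, so the hypothesis gives `φ'(1)/4 ≤ K φ_1(1)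
λ^(2-q)`, whose right side would tend to `0` with `λ` if `q < 2`. -/
theorem two_le_of_shiftedPowerBound (h : OrliczAssumption c₁ c₂ φ) (hc₁ : 0 < c₁) (hc₂ : 0 < c₂)
    {q K : ℝ} (hq : 1 < q) (hK : ShiftedPowerBound K q φ) : 2 ≤ q := by
  by_contra hn
  push Not at hn
  have hA := h.deriv_pos hc₁ hc₂ one_pos
  have low : ∀ m : ℝ, 0 ≤ m → m ≤ 1 → deriv φ 1 / 4 * m ^ 2 ≤ shifted φ 1 m := by
    intro m hm hm1
    have e : deriv φ 1 / 4 * m ^ 2 = ∫ s in (0 : ℝ)..m, deriv φ 1 / 2 * s := by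
      rw [intervalIntegral.integral_const_mul, integral_id]; ring
    rw [e, shifted]
    apply intervalIntegral.integral_mono_on hm
      ((continuous_const.mul continuous_id).intervalIntegrable _ _)
      (h.intervalIntegrable_shifted hc₂ zero_le_one hm)
    intro s hs
    have h1 := h.deriv_mono hc₂ (by simp : (0 : ℝ) < 1) (show (0 : ℝ) < 1 + s by linarith [hs.1])
      (by linarith [hs.1])
    apply mul_le_mul_of_nonneg_right _ hs.1
    apply div_le_div₀ (hA.le.trans h1) h1 (by linarith [hs.1]) (by linarith [hs.2])
  have key : ∀ l : ℝ, 0 < l → l ≤ 1 → deriv φ 1 / 4 ≤ K * shifted φ 1 1 * l ^ (2 - q) := by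
    intro l hl hl1
    have h1 := hK 1 1 l zero_le_one zero_le_one hl.le hl1
    rw [mul_one] at h1
    have h2 := (low (l ^ (q - 1)) (by positivity)
      (Real.rpow_le_one hl.le hl1 (by linarith))).trans h1
    have e : l ^ q = l ^ (2 - q) * (l ^ (q - 1)) ^ 2 := by
      rw [← Real.rpow_natCast, ← Real.rpow_mul hl.le, ← Real.rpow_add hl]
      congr 1; push_cast; ring
    rw [e] at h2
    have hp : 0 < (l ^ (q - 1)) ^ 2 := by positivity
    apply le_of_mul_le_mul_right _ hp
    linarith
  have lim : Tendsto (fun l : ℝ => K * shifted φ 1 1 * l ^ (2 - q)) (𝓝[>] 0) (𝓝 0) := by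
    have h1 : ContinuousAt (fun l : ℝ => K * shifted φ 1 1 * l ^ (2 - q)) 0 :=
      continuousAt_const.mul (Real.continuousAt_rpow_const _ _ (Or.inr (by linarith)))
    have h2 := h1.tendsto
    simp only [Real.zero_rpow (by linarith : (2 : ℝ) - q ≠ 0), mul_zero] at h2
    exact h2.mono_left nhdsWithin_le_nhds
  have := ge_of_tendsto lim (by
    filter_upwards [Ioo_mem_nhdsGT (one_pos : (0 : ℝ) < 1)] with l hl using key l hl.1 hl.2.le)
  linarith

/-- Rescaling the integral gives one factor `m`. For the integrands put `x = a + ms` and `y = a +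
s`, so that `m ≤ x/y ≤ 1`. The growth `φ'(x)/φ'(y) ≤ (x/y)^(1/c₂)` leaves `m (x/y)^(1/c₂ - 1)`,
which is at most `m` if `1/c₂ ≥ 1` and at most `m^(1/c₂)` otherwise. -/
theorem shifted_mul_le (h : OrliczAssumption c₁ c₂ φ) (hc₂ : 0 < c₂) {a t m : ℝ}
    (ha : 0 ≤ a) (ht : 0 ≤ t) (hm : 0 < m) (hm1 : m ≤ 1) :
    shifted φ a (m * t) ≤ m ^ (1 + min 1 (1 / c₂)) * shifted φ a t := by
  have e : shifted φ a (m * t) = m * ∫ s in (0 : ℝ)..t,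
      deriv φ (a + m * s) / (a + m * s) * (m * s) := by
    rw [shifted, intervalIntegral.mul_integral_comp_mul_left
      (f := fun s => deriv φ (a + s) / (a + s) * s), mul_zero]
  rw [e, shifted, ← intervalIntegral.integral_const_mul, ← intervalIntegral.integral_const_mul]
  have hθ : 0 < min 1 (1 / c₂) := by positivity
  apply intervalIntegral.integral_mono_on_of_le_Ioo ht
  · have := h.intervalIntegrable_shifted hc₂ ha (by positivity : 0 ≤ m * t)
    have h2 := (this.comp_mul_left (c := m)).const_mul m
    simpa [hm.ne'] using h2
  · exact (h.intervalIntegrable_shifted hc₂ ha ht).const_mul _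
  · intro s hs
    have hs0 := hs.1
    have hx : 0 < a + m * s := by positivity
    have hy : 0 < a + s := by positivity
    have hxy : a + m * s ≤ a + s := by nlinarith
    have hmxy : m * (a + s) ≤ a + m * s := by nlinarith
    have hA := h.deriv_nonneg hy
    have hr := h.rpow_mul_deriv_le hc₂ hx hxy
    have hd : deriv φ (a + m * s) * (m * (a + s)) ≤
        deriv φ (a + s) * (m ^ min 1 (1 / c₂) * (a + m * s)) := by
      rcases le_total 1 (1 / c₂) with hc | hc
      · rw [min_eq_left hc, Real.rpow_one]
        have h1 : (a + m * s) ^ (1 / c₂ - 1) ≤ (a + s) ^ (1 / c₂ - 1) :=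
          Real.rpow_le_rpow hx.le hxy (by linarith)
        have h2 : deriv φ (a + m * s) * (a + s) ≤ deriv φ (a + s) * (a + m * s) := by
          have p1 := Real.rpow_pos_of_pos hy (1 / c₂ - 1)
          apply le_of_mul_le_mul_right _ p1
          have e1 : (a + s) ^ (1 / c₂) = (a + s) * (a + s) ^ (1 / c₂ - 1) := by
            rw [Real.rpow_sub_one hy.ne']; field_simp
          have e2 : (a + m * s) ^ (1 / c₂) = (a + m * s) * (a + m * s) ^ (1 / c₂ - 1) := by
            rw [Real.rpow_sub_one hx.ne']; field_simp
          rw [e1, e2] at hr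
          calc _ = deriv φ (a + m * s) * ((a + s) * (a + s) ^ (1 / c₂ - 1)) := by ring
            _ ≤ _ := hr
            _ = deriv φ (a + s) * (a + m * s) * (a + m * s) ^ (1 / c₂ - 1) := by ring
            _ ≤ _ := by gcongr
        calc _ = m * (deriv φ (a + m * s) * (a + s)) := by ring
          _ ≤ m * (deriv φ (a + s) * (a + m * s)) := by gcongr
          _ = _ := by ring
      · rw [min_eq_right hc]
        have h1 : (m * (a + s)) ^ (1 - 1 / c₂) ≤ (a + m * s) ^ (1 - 1 / c₂) :=
          Real.rpow_le_rpow (by positivity) hmxy (by linarith)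
        have e1 : m * (a + s) = m ^ (1 / c₂) * ((a + s) ^ (1 / c₂)) *
            (m * (a + s)) ^ (1 - 1 / c₂) := by
          rw [← Real.mul_rpow hm.le hy.le, ← Real.rpow_add (by positivity)]
          simp
        have e2 : (a + m * s) = (a + m * s) ^ (1 / c₂) * (a + m * s) ^ (1 - 1 / c₂) := by
          rw [← Real.rpow_add hx]; simp
        have q1 : 0 ≤ m ^ (1 / c₂) := by positivity
        have q2 : 0 ≤ (a + m * s) ^ (1 / c₂) := by positivity
        have q3 : 0 ≤ (a + s) ^ (1 / c₂) := by positivity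
        have q4 : 0 ≤ (m * (a + s)) ^ (1 - 1 / c₂) := by positivity
        calc deriv φ (a + m * s) * (m * (a + s))
            = m ^ (1 / c₂) * (deriv φ (a + m * s) * (a + s) ^ (1 / c₂)) *
              (m * (a + s)) ^ (1 - 1 / c₂) := by conv_lhs => rw [e1]
                                                 ring
          _ ≤ m ^ (1 / c₂) * (deriv φ (a + s) * (a + m * s) ^ (1 / c₂)) *
              (a + m * s) ^ (1 - 1 / c₂) := by gcongr
          _ = deriv φ (a + s) * (m ^ (1 / c₂) *
              ((a + m * s) ^ (1 / c₂) * (a + m * s) ^ (1 - 1 / c₂))) := by ring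
          _ = _ := by rw [← e2]
    rw [Real.rpow_add hm, Real.rpow_one]
    have h3 : deriv φ (a + m * s) / (a + m * s) * m ≤
        m ^ min 1 (1 / c₂) * (deriv φ (a + s) / (a + s)) := by
      rw [div_mul_eq_mul_div, ← mul_div_assoc, div_le_div_iff₀ hx hy]
      linarith
    have h4 := mul_le_mul_of_nonneg_left h3 (mul_pos hm hs0).le
    linarith

end OrliczAssumption

theorem exists_shiftedPowerBound {c₂ : ℝ} (hc₂ : 0 < c₂) :
    ∃ q : ℝ, 1 < q ∧ ∃ K : ℝ, ∀ (c₁ : ℝ) (φ : ℝ → ℝ), OrliczAssumption c₁ c₂ φ →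
      ShiftedPowerBound K q φ := by
  set θ : ℝ := min 1 (1 / c₂) with hθ
  have hθ0 : 0 < θ := by positivity
  -- With `m = λ^(1/θ)` the gain `m^(1+θ)` equals `λ^(1 + 1/θ)`; hence this `q`, and `K = 1`.
  refine ⟨1 + 1 / θ, by linarith [one_div_pos.2 hθ0], 1, ?_⟩
  intro c₁ φ h a t l ha ht hl hl1
  rcases hl.eq_or_lt with rfl | hl
  · rw [Real.zero_rpow, Real.zero_rpow]
    · simp [shifted]
    · positivity
    · have : 0 < 1 / θ := by positivity
      linarith
  have e : 1 + 1 / θ - 1 = 1 / θ := by ring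
  rw [e, one_mul]
  have := h.shifted_mul_le hc₂ ha ht (Real.rpow_pos_of_pos hl (1 / θ))
    (Real.rpow_le_one hl.le hl1 (by positivity))
  rw [← Real.rpow_mul hl.le, ← hθ] at this
  have e2 : 1 / θ * (1 + θ) = 1 + 1 / θ := by field_simp; ring
  rwa [e2] at this

/-! ### A generalized dominated convergence theorem -/

/-- Truncate `F k` to `[-G, G]`: the truncations converge by ordinary dominated convergence. The
truncation error is at most `g k - min (g k) G`, whose integral tends to `0` because the integrals
of `g k` and of `min (g k) G` have the same limit. -/
theorem tendsto_integral_of_tendsto_bound {α : Type*} [MeasurableSpace α] {μ : Measure α}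
    {F g : ℕ → α → ℝ} {f G : α → ℝ} (hF : ∀ k, AEStronglyMeasurable (F k) μ)
    (hg : ∀ k, Integrable (g k) μ) (hG : Integrable G μ) (hFg : ∀ k, ∀ᵐ x ∂μ, |F k x| ≤ g k x)
    (hFf : ∀ᵐ x ∂μ, Tendsto (fun k => F k x) atTop (𝓝 (f x)))
    (hgG : ∀ᵐ x ∂μ, Tendsto (fun k => g k x) atTop (𝓝 (G x)))
    (hint : Tendsto (fun k => ∫ x, g k x ∂μ) atTop (𝓝 (∫ x, G x ∂μ))) :
    Tendsto (fun k => ∫ x, F k x ∂μ) atTop (𝓝 (∫ x, f x ∂μ)) := by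
  have hFg' : ∀ᵐ x ∂μ, ∀ k, |F k x| ≤ g k x := ae_all_iff.2 hFg
  have hG0 : ∀ᵐ x ∂μ, |f x| ≤ G x := by
    filter_upwards [hFg', hFf, hgG] with x h1 h2 h3
    exact le_of_tendsto_of_tendsto' h2.abs h3 h1
  have hm : Tendsto (fun k => ∫ x, min (g k x) (G x) ∂μ) atTop (𝓝 (∫ x, G x ∂μ)) := by
    apply tendsto_integral_of_dominated_convergence G
    · exact fun k => (hg k).aestronglyMeasurable.inf hG.aestronglyMeasurable
    · exact hG
    · intro k
      filter_upwards [hFg', hG0] with x h1 h2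
      have h3 := (abs_nonneg _).trans (h1 k)
      have h4 := (abs_nonneg _).trans h2
      rw [Real.norm_of_nonneg (le_min h3 h4)]
      exact min_le_right _ _
    · filter_upwards [hgG] with x h
      simpa using h.min (tendsto_const_nhds (x := G x))
  have ht : Tendsto (fun k => ∫ x, max (min (F k x) (G x)) (-G x) ∂μ) atTop (𝓝 (∫ x, f x ∂μ)) := by
    apply tendsto_integral_of_dominated_convergence G
    · exact fun k => ((hF k).inf hG.aestronglyMeasurable).sup hG.aestronglyMeasurable.neg
    · exact hG
    · intro k
      filter_upwards [hG0] with x h2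
      have h4 := (abs_nonneg _).trans h2
      rw [Real.norm_eq_abs, abs_le]
      exact ⟨le_max_right _ _, max_le (min_le_right _ _) (by linarith)⟩
    · filter_upwards [hFf, hG0] with x h1 h2
      have := (h1.min (tendsto_const_nhds (x := G x))).max (tendsto_const_nhds (x := -G x))
      rwa [min_eq_left (abs_le.1 h2).2, max_eq_left (abs_le.1 h2).1] at this
  have hFi : ∀ k, Integrable (F k) μ := fun k =>
    (hg k).mono' (hF k) (by simpa [Real.norm_eq_abs] using hFg k)
  have hmi : ∀ k, Integrable (fun x => min (g k x) (G x)) μ := fun k => (hg k).inf hG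
  have hti : ∀ k, Integrable (fun x => max (min (F k x) (G x)) (-G x)) μ := fun k =>
    ((hFi k).inf hG).sup hG.neg
  have hd : Tendsto (fun k => ∫ x, F k x ∂μ - ∫ x, max (min (F k x) (G x)) (-G x) ∂μ) atTop
      (𝓝 0) := by
    have h0 := hint.sub hm
    rw [sub_self] at h0
    refine squeeze_zero_norm (fun k => ?_) h0
    rw [← integral_sub (hFi k) (hti k), ← integral_sub (hg k) (hmi k)]
    refine norm_integral_le_of_norm_le ((hg k).sub (hmi k)) ?_
    filter_upwards [hFg', hG0] with x h1 h2
    have h3 := h1 k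
    have h4 := (abs_nonneg _).trans h2
    rw [abs_le] at h3
    rw [Real.norm_eq_abs, abs_le]
    rcases le_total (F k x) (G x) with h5 | h5 <;> rcases le_total (F k x) (-G x) with h6 | h6 <;>
      rcases le_total (g k x) (G x) with h7 | h7 <;>
      rcases le_total (G x) (-G x) with h8 | h8 <;> simp only [min_eq_left, min_eq_right,
        max_eq_left, max_eq_right, h5, h6, h7, h8] <;> constructor <;> linarith
  have := hd.add ht
  simpa using this

/-! ### Mollification -/

section Mollify

variable {E : Type*} [NormedAddCommGroup E] [NormedSpace ℝ E] [FiniteDimensional ℝ E]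
  [MeasureSpace E] [BorelSpace E] [(volume : Measure E).IsAddHaarMeasure]

/-- A sequence of bump functions with supports shrinking to the origin. -/
def bumpSeq (E : Type*) [NormedAddCommGroup E] (k : ℕ) : ContDiffBump (0 : E) where
  rIn := 1 / (2 * (k + 1))
  rOut := 1 / (k + 1)
  rIn_pos := by positivity
  rIn_lt_rOut := by
    apply one_div_lt_one_div_of_lt (by positivity)
    linarith [(Nat.cast_nonneg k : (0 : ℝ) ≤ k)]

theorem tendsto_bumpSeq_rOut : Tendsto (fun k => (bumpSeq E k).rOut) atTop (𝓝 0) :=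
  tendsto_one_div_add_atTop_nhds_zero_nat

/-- The standard mollifiers. -/
def mollifier (E : Type*) [NormedAddCommGroup E] [NormedSpace ℝ E] [FiniteDimensional ℝ E]
    [MeasureSpace E] (k : ℕ) : E → ℝ :=
  (bumpSeq E k).normed volume

theorem contDiff_mollifier (k : ℕ) : ContDiff ℝ ∞ (mollifier E k) :=
  (bumpSeq E k).contDiff_normed

theorem mollifier_nonneg (k : ℕ) (x : E) : 0 ≤ mollifier E k x :=
  (bumpSeq E k).nonneg_normed x

theorem integral_mollifier (k : ℕ) : ∫ x, mollifier E k x = 1 :=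
  (bumpSeq E k).integral_normed

theorem hasCompactSupport_mollifier (k : ℕ) : HasCompactSupport (mollifier E k) :=
  (bumpSeq E k).hasCompactSupport_normed

theorem tsupport_mollifier (k : ℕ) :
    tsupport (mollifier E k) = Metric.closedBall 0 (bumpSeq E k).rOut :=
  (bumpSeq E k).tsupport_normed_eq

/-- Mollification of a function. -/
def mollify (k : ℕ) (f : E → ℝ) : E → ℝ :=
  convolution (mollifier E k) f (ContinuousLinearMap.lsmul ℝ ℝ) volume

theorem mollify_apply (k : ℕ) (f : E → ℝ) (z : E) :
    mollify k f z = ∫ y, mollifier E k (z - y) * f y := by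
  rw [mollify, convolution_lsmul_swap]
  simp

theorem contDiff_mollify (k : ℕ) {f : E → ℝ} (hf : LocallyIntegrable f) :
    ContDiff ℝ ∞ (mollify k f) :=
  (hasCompactSupport_mollifier k).contDiff_convolution_left _ (contDiff_mollifier k) hf

theorem fderiv_mollify_apply (k : ℕ) {f : E → ℝ} (hf : LocallyIntegrable f) (z v : E) :
    fderiv ℝ (mollify k f) z v = ∫ y, fderiv ℝ (mollifier E k) (z - y) v * f y := by
  have h0 : mollify k f =
      convolution f (mollifier E k) (ContinuousLinearMap.lsmul ℝ ℝ).flip volume :=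
    (convolution_flip _).symm
  have hc1 : ContDiff ℝ 1 (mollifier E k) := (contDiff_mollifier k).of_le (by simp)
  have h1 := (hasCompactSupport_mollifier (E := E) k).hasFDerivAt_convolution_right
    (ContinuousLinearMap.lsmul ℝ ℝ).flip hf hc1 z
  rw [h0, h1.fderiv, convolution_precompR_apply _ hf ((hasCompactSupport_mollifier k).fderiv ℝ)
    (hc1.continuous_fderiv one_ne_zero), convolution_def]
  simp

theorem ae_tendsto_mollify {f : E → ℝ} (hf : LocallyIntegrable f) :
    ∀ᵐ z, Tendsto (fun k => mollify k f z) atTop (𝓝 (f z)) := by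
  apply ContDiffBump.ae_convolution_tendsto_right_of_locallyIntegrable (K := 2)
    tendsto_bumpSeq_rOut _ hf
  filter_upwards with k
  simp only [bumpSeq]
  apply le_of_eq
  field_simp

theorem integrable_mollifier_mul (k : ℕ) {f : E → ℝ} (hf : LocallyIntegrable f) (z : E) :
    Integrable (fun y => mollifier E k (z - y) * f y) := by
  have h2 : ConvolutionExistsAt (mollifier E k) f z (ContinuousLinearMap.lsmul ℝ ℝ) volume :=
    (hasCompactSupport_mollifier k).convolutionExists_left _ (contDiff_mollifier k).continuous hf z
  simpa using h2.integrable_swap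

theorem integrable_mollify (k : ℕ) {f : E → ℝ} (hf : Integrable f) : Integrable (mollify k f) :=
  Integrable.integrable_convolution _
    ((contDiff_mollifier k).continuous.integrable_of_hasCompactSupport
      (hasCompactSupport_mollifier k)) hf

theorem integral_mollify (k : ℕ) {f : E → ℝ} (hf : Integrable f) :
    ∫ z, mollify k f z = ∫ z, f z := by
  have := integral_convolution (μ := (volume : Measure E)) (ν := (volume : Measure E))
    (ContinuousLinearMap.lsmul ℝ ℝ)
    ((contDiff_mollifier (E := E) k).continuous.integrable_of_hasCompactSupport
      (hasCompactSupport_mollifier k)) hf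
  rw [integral_mollifier] at this
  simpa [mollify] using this

/-- The product of two mollifications is a double average of `f(y) g(y')` over independent points
against a probability density. A bound for `f g` on the diagonal would therefore not suffice; the
two-point bound does. -/
theorem abs_mollify_mul_mollify_le (k : ℕ) {f g Γ : E → ℝ} (hf : Integrable f) (hg : Integrable g)
    (hΓ : Integrable Γ) (hfg : ∀ᵐ y, ∀ᵐ y', |f y| * |g y'| ≤ Γ y + Γ y') (z : E) :
    |mollify k f z * mollify k g z| ≤ 2 * mollify k Γ z := by
  have iΓ := integrable_mollifier_mul k hΓ.locallyIntegrable z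
  have iρ : Integrable (fun y => mollifier E k (z - y)) :=
    ((contDiff_mollifier k).continuous.integrable_of_hasCompactSupport
      (hasCompactSupport_mollifier k)).comp_sub_left z
  have hρ : ∫ y, mollifier E k (z - y) = 1 := by
    rw [integral_sub_left_eq_self (fun y => mollifier E k y) volume z, integral_mollifier]
  have bound : ∀ u : E → ℝ, |mollify k u z| ≤ ∫ y, mollifier E k (z - y) * |u y| := by
    intro u
    rw [mollify_apply]
    refine (abs_integral_le_integral_abs).trans_eq ?_
    refine integral_congr_ae (Eventually.of_forall fun y => ?_)
    simp only [abs_mul, abs_of_nonneg (mollifier_nonneg k _)]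
  have if' := integrable_mollifier_mul k hf.abs.locallyIntegrable z
  have ig' := integrable_mollifier_mul k hg.abs.locallyIntegrable z
  have nn : ∀ u : E → ℝ, 0 ≤ ∫ y, mollifier E k (z - y) * |u y| := fun u =>
    integral_nonneg fun y => mul_nonneg (mollifier_nonneg k _) (abs_nonneg _)
  calc |mollify k f z * mollify k g z|
      ≤ (∫ y, mollifier E k (z - y) * |f y|) * ∫ y, mollifier E k (z - y) * |g y| := by
        rw [abs_mul]
        exact mul_le_mul (bound f) (bound g) (abs_nonneg _) (nn f)
    _ = ∫ y, mollifier E k (z - y) * |f y| * ∫ y', mollifier E k (z - y') * |g y'| := by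
        rw [integral_mul_const]
    _ ≤ ∫ y, (mollifier E k (z - y) * Γ y + mollifier E k (z - y) * mollify k Γ z) := by
        refine integral_mono_ae (if'.mul_const _) (iΓ.add (iρ.mul_const _)) ?_
        filter_upwards [hfg] with y hy
        have h1 : |f y| * ∫ y', mollifier E k (z - y') * |g y'| ≤ Γ y + mollify k Γ z := by
          calc |f y| * ∫ y', mollifier E k (z - y') * |g y'|
              = ∫ y', mollifier E k (z - y') * (|f y| * |g y'|) := by
                rw [← integral_const_mul]
                congr 1; ext y'; ring
            _ ≤ ∫ y', (mollifier E k (z - y') * Γ y + mollifier E k (z - y') * Γ y') := by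
                refine integral_mono_ae ?_ ((iρ.mul_const _).add iΓ) ?_
                · refine (ig'.const_mul |f y|).congr (Eventually.of_forall fun y' => ?_)
                  ring
                · filter_upwards [hy] with y' hy'
                  have := mul_le_mul_of_nonneg_left hy' (mollifier_nonneg k (z - y'))
                  linarith
            _ = Γ y + mollify k Γ z := by
                rw [integral_add (iρ.mul_const _) iΓ, integral_mul_const, hρ, one_mul,
                  mollify_apply]
        have := mul_le_mul_of_nonneg_left h1 (mollifier_nonneg k (z - y))
        linarith
    _ = 2 * mollify k Γ z := by
        rw [integral_add iΓ (iρ.mul_const _), integral_mul_const, hρ, ← mollify_apply]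
        ring

/-- The products converge almost everywhere and are dominated by mollifications of `2Γ`, whose
integrals do not depend on `k`; this is the setting of the generalized dominated convergence
theorem. -/
theorem tendsto_integral_mollify_mul_mollify {f g Γ ζ : E → ℝ} (hf : Integrable f)
    (hg : Integrable g) (hΓ : Integrable Γ) (hfg : ∀ᵐ y, ∀ᵐ y', |f y| * |g y'| ≤ Γ y + Γ y')
    (hζ : Continuous ζ) (hζc : HasCompactSupport ζ) :
    Tendsto (fun k => ∫ z, mollify k f z * mollify k g z * ζ z) atTop
      (𝓝 (∫ z, f z * g z * ζ z)) := by
  obtain ⟨C, hC⟩ := hζc.exists_bound_of_continuous hζ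
  have hC0 : 0 ≤ C := (norm_nonneg _).trans (hC 0)
  apply tendsto_integral_of_tendsto_bound (g := fun k z => 2 * mollify k Γ z * C)
    (G := fun z => 2 * Γ z * C)
  · intro k
    exact (((contDiff_mollify k hf.locallyIntegrable).continuous.mul
      (contDiff_mollify k hg.locallyIntegrable).continuous).mul hζ).aestronglyMeasurable
  · exact fun k => ((integrable_mollify k hΓ).const_mul 2).mul_const C
  · exact (hΓ.const_mul 2).mul_const C
  · intro k
    filter_upwards with z
    rw [abs_mul]
    have h1 := abs_mollify_mul_mollify_le k hf hg hΓ hfg z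
    exact mul_le_mul h1 (hC z) (abs_nonneg _) ((abs_nonneg _).trans h1)
  · filter_upwards [ae_tendsto_mollify hf.locallyIntegrable,
      ae_tendsto_mollify hg.locallyIntegrable] with z h1 h2
    exact (h1.mul h2).mul_const _
  · filter_upwards [ae_tendsto_mollify hΓ.locallyIntegrable] with z h
    exact (h.const_mul 2).mul_const C
  · simp only [integral_mul_const, integral_const_mul, integral_mollify _ hΓ]
    exact tendsto_const_nhds

/-! ### The energy identity -/

/-- Smooth real functions with compact support in `W`. -/
def IsTest (W : Set E) (ζ : E → ℝ) : Prop :=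
  ContDiff ℝ ∞ ζ ∧ HasCompactSupport ζ ∧ tsupport ζ ⊆ W

/-- `g` is the weak derivative of `f` in direction `e` on `W`, tested against `C_0^∞(W)`. -/
def IsWeakDeriv (W : Set E) (e : E) (f g : E → ℝ) : Prop :=
  ∀ ζ : E → ℝ, IsTest W ζ → ∫ z, f z * fderiv ℝ ζ z e = - ∫ z, g z * ζ z

theorem fderiv_const_sub_apply {ρ : E → ℝ} (hρ : Differentiable ℝ ρ) (z y v : E) :
    fderiv ℝ (fun y => ρ (z - y)) y v = - fderiv ℝ ρ (z - y) v := by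
  have h1 : HasFDerivAt (fun y => ρ (z - y))
      ((fderiv ℝ ρ (z - y)).comp (-ContinuousLinearMap.id ℝ E)) y :=
    (hρ (z - y)).hasFDerivAt.comp y ((hasFDerivAt_id y).const_sub z)
  rw [h1.fderiv]
  simp

theorem isTest_mollifier_sub {W : Set E} {k : ℕ} {z : E}
    (hz : Metric.closedBall z (bumpSeq E k).rOut ⊆ W) :
    IsTest W (fun y => mollifier E k (z - y)) := by
  have hs : tsupport (fun y => mollifier E k (z - y)) ⊆ Metric.closedBall z (bumpSeq E k).rOut := by
    apply closure_minimal _ Metric.isClosed_closedBall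
    intro y hy
    have : z - y ∈ tsupport (mollifier E k) := subset_tsupport _ hy
    rw [tsupport_mollifier, mem_closedBall_zero_iff] at this
    rwa [Metric.mem_closedBall, dist_comm, dist_eq_norm]
  refine ⟨(contDiff_mollifier k).comp (contDiff_const.sub contDiff_id), ?_, hs.trans hz⟩
  exact HasCompactSupport.of_support_subset_isCompact (isCompact_closedBall z _)
    ((subset_tsupport _).trans hs)

theorem fderiv_mollify_of_isWeakDeriv {W : Set E} {k : ℕ} {z e : E} {f g : E → ℝ}
    (hf : LocallyIntegrable f) (h : IsWeakDeriv W e f g)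
    (hz : Metric.closedBall z (bumpSeq E k).rOut ⊆ W) :
    fderiv ℝ (mollify k f) z e = mollify k g z := by
  have h1 := h _ (isTest_mollifier_sub hz)
  have hd : Differentiable ℝ (mollifier E k) := (contDiff_mollifier k).differentiable (by simp)
  simp only [fderiv_const_sub_apply hd] at h1
  rw [fderiv_mollify_apply k hf, mollify_apply]
  simp only [mul_neg, integral_neg, neg_inj] at h1
  simpa only [mul_comm] using h1

theorem integral_fderiv_mul_eq {f ζ : E → ℝ} (hf : ContDiff ℝ 1 f) (hζ : ContDiff ℝ 1 ζ)
    (hζc : HasCompactSupport ζ) (e : E) :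
    ∫ z, fderiv ℝ f z e * ζ z = - ∫ z, f z * fderiv ℝ ζ z e := by
  have c1 : Continuous fun z => fderiv ℝ f z e :=
    (hf.continuous_fderiv one_ne_zero).clm_apply continuous_const
  have c2 : Continuous fun z => fderiv ℝ ζ z e :=
    (hζ.continuous_fderiv one_ne_zero).clm_apply continuous_const
  have s2 : HasCompactSupport fun z => fderiv ℝ ζ z e := hζc.fderiv_apply (𝕜 := ℝ) e
  rw [integral_mul_fderiv_eq_neg_fderiv_mul_of_integrable, neg_neg]
  · exact (c1.mul hζ.continuous).integrable_of_hasCompactSupport hζc.mul_left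
  · exact (hf.continuous.mul c2).integrable_of_hasCompactSupport s2.mul_left
  · exact (hf.continuous.mul hζ.continuous).integrable_of_hasCompactSupport hζc.mul_left
  · exact fun x _ => hf.differentiable one_ne_zero x
  · exact fun x _ => hζ.differentiable one_ne_zero x

/-- The energy identity for a weak solution of `∂_τ w = Σ_j ∂_{e_j} B_j` with `∂_{e_j} w = g_j`. -/
theorem energy_identity {κ : Type*} [Fintype κ] {W : Set E} (hW : IsOpen W) {τ : E} {e : κ → E}
    {w Γ : E → ℝ} {g B : κ → E → ℝ} (hw : Integrable w) (hg : ∀ j, Integrable (g j))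
    (hB : ∀ j, Integrable (B j)) (hΓ : Integrable Γ)
    (hww : ∀ᵐ y, ∀ᵐ y', |w y| * |w y'| ≤ Γ y + Γ y')
    (hBg : ∀ j, ∀ᵐ y, ∀ᵐ y', |B j y| * |g j y'| ≤ Γ y + Γ y')
    (hBw : ∀ j, ∀ᵐ y, ∀ᵐ y', |B j y| * |w y'| ≤ Γ y + Γ y')
    (hwg : ∀ j, IsWeakDeriv W (e j) w (g j))
    (heq : ∀ ζ, IsTest W ζ →
      ∑ j, ∫ z, B j z * fderiv ℝ ζ z (e j) = ∫ z, w z * fderiv ℝ ζ z τ)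
    {ζ : E → ℝ} (hζ : ContDiff ℝ 1 ζ) (hζc : HasCompactSupport ζ) (hζW : tsupport ζ ⊆ W) :
    ∑ j, ((∫ z, B j z * g j z * ζ z) + ∫ z, B j z * w z * fderiv ℝ ζ z (e j)) =
      1 / 2 * ∫ z, w z * w z * fderiv ℝ ζ z τ := by
  have hwl := hw.locallyIntegrable
  have hBl := fun j => (hB j).locallyIntegrable
  have cd : ∀ v, Continuous fun z => fderiv ℝ ζ z v := fun v =>
    (hζ.continuous_fderiv one_ne_zero).clm_apply continuous_const
  have sd : ∀ v, HasCompactSupport fun z => fderiv ℝ ζ z v := fun v =>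
    hζc.fderiv_apply (𝕜 := ℝ) v
  have l1 : Tendsto (fun k => ∑ j, ((∫ z, mollify k (B j) z * mollify k (g j) z * ζ z) +
      ∫ z, mollify k (B j) z * mollify k w z * fderiv ℝ ζ z (e j))) atTop
      (𝓝 (∑ j, ((∫ z, B j z * g j z * ζ z) + ∫ z, B j z * w z * fderiv ℝ ζ z (e j)))) :=
    tendsto_finsetSum _ fun j _ =>
      (tendsto_integral_mollify_mul_mollify (hB j) (hg j) hΓ (hBg j) hζ.continuous hζc).add
      (tendsto_integral_mollify_mul_mollify (hB j) hw hΓ (hBw j) (cd _) (sd _))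
  have l2 : Tendsto (fun k => 1 / 2 * ∫ z, mollify k w z * mollify k w z * fderiv ℝ ζ z τ) atTop
      (𝓝 (1 / 2 * ∫ z, w z * w z * fderiv ℝ ζ z τ)) :=
    (tendsto_integral_mollify_mul_mollify hw hw hΓ hww (cd _) (sd _)).const_mul _
  refine tendsto_nhds_unique (l1.congr' ?_) l2
  -- For large `k` the kernel centred at any point of the support of `ζ` is supported in `W`, hence
  -- an admissible test function, so the mollified functions solve the equation classically there.
  obtain ⟨δ, hδ, hδW⟩ := hζc.isCompact.exists_cthickening_subset_open hW hζW
  filter_upwards [(tendsto_bumpSeq_rOut (E := E)).eventually (eventually_le_nhds hδ)] with k hk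
  have hball : ∀ z ∈ tsupport ζ, Metric.closedBall z (bumpSeq E k).rOut ⊆ W := fun z hz =>
    ((Metric.closedBall_subset_closedBall hk).trans
      (Metric.closedBall_subset_cthickening hz δ)).trans hδW
  set wk := mollify k w with hwk
  have swk : ContDiff ℝ 1 wk := (contDiff_mollify k hwl).of_le (by simp)
  have sB : ∀ j, ContDiff ℝ 1 (mollify k (B j)) := fun j =>
    (contDiff_mollify k (hBl j)).of_le (by simp)
  have cfd : ∀ {u : E → ℝ}, ContDiff ℝ 1 u → ∀ v, Continuous fun z => fderiv ℝ u z v :=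
    fun hu v => (hu.continuous_fderiv one_ne_zero).clm_apply continuous_const
  have sζ : ContDiff ℝ 1 (fun z => wk z * ζ z) := swk.mul hζ
  have sζc : HasCompactSupport (fun z => wk z * ζ z) := hζc.mul_left
  have dprod : ∀ z v, fderiv ℝ (fun z => wk z * ζ z) z v =
      wk z * fderiv ℝ ζ z v + fderiv ℝ wk z v * ζ z := by
    intro z v
    rw [fderiv_fun_mul (swk.differentiable one_ne_zero z) (hζ.differentiable one_ne_zero z)]
    simp [mul_comm]
  -- the equation for the mollified functions
  have eqk : ∀ z, ∑ j, fderiv ℝ (mollify k (B j)) z (e j) * (wk z * ζ z) =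
      fderiv ℝ wk z τ * (wk z * ζ z) := by
    intro z
    by_cases hz : z ∈ tsupport ζ
    · rw [← Finset.sum_mul]
      congr 1
      have h1 := heq _ (isTest_mollifier_sub (hball z hz))
      have hd : Differentiable ℝ (mollifier E k) := (contDiff_mollifier k).differentiable (by simp)
      simp only [fderiv_const_sub_apply hd, mul_neg, integral_neg, Finset.sum_neg_distrib,
        neg_inj] at h1
      simp only [fderiv_mollify_apply k (hBl _), hwk, fderiv_mollify_apply k hwl]
      simpa only [mul_comm] using h1
    · simp [image_eq_zero_of_notMem_tsupport hz]
  have eqg : ∀ j z, mollify k (B j) z * (fderiv ℝ wk z (e j) * ζ z) =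
      mollify k (B j) z * mollify k (g j) z * ζ z := by
    intro j z
    by_cases hz : z ∈ tsupport ζ
    · rw [hwk, fderiv_mollify_of_isWeakDeriv hwl (hwg j) (hball z hz), mul_assoc]
    · simp [image_eq_zero_of_notMem_tsupport hz]
  have i1 : ∀ j, Integrable fun z => mollify k (B j) z * mollify k (g j) z * ζ z := fun j =>
    ((((sB j).continuous).mul (contDiff_mollify k
      (hg j).locallyIntegrable).continuous).mul hζ.continuous).integrable_of_hasCompactSupport
      hζc.mul_left
  have i2 : ∀ j, Integrable fun z => mollify k (B j) z * wk z * fderiv ℝ ζ z (e j) := fun j =>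
    ((((sB j).continuous).mul swk.continuous).mul (cd _)).integrable_of_hasCompactSupport
      (sd _).mul_left
  have lhs : ∀ j, (∫ z, mollify k (B j) z * mollify k (g j) z * ζ z) +
      ∫ z, mollify k (B j) z * wk z * fderiv ℝ ζ z (e j) =
      - ∫ z, fderiv ℝ (mollify k (B j)) z (e j) * (wk z * ζ z) := by
    intro j
    rw [integral_fderiv_mul_eq (sB j) sζ sζc, neg_neg, ← integral_add (i1 j) (i2 j)]
    congr 1; ext z
    rw [dprod, mul_add, eqg]
    ring
  have i3 : ∀ j, Integrable fun z => fderiv ℝ (mollify k (B j)) z (e j) * (wk z * ζ z) := fun j =>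
    ((cfd (sB j) _).mul sζ.continuous).integrable_of_hasCompactSupport sζc.mul_left
  rw [Finset.sum_congr rfl fun j _ => lhs j, Finset.sum_neg_distrib,
    ← integral_finsetSum _ fun j _ => i3 j]
  simp only [eqk]
  -- Integrating by parts reproduces the same term with opposite sign; this gives the factor `1/2`.
  have h5 := integral_fderiv_mul_eq swk sζ sζc τ
  have i4 : Integrable fun z => wk z * wk z * fderiv ℝ ζ z τ :=
    ((swk.continuous.mul swk.continuous).mul (cd _)).integrable_of_hasCompactSupport (sd _).mul_left
  have i5 : Integrable fun z => fderiv ℝ wk z τ * (wk z * ζ z) :=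
    ((cfd swk _).mul sζ.continuous).integrable_of_hasCompactSupport sζc.mul_left
  have h6 : ∫ z, wk z * fderiv ℝ (fun z => wk z * ζ z) z τ =
      (∫ z, wk z * wk z * fderiv ℝ ζ z τ) + ∫ z, fderiv ℝ wk z τ * (wk z * ζ z) := by
    rw [← integral_add i4 i5]
    congr 1; ext z
    rw [dprod]; ring
  linarith

end Mollify

/-! ### Difference quotients and weak derivatives -/

section DifferenceQuotient

variable {E : Type*} [NormedAddCommGroup E] [NormedSpace ℝ E] [FiniteDimensional ℝ E]
  [MeasureSpace E] [BorelSpace E] [(volume : Measure E).IsAddHaarMeasure]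

theorem IsTest.mono {W W' : Set E} {ζ : E → ℝ} (h : IsTest W ζ) (hW : W ⊆ W') : IsTest W' ζ :=
  ⟨h.1, h.2.1, h.2.2.trans hW⟩

theorem IsTest.comp_sub {W W₀ : Set E} {ζ : E → ℝ} (h : IsTest W₀ ζ) {s : E}
    (hs : ∀ z ∈ W₀, z + s ∈ W) : IsTest W (fun z => ζ (z - s)) := by
  refine ⟨h.1.comp (contDiff_id.sub contDiff_const), ?_, ?_⟩
  · exact h.2.1.comp_homeomorph (Homeomorph.subRight s)
  · intro z hz
    have h1 : z - s ∈ tsupport ζ :=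
      tsupport_comp_subset_preimage ζ (continuous_id.sub continuous_const) hz
    simpa using hs _ (h.2.2 h1)

theorem IsTest.integrable_mul {W : Set E} {ζ f : E → ℝ} (h : IsTest W ζ) (hf : Integrable f) :
    Integrable fun z => f z * ζ z := by
  obtain ⟨C, hC⟩ := h.2.1.exists_bound_of_continuous h.1.continuous
  exact hf.mul_bdd (c := C) h.1.continuous.aestronglyMeasurable (Eventually.of_forall hC)

theorem IsTest.continuous_fderiv_apply {W : Set E} {ζ : E → ℝ} (h : IsTest W ζ) (e : E) :
    Continuous fun z => fderiv ℝ ζ z e :=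
  (h.1.continuous_fderiv (by simp)).clm_apply continuous_const

theorem IsTest.exists_bound_fderiv {W : Set E} {ζ : E → ℝ} (h : IsTest W ζ) (e : E) :
    ∃ C, ∀ z, ‖fderiv ℝ ζ z e‖ ≤ C :=
  (h.2.1.fderiv_apply (𝕜 := ℝ) e).exists_bound_of_continuous (h.continuous_fderiv_apply e)

theorem IsTest.integrable_mul_fderiv {W : Set E} {ζ f : E → ℝ} (h : IsTest W ζ)
    (hf : Integrable f) (e : E) : Integrable fun z => f z * fderiv ℝ ζ z e := by
  obtain ⟨C, hC⟩ := h.exists_bound_fderiv e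
  exact hf.mul_bdd (c := C) (h.continuous_fderiv_apply e).aestronglyMeasurable
    (Eventually.of_forall hC)

theorem integral_sub_shift_mul {f ζ : E → ℝ} {s : E} (h1 : Integrable fun z => f z * ζ (z - s))
    (h2 : Integrable fun z => f z * ζ z) :
    ∫ z, (f (z + s) - f z) * ζ z = (∫ z, f z * ζ (z - s)) - ∫ z, f z * ζ z := by
  have h3 : ∫ z, f z * ζ (z - s) = ∫ z, f (z + s) * ζ z := by
    rw [← integral_add_right_eq_self (fun z => f z * ζ (z - s)) s]
    simp
  have h4 : Integrable fun z => f (z + s) * ζ z := by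
    simpa using h1.comp_add_right s
  rw [h3, ← integral_sub h4 h2]
  congr 1; ext z; ring

theorem IsTest.integral_sub_shift_mul_fderiv {W W₀ : Set E} {f ζ : E → ℝ} (hζ : IsTest W₀ ζ)
    (hf : Integrable f) {s : E} (hsW : ∀ z ∈ W₀, z + s ∈ W) (e : E) :
    ∫ z, (f (z + s) - f z) * fderiv ℝ ζ z e =
      (∫ z, f z * fderiv ℝ (fun z => ζ (z - s)) z e) - ∫ z, f z * fderiv ℝ ζ z e := by
  have h1 := (hζ.comp_sub hsW).integrable_mul_fderiv hf e
  simp only [fderiv_comp_sub] at h1 ⊢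
  exact integral_sub_shift_mul (ζ := fun z => fderiv ℝ ζ z e) h1 (hζ.integrable_mul_fderiv hf e)

theorem IsWeakDeriv.sub_shift {W W₀ : Set E} {e : E} {f g : E → ℝ} (h : IsWeakDeriv W e f g)
    (hf : Integrable f) (hg : Integrable g) (hW : W₀ ⊆ W) {s : E} (hs : ∀ z ∈ W₀, z + s ∈ W) :
    IsWeakDeriv W₀ e (fun z => f (z + s) - f z) (fun z => g (z + s) - g z) := by
  intro ζ hζ
  rw [hζ.integral_sub_shift_mul_fderiv hf hs, h _ (hζ.comp_sub hs), h _ (hζ.mono hW),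
    integral_sub_shift_mul ((hζ.comp_sub hs).integrable_mul hg) (hζ.integrable_mul hg)]
  ring

/-- Translating by `s e` while integrating over `s` preserves the product measure. It makes
integrals along segments measurable and integrable for functions given only almost everywhere. -/
theorem measurePreserving_shear (e : E) (ν : Measure ℝ) [SFinite ν] :
    MeasurePreserving (fun p : ℝ × E => (p.1, p.2 + p.1 • e)) (ν.prod volume)
      (ν.prod volume) := by
  apply MeasurePreserving.skew_product (MeasurePreserving.id ν) (g := fun s z => z + s • e)
  · exact Continuous.measurable (by fun_prop)
  · exact Eventually.of_forall fun s => map_add_right_eq_self volume (s • e)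

theorem integrable_shear {g : E → ℝ} (hg : Integrable g) (e : E) (ν : Measure ℝ)
    [IsFiniteMeasure ν] : Integrable (fun p : ℝ × E => g (p.2 + p.1 • e)) (ν.prod volume) :=
  (measurePreserving_shear e ν).integrable_comp_of_integrable (hg.comp_snd ν)

/-- The fundamental theorem of calculus along lines for weak derivatives. -/
theorem IsWeakDeriv.ae_sub_eq {W W₀ : Set E} {e : E} {f g : E → ℝ} (h : IsWeakDeriv W e f g)
    (hf : Integrable f) (hg : Integrable g) (hW₀ : IsOpen W₀) {r : ℝ} (hr : 0 ≤ r)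
    (hs : ∀ z ∈ W₀, ∀ s ∈ Icc (0 : ℝ) r, z + s • e ∈ W) :
    ∀ᵐ z, z ∈ W₀ → f (z + r • e) - f z = ∫ s in Ioc 0 r, g (z + s • e) := by
  set ν : Measure ℝ := volume.restrict (Ioc 0 r) with hν
  have ig := integrable_shear hg e ν
  have ig2 : Integrable (fun z => ∫ s, g (z + s • e) ∂ν) := ig.integral_prod_right
  have iF : Integrable (fun z => (f (z + r • e) - f z) - ∫ s, g (z + s • e) ∂ν) :=
    ((hf.comp_add_right _).sub hf).sub ig2
  have key := hW₀.ae_eq_zero_of_integral_contDiff_smul_eq_zero (μ := volume)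
    (iF.locallyIntegrable.locallyIntegrableOn W₀) ?_
  · filter_upwards [key] with z hz hzW
    exact sub_eq_zero.1 (hz hzW)
  intro ζ hζ1 hζ2 hζ3
  have hζ : IsTest W₀ ζ := ⟨hζ1, hζ2, hζ3⟩
  have hW : W₀ ⊆ W := fun z hz => by simpa using hs z hz 0 (left_mem_Icc.2 hr)
  have hsr : ∀ z ∈ W₀, z + r • e ∈ W := fun z hz => hs z hz r (right_mem_Icc.2 hr)
  have i1 : Integrable fun z => (f (z + r • e) - f z) * ζ z :=
    hζ.integrable_mul ((hf.comp_add_right _).sub hf)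
  have i2 : Integrable fun z => (∫ s, g (z + s • e) ∂ν) * ζ z := hζ.integrable_mul ig2
  have e0 : ∫ z, ζ z • ((f (z + r • e) - f z) - ∫ s, g (z + s • e) ∂ν) =
      (∫ z, (f (z + r • e) - f z) * ζ z) - ∫ z, (∫ s, g (z + s • e) ∂ν) * ζ z := by
    rw [← integral_sub i1 i2]
    congr 1; ext z; rw [smul_eq_mul]; ring
  rw [e0, integral_sub_shift_mul ((hζ.comp_sub hsr).integrable_mul hf) (hζ.integrable_mul hf)]
  rw [← integral_sub ((hζ.comp_sub hsr).integrable_mul hf) (hζ.integrable_mul hf)]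
  -- The fundamental theorem of calculus is applied to the smooth test function along the segment;
  -- Fubini and the definition of the weak derivative then transfer it to `f`.
  have e1 : ∀ z, f z * ζ (z - r • e) - f z * ζ z =
      ∫ s, - (f z * fderiv ℝ ζ (z - s • e) e) ∂ν := by
    intro z
    have hd : ∀ s ∈ uIcc 0 r, HasDerivAt (fun s => ζ (z - s • e)) (- fderiv ℝ ζ (z - s • e) e) s := by
      intro s _
      have a1 : HasFDerivAt ζ (fderiv ℝ ζ (z - s • e)) (z - s • e) :=
        (hζ.1.differentiable (by simp) _).hasFDerivAt
      have a2 : HasDerivAt (fun s : ℝ => z - s • e) (- e) s := by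
        simpa using ((hasDerivAt_id s).smul_const e).const_sub z
      have a3 := a1.comp_hasDerivAt s a2
      rw [map_neg] at a3
      exact a3
    have hc : Continuous fun s : ℝ => - fderiv ℝ ζ (z - s • e) e :=
      ((hζ.continuous_fderiv_apply e).comp (by fun_prop)).neg
    have := intervalIntegral.integral_eq_sub_of_hasDerivAt hd (hc.intervalIntegrable _ _)
    rw [intervalIntegral.integral_of_le hr] at this
    simp only [zero_smul, sub_zero] at this
    rw [← mul_sub, ← this, ← hν, ← integral_const_mul]
    congr 1; ext s; ring
  simp only [e1]
  obtain ⟨C, hC⟩ := hζ.exists_bound_fderiv e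
  have i3 : Integrable (fun p : E × ℝ => - (f p.1 * fderiv ℝ ζ (p.1 - p.2 • e) e))
      (volume.prod ν) := by
    apply Integrable.neg
    apply (hf.comp_fst ν).mul_bdd (c := C)
    · exact ((hζ.continuous_fderiv_apply e).comp (by fun_prop)).aestronglyMeasurable
    · exact Eventually.of_forall fun p => hC _
  rw [integral_integral_swap (f := fun z s => - (f z * fderiv ℝ ζ (z - s • e) e)) i3]
  obtain ⟨C', hC'⟩ := hζ.2.1.exists_bound_of_continuous hζ.1.continuous
  have i4 : Integrable (fun p : ℝ × E => g (p.2 + p.1 • e) * ζ p.2) (ν.prod volume) := by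
    apply ig.mul_bdd (c := C')
    · exact (hζ.1.continuous.comp continuous_snd).aestronglyMeasurable
    · exact Eventually.of_forall fun p => hC' _
  simp only [← integral_mul_const]
  rw [← integral_integral_swap (f := fun s z => g (z + s • e) * ζ z) i4, sub_eq_zero]
  refine integral_congr_ae ?_
  filter_upwards [ae_restrict_mem measurableSet_Ioc] with s hs'
  have hsW : ∀ z ∈ W₀, z + s • e ∈ W := fun z hz => hs z hz s ⟨hs'.1.le, hs'.2⟩
  have h1 := h _ (hζ.comp_sub hsW)
  simp only [fderiv_comp_sub] at h1
  rw [integral_neg, h1, neg_neg,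
    ← integral_add_right_eq_self (fun z => g z * ζ (z - s • e)) (s • e)]
  simp

/-- Cauchy–Schwarz for the integral of a function over a finite measure space. -/
theorem sq_integral_le {α : Type*} [MeasurableSpace α] {ν : Measure α} [IsFiniteMeasure ν]
    {a : α → ℝ} (ha : Integrable a ν) (ha2 : Integrable (fun s => a s ^ 2) ν) :
    (∫ s, a s ∂ν) ^ 2 ≤ ν.real univ * ∫ s, a s ^ 2 ∂ν := by
  rcases eq_or_ne (ν.real univ) 0 with h0 | h0
  · have : ν = 0 := by
      rw [measureReal_eq_zero_iff] at h0
      exact Measure.measure_univ_eq_zero.1 h0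
    simp [this]
  have hp : 0 < ν.real univ := lt_of_le_of_ne measureReal_nonneg h0.symm
  set m := (∫ s, a s ∂ν) / ν.real univ with hm
  have h1 : 0 ≤ ∫ s, (a s - m) ^ 2 ∂ν := integral_nonneg fun s => sq_nonneg _
  have h2 : ∫ s, (a s - m) ^ 2 ∂ν =
      (∫ s, a s ^ 2 ∂ν) - 2 * m * (∫ s, a s ∂ν) + m ^ 2 * ν.real univ := by
    have e : ∀ s, (a s - m) ^ 2 = a s ^ 2 - 2 * m * a s + m ^ 2 := fun s => by ring
    simp only [e]
    have i1 : Integrable (fun s => a s ^ 2 - 2 * m * a s) ν := ha2.sub (ha.const_mul _)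
    rw [integral_add i1 (integrable_const _), integral_sub ha2 (ha.const_mul _), integral_const_mul, integral_const]
    simp [mul_comm]
  rw [h2] at h1
  have h3 : (∫ s, a s ∂ν) = m * ν.real univ := by rw [hm]; field_simp
  rw [h3] at h1 ⊢
  nlinarith

theorem tendsto_integral_sub_shift_sq {g : E → ℝ} (hg : MemLp g 2) (e : E) :
    Tendsto (fun s : ℝ => ∫ z, (g (z + s • e) - g z) ^ 2) (𝓝 0) (𝓝 0) := by
  have hmp : ∀ s : ℝ, MeasurePreserving (ContinuousMap.addRight (s • e) : C(E, E)) volume volume :=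
    fun s => measurePreserving_add_right volume (s • e)
  have hcont : Continuous fun s : ℝ => (ContinuousMap.addRight (s • e) : C(E, E)) := by
    apply ContinuousMap.continuous_of_continuous_uncurry
    simp only [Function.uncurry_def, ContinuousMap.coe_addRight]
    fun_prop
  have h1 : Tendsto (fun s : ℝ => Lp.compMeasurePreserving _ (hmp s) (hg.toLp g)) (𝓝 0)
      (𝓝 (Lp.compMeasurePreserving _ (hmp 0) (hg.toLp g))) :=
    tendsto_const_nhds.compMeasurePreservingLp (hcont.tendsto 0) hmp (hmp 0) (by simp)
  have h2 := (tendsto_iff_norm_sub_tendsto_zero.1 h1).pow 2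
  simp only [ne_eq, OfNat.ofNat_ne_zero, not_false_eq_true, zero_pow] at h2
  refine h2.congr fun s => ?_
  rw [← real_inner_self_eq_norm_sq, L2.inner_def]
  refine integral_congr_ae ?_
  have a0 := hg.coeFn_toLp
  have a1 := Lp.coeFn_compMeasurePreserving (hg.toLp g) (hmp s)
  have a2 := Lp.coeFn_compMeasurePreserving (hg.toLp g) (hmp 0)
  have a3 := (hmp s).quasiMeasurePreserving.ae_eq_comp a0
  have a4 := (hmp 0).quasiMeasurePreserving.ae_eq_comp a0
  filter_upwards [Lp.coeFn_sub (Lp.compMeasurePreserving _ (hmp s) (hg.toLp g))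
    (Lp.compMeasurePreserving _ (hmp 0) (hg.toLp g)), a1, a2, a3, a4] with z b0 b1 b2 b3 b4
  rw [b0, Pi.sub_apply, b1, b2, b3, b4]
  simp [sq]

/-- Difference quotients converge to the weak derivative in `L²`. -/
theorem IsWeakDeriv.tendsto_integral_sq {W W₀ : Set E} {e : E} {f g : E → ℝ}
    (h : IsWeakDeriv W e f g) (hf : Integrable f) (hg : Integrable g) (hg2 : MemLp g 2)
    (hW₀ : IsOpen W₀) {δ : ℝ} (hδ : 0 < δ) (hs : ∀ z ∈ W₀, ∀ s ∈ Icc (0 : ℝ) δ, z + s • e ∈ W) :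
    Tendsto (fun r : ℝ => ∫ z in W₀, ((f (z + r • e) - f z) / r - g z) ^ 2) (𝓝[>] 0) (𝓝 0) := by
  have hω := tendsto_integral_sub_shift_sq hg2 e
  rw [Metric.tendsto_nhds] at hω ⊢
  intro ε hε
  obtain ⟨ρ, hρ, hρε⟩ := Metric.eventually_nhds_iff.1 (hω (ε / 2) (by positivity))
  filter_upwards [Ioo_mem_nhdsGT (lt_min hδ hρ)] with r hr
  have hr0 : 0 < r := hr.1
  have hrδ : r < δ := hr.2.trans_le (min_le_left _ _)
  have hrρ : r < ρ := hr.2.trans_le (min_le_right _ _)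
  set ν : Measure ℝ := volume.restrict (Ioc 0 r) with hν
  have hνr : ν.real univ = r := by simp [hν, hr0.le]
  have hftc := h.ae_sub_eq hf hg hW₀ hr0.le fun z hz s hs' => hs z hz s ⟨hs'.1, hs'.2.trans hrδ.le⟩
  have igs := integrable_shear hg e ν
  have igc : Integrable (fun p : ℝ × E => g p.2) (ν.prod volume) := hg.comp_snd ν
  have m1 : MemLp (fun p : ℝ × E => g (p.2 + p.1 • e)) 2 (ν.prod volume) :=
    (memLp_two_iff_integrable_sq igs.aestronglyMeasurable).2
      (integrable_shear hg2.integrable_sq e ν)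
  have m2 : MemLp (fun p : ℝ × E => g p.2) 2 (ν.prod volume) :=
    (memLp_two_iff_integrable_sq igc.aestronglyMeasurable).2 (hg2.integrable_sq.comp_snd ν)
  have idiff : Integrable (fun p : ℝ × E => g (p.2 + p.1 • e) - g p.2) (ν.prod volume) :=
    igs.sub igc
  have idiff2 : Integrable (fun p : ℝ × E => (g (p.2 + p.1 • e) - g p.2) ^ 2) (ν.prod volume) :=
    (m1.sub m2).integrable_sq
  have hnn : 0 ≤ ∫ z in W₀, ((f (z + r • e) - f z) / r - g z) ^ 2 :=
    integral_nonneg fun z => sq_nonneg _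
  rw [Real.dist_eq, sub_zero, abs_of_nonneg hnn]
  have iR : Integrable fun z => r⁻¹ * ∫ s, (g (z + s • e) - g z) ^ 2 ∂ν :=
    (idiff2.integral_prod_right).const_mul _
  -- The error of the difference quotient is the average of `g(z + s e) - g(z)` over `0 < s ≤ r`;
  -- Cauchy–Schwarz in `s` reduces the claim to continuity of translations in `L²`.
  have step1 : ∫ z in W₀, ((f (z + r • e) - f z) / r - g z) ^ 2 ≤
      ∫ z, r⁻¹ * ∫ s, (g (z + s • e) - g z) ^ 2 ∂ν := by
    refine le_trans ?_ (setIntegral_le_integral (s := W₀) iR (Eventually.of_forall fun z =>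
      mul_nonneg (by positivity) (integral_nonneg fun s => sq_nonneg _)))
    refine integral_mono_of_nonneg (Eventually.of_forall fun z => sq_nonneg _) iR.integrableOn ?_
    rw [EventuallyLE, ae_restrict_iff' hW₀.measurableSet]
    filter_upwards [hftc, igs.prod_left_ae, idiff.prod_left_ae, idiff2.prod_left_ae]
      with z h1 h2 h3 h4 hz
    have e1 : (f (z + r • e) - f z) / r - g z = r⁻¹ * ∫ s, (g (z + s • e) - g z) ∂ν := by
      rw [h1 hz, integral_sub h2 (integrable_const _), integral_const, hνr]
      field_simp
      simp only [smul_eq_mul]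
      rfl
    rw [e1, mul_pow]
    have h5 := sq_integral_le h3 h4
    rw [hνr] at h5
    calc r⁻¹ ^ 2 * (∫ s, (g (z + s • e) - g z) ∂ν) ^ 2
        ≤ r⁻¹ ^ 2 * (r * ∫ s, (g (z + s • e) - g z) ^ 2 ∂ν) := by gcongr
      _ = r⁻¹ * ∫ s, (g (z + s • e) - g z) ^ 2 ∂ν := by field_simp
  have step2 : ∫ z, r⁻¹ * ∫ s, (g (z + s • e) - g z) ^ 2 ∂ν ≤ ε / 2 := by
    rw [integral_const_mul,
      ← integral_integral_swap (f := fun s z => (g (z + s • e) - g z) ^ 2) idiff2]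
    have : ∫ s, (∫ z, (g (z + s • e) - g z) ^ 2) ∂ν ≤ ∫ s, ε / 2 ∂ν := by
      refine integral_mono_of_nonneg (Eventually.of_forall fun s =>
        integral_nonneg fun z => sq_nonneg _) (integrable_const _) ?_
      filter_upwards [ae_restrict_mem measurableSet_Ioc] with s hs'
      have := hρε (y := s) (by
        rw [Real.dist_eq, sub_zero, abs_of_pos hs'.1]; exact hs'.2.trans_lt hrρ)
      rw [Real.dist_eq, sub_zero] at this
      exact (le_abs_self _).trans this.le
    rw [integral_const, hνr, smul_eq_mul] at this
    calc _ ≤ r⁻¹ * (r * (ε / 2)) := by gcongr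
      _ = ε / 2 := by field_simp
  linarith

/-- Rests on `|a² - b²| ≤ (1 + 1/l)(a - b)² + l b²` for every `l > 0`: first fix `l` small, then use
the `L²` convergence on `W₀`. -/
theorem tendsto_integral_sq_mul_of_tendsto {W₀ : Set E} (hW₀ : MeasurableSet W₀)
    {a : ℝ → E → ℝ} {b ψ : E → ℝ}
    (ha : ∀ r, Integrable (fun z => a r z ^ 2)) (ham : ∀ r, AEStronglyMeasurable (a r))
    (hb : MemLp b 2)
    (h : Tendsto (fun r : ℝ => ∫ z in W₀, (a r z - b z) ^ 2) (𝓝[>] 0) (𝓝 0))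
    (hψ : Continuous ψ) (hψc : HasCompactSupport ψ) (hψW : ∀ z, z ∉ W₀ → ψ z = 0) :
    Tendsto (fun r : ℝ => ∫ z, a r z ^ 2 * ψ z) (𝓝[>] 0) (𝓝 (∫ z, b z ^ 2 * ψ z)) := by
  obtain ⟨C, hC⟩ := hψc.exists_bound_of_continuous hψ
  have hC0 : 0 ≤ C := (norm_nonneg _).trans (hC 0)
  set S := ∫ z, b z ^ 2 with hS
  have hS0 : 0 ≤ S := integral_nonneg fun z => sq_nonneg _
  have hma : ∀ r, MemLp (a r) 2 := fun r => (memLp_two_iff_integrable_sq (ham r)).2 (ha r)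
  have bound : ∀ r, ∀ l : ℝ, 0 < l → |(∫ z, a r z ^ 2 * ψ z) - ∫ z, b z ^ 2 * ψ z| ≤
      C * ((1 + 1 / l) * (∫ z in W₀, (a r z - b z) ^ 2) + l * S) := by
    intro r l hl
    have i1 : Integrable fun z => a r z ^ 2 * ψ z :=
      (ha r).mul_bdd (c := C) hψ.aestronglyMeasurable (Eventually.of_forall hC)
    have i2 : Integrable fun z => b z ^ 2 * ψ z :=
      hb.integrable_sq.mul_bdd (c := C) hψ.aestronglyMeasurable (Eventually.of_forall hC)
    have i3 : Integrable fun z => (a r z - b z) ^ 2 := ((hma r).sub hb).integrable_sq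
    rw [← integral_sub i1 i2, ← Real.norm_eq_abs]
    have i4 : Integrable (fun z => C * ((1 + 1 / l) * (a r z - b z) ^ 2 + l * b z ^ 2)) :=
      ((i3.const_mul _).add (hb.integrable_sq.const_mul _)).const_mul _
    have i5 : Integrable (W₀.indicator
        fun z => C * ((1 + 1 / l) * (a r z - b z) ^ 2 + l * b z ^ 2)) := i4.indicator hW₀
    refine (norm_integral_le_of_norm_le i5 (Eventually.of_forall fun z => ?_)).trans ?_
    · by_cases hz : z ∈ W₀
      · rw [indicator_of_mem hz, ← sub_mul, norm_mul, mul_comm]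
        apply mul_le_mul (hC z) _ (norm_nonneg _) hC0
        rw [Real.norm_eq_abs, abs_le]
        have e : ∀ x y : ℝ, 2 * (x * y) ≤ 1 / l * x ^ 2 + l * y ^ 2 := by
          intro x y
          have : 1 / l * x ^ 2 + l * y ^ 2 - 2 * (x * y) = l * (x / l - y) ^ 2 := by
            field_simp; ring
          have : 0 ≤ l * (x / l - y) ^ 2 := by positivity
          linarith
        have e1 := e (a r z - b z) (b z)
        have e2 := e (a r z - b z) (-b z)
        have e3 := sq_nonneg (a r z - b z)
        constructor <;> nlinarith
      · simp [indicator_of_notMem hz, hψW z hz]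
    · rw [integral_indicator hW₀, integral_const_mul]
      gcongr
      rw [integral_add (i3.const_mul _).integrableOn (hb.integrable_sq.const_mul _).integrableOn,
        integral_const_mul, integral_const_mul]
      gcongr
      exact setIntegral_le_integral hb.integrable_sq (Eventually.of_forall fun z => sq_nonneg _)
  rw [Metric.tendsto_nhds]
  intro ε hε
  set l : ℝ := ε / (2 * (C * S + 1)) with hl
  have hCS : 0 ≤ C * S := by positivity
  have hl0 : 0 < l := by positivity
  have hlim : Tendsto (fun r : ℝ => C * ((1 + 1 / l) * ∫ z in W₀, (a r z - b z) ^ 2)) (𝓝[>] 0)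
      (𝓝 0) := by
    simpa using (h.const_mul (1 + 1 / l)).const_mul C
  filter_upwards [hlim.eventually (gt_mem_nhds (half_pos hε))] with r hr
  rw [Real.dist_eq]
  refine (bound r l hl0).trans_lt ?_
  have : C * (l * S) < ε / 2 := by
    have : C * (l * S) = ε / 2 * (C * S / (C * S + 1)) := by rw [hl]; field_simp
    rw [this]
    have : C * S / (C * S + 1) < 1 := by rw [div_lt_one (by positivity)]; linarith
    nlinarith
  linarith

end DifferenceQuotient

/-! ### Existence, uniqueness and gluing of weak derivatives -/

section WeakDerivExistence

variable {E : Type*} [NormedAddCommGroup E] [NormedSpace ℝ E] [FiniteDimensional ℝ E]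
  [MeasureSpace E] [BorelSpace E] [(volume : Measure E).IsAddHaarMeasure]

/-- Bounded families in a Hilbert space have weak limit points along every filter. -/
theorem exists_weak_limit {H : Type*} [NormedAddCommGroup H] [InnerProductSpace ℝ H]
    [CompleteSpace H] {α : Type*} {l : Filter α} [l.NeBot] {G : α → H} {C : ℝ}
    (hG : ∀ᶠ a in l, ‖G a‖ ≤ C) :
    ∃ U : Ultrafilter α, (U : Filter α) ≤ l ∧ ∃ g : H, ∀ v,
      Tendsto (fun a => inner ℝ (G a) v) U (𝓝 (inner ℝ g v)) := by
  -- By Banach–Alaoglu every ultrafilter on a ball converges weakly, so no separability or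
  -- subsequence is needed.
  refine ⟨Ultrafilter.of l, Ultrafilter.of_le l, ?_⟩
  have hK := WeakDual.isCompact_closedBall (𝕜 := ℝ) (E := H) 0 C
  rw [isCompact_iff_ultrafilter_le_nhds'] at hK
  obtain ⟨x, -, hx⟩ := hK ((Ultrafilter.of l).map
    fun a => StrongDual.toWeakDual (innerSL ℝ (G a))) (by
      rw [Ultrafilter.mem_map]
      apply Ultrafilter.of_le l
      filter_upwards [hG] with a ha
      simp only [mem_preimage, Metric.mem_closedBall, dist_zero_right]
      refine le_trans (le_of_eq ?_) ha
      exact innerSL_apply_norm ℝ (G a))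
  refine ⟨(InnerProductSpace.toDual ℝ H).symm (WeakDual.toStrongDual x), fun v => ?_⟩
  rw [InnerProductSpace.toDual_symm_apply]
  have h1 : Tendsto (fun a => StrongDual.toWeakDual (innerSL ℝ (G a))) (Ultrafilter.of l)
      (𝓝 x) := hx
  exact ((WeakDual.eval_continuous v).tendsto x).comp h1

theorem IsTest.tendsto_slope {W : Set E} {f ζ : E → ℝ} (hζ : IsTest W ζ) (hf : Integrable f)
    (e : E) : Tendsto (fun r : ℝ => ∫ z, f z * ((ζ (z - r • e) - ζ z) / r)) (𝓝[>] 0)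
      (𝓝 (∫ z, f z * - fderiv ℝ ζ z e)) := by
  obtain ⟨K, hK⟩ := hζ.1.lipschitzWith_of_hasCompactSupport hζ.2.1 (by simp)
  apply tendsto_integral_filter_of_dominated_convergence (fun z => ‖f z‖ * (K * ‖e‖))
  · filter_upwards with r
    exact hf.aestronglyMeasurable.mul (Continuous.aestronglyMeasurable
      (((hζ.1.continuous.comp (by fun_prop)).sub hζ.1.continuous).div_const _))
  · filter_upwards [self_mem_nhdsWithin] with r hr
    filter_upwards with z
    rw [norm_mul]
    gcongr
    have h1 := hK.dist_le_mul (z - r • e) z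
    rw [dist_eq_norm, dist_eq_norm, sub_sub_cancel_left, norm_neg, norm_smul] at h1
    have hr' : 0 < ‖r‖ := norm_pos_iff.2 (ne_of_gt hr)
    rw [norm_div, div_le_iff₀ hr']
    linarith
  · exact hf.norm.mul_const _
  · filter_upwards with z
    have a1 : HasFDerivAt ζ (fderiv ℝ ζ (z - (0 : ℝ) • e)) (z - (0 : ℝ) • e) :=
      (hζ.1.differentiable (by simp) _).hasFDerivAt
    have a2 : HasDerivAt (fun s : ℝ => z - s • e) (- e) 0 := by
      simpa using ((hasDerivAt_id (0 : ℝ)).smul_const e).const_sub z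
    have a3 := a1.comp_hasDerivAt (0 : ℝ) a2
    rw [map_neg, zero_smul, sub_zero] at a3
    have a4 := a3.tendsto_slope_zero_right
    refine (a4.congr fun r => ?_).const_mul (f z)
    simp [div_eq_inv_mul]

/-- The difference quotients are bounded in `L²(W)` for small `r` and have a weak limit point.
Paired with a test function, a difference quotient of `f` becomes a backward difference quotient of
the test function, and its limit identifies the limit point as the weak derivative. -/
theorem exists_isWeakDeriv_of_bounded {W : Set E} (hW : MeasurableSet W) {f : E → ℝ}
    (hf : Integrable f) (hf2 : MemLp f 2) {e : E} {C : ℝ}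
    (hC : ∀ᶠ r in 𝓝[>] (0 : ℝ), ∫ z in W, (f (z + r • e) - f z) ^ 2 ≤ C * r ^ 2) :
    ∃ g : E → ℝ, MemLp g 2 ∧ IsWeakDeriv W e f g := by
  have hm : ∀ r : ℝ, MemLp (fun z => (f (z + r • e) - f z) / r) 2 (volume.restrict W) := by
    intro r
    have h1 : MemLp (fun z => f (z + r • e)) 2 :=
      hf2.comp_measurePreserving (measurePreserving_add_right volume (r • e))
    have h2 := ((h1.sub hf2).const_mul r⁻¹).restrict W
    refine h2.ae_eq (Eventually.of_forall fun z => ?_)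
    simp [div_eq_inv_mul]
  have hnorm : ∀ᶠ r in 𝓝[>] (0 : ℝ), ‖(hm r).toLp _‖ ≤ Real.sqrt C := by
    filter_upwards [hC, self_mem_nhdsWithin] with r hr hr0
    apply Real.le_sqrt_of_sq_le
    rw [← real_inner_self_eq_norm_sq, L2.inner_def]
    have e1 : ∫ z in W, inner ℝ ((hm r).toLp _ z) ((hm r).toLp _ z) =
        ∫ z in W, (f (z + r • e) - f z) ^ 2 / r ^ 2 := by
      refine integral_congr_ae ?_
      filter_upwards [(hm r).coeFn_toLp] with z hz
      rw [hz]
      simp only [RCLike.inner_apply, conj_trivial]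
      rw [← div_pow, sq]
    have hr0' : 0 < r := hr0
    rw [e1, integral_div, div_le_iff₀ (by positivity)]
    exact hr
  obtain ⟨U, hU, g, hg⟩ := exists_weak_limit hnorm
  refine ⟨W.indicator g, (memLp_indicator_iff_restrict hW).2 (Lp.memLp g), ?_⟩
  intro ζ hζ
  have hζ2 : MemLp ζ 2 (volume.restrict W) :=
    (hζ.1.continuous.memLp_of_hasCompactSupport hζ.2.1).restrict W
  have h1 := hg (hζ2.toLp ζ)
  have hoff : ∀ z, z ∉ W → ζ z = 0 := fun z hz =>
    image_eq_zero_of_notMem_tsupport fun h => hz (hζ.2.2 h)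
  have e1 : ∀ r : ℝ, inner ℝ ((hm r).toLp _) (hζ2.toLp ζ) =
      ∫ z, f z * ((ζ (z - r • e) - ζ z) / r) := by
    intro r
    rw [L2.inner_def]
    have : ∫ z in W, inner ℝ ((hm r).toLp _ z) (hζ2.toLp ζ z) =
        ∫ z in W, ((f (z + r • e) - f z) * ζ z) / r := by
      refine integral_congr_ae ?_
      filter_upwards [(hm r).coeFn_toLp, hζ2.coeFn_toLp] with z hz1 hz2
      rw [hz1, hz2]
      simp only [RCLike.inner_apply, conj_trivial]
      ring
    rw [this, setIntegral_eq_integral_of_forall_compl_eq_zero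
      fun z hz => by simp [hoff z hz], integral_div]
    have t1 : Integrable fun z => f z * ζ (z - r • e) :=
      (hζ.comp_sub (W := univ) fun _ _ => mem_univ _).integrable_mul hf
    rw [integral_sub_shift_mul t1 (hζ.integrable_mul hf),
      ← integral_sub t1 (hζ.integrable_mul hf), ← integral_div]
    congr 1; ext z; ring
  have e2 : inner ℝ g (hζ2.toLp ζ) = ∫ z, W.indicator g z * ζ z := by
    rw [L2.inner_def]
    have : ∫ z in W, inner ℝ (g z) (hζ2.toLp ζ z) = ∫ z in W, g z * ζ z := by
      refine integral_congr_ae ?_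
      filter_upwards [hζ2.coeFn_toLp] with z hz2
      rw [hz2]
      simp only [RCLike.inner_apply, conj_trivial]
      ring
    rw [this, ← integral_indicator hW]
    congr 1; ext z
    by_cases hz : z ∈ W <;> simp [hz]
  simp only [e1] at h1
  have h2 := tendsto_nhds_unique h1 ((hζ.tendsto_slope hf e).mono_left hU)
  rw [e2] at h2
  rw [h2]
  simp [integral_neg]

theorem IsWeakDeriv.congr {W : Set E} {e : E} {f f' g g' : E → ℝ} (h : IsWeakDeriv W e f g)
    (hf : ∀ᵐ z, z ∈ W → f z = f' z) (hg : ∀ᵐ z, z ∈ W → g z = g' z) : IsWeakDeriv W e f' g' := by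
  intro ζ hζ
  have h1 := h ζ hζ
  have e1 : ∫ z, f z * fderiv ℝ ζ z e = ∫ z, f' z * fderiv ℝ ζ z e := by
    refine integral_congr_ae ?_
    filter_upwards [hf] with z hz
    by_cases hzW : z ∈ W
    · rw [hz hzW]
    · have : fderiv ℝ ζ z = 0 := image_eq_zero_of_notMem_tsupport
        fun hh => hzW (hζ.2.2 (tsupport_fderiv_subset ℝ hh))
      simp [this]
  have e2 : ∫ z, g z * ζ z = ∫ z, g' z * ζ z := by
    refine integral_congr_ae ?_
    filter_upwards [hg] with z hz
    by_cases hzW : z ∈ W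
    · rw [hz hzW]
    · have : ζ z = 0 := image_eq_zero_of_notMem_tsupport fun hh => hzW (hζ.2.2 hh)
      simp [this]
  rw [← e1, ← e2, h1]

theorem IsWeakDeriv.ae_eq {W : Set E} (hW : IsOpen W) {e : E} {f g g' : E → ℝ}
    (h : IsWeakDeriv W e f g) (h' : IsWeakDeriv W e f g') (hg : LocallyIntegrable g)
    (hg' : LocallyIntegrable g') : ∀ᵐ z, z ∈ W → g z = g' z := by
  have key := hW.ae_eq_zero_of_integral_contDiff_smul_eq_zero (μ := volume)
    ((hg.sub hg').locallyIntegrableOn W) (by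
      intro ζ h1 h2 h3
      have a := h ζ ⟨h1, h2, h3⟩
      have b := h' ζ ⟨h1, h2, h3⟩
      have i1 := hg.integrable_smul_left_of_hasCompactSupport h1.continuous h2
      have i2 := hg'.integrable_smul_left_of_hasCompactSupport h1.continuous h2
      simp only [Pi.sub_apply, smul_sub]
      rw [integral_sub i1 i2]
      simp only [smul_eq_mul, mul_comm (ζ _)]
      linarith)
  filter_upwards [key] with z hz hzW
  exact sub_eq_zero.1 (hz hzW)

/-- An exhaustion of an open set by open subsets. -/
def openExhaustion (U : Set E) (j : ℕ) : Set E :=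
  Metric.ball 0 (j + 1) ∩ {z | ((j : ℝ≥0∞) + 1)⁻¹ < Metric.infEDist z Uᶜ}

theorem isOpen_openExhaustion (U : Set E) (j : ℕ) : IsOpen (openExhaustion U j) :=
  Metric.isOpen_ball.inter (isOpen_lt continuous_const Metric.continuous_infEDist)

theorem openExhaustion_mono (U : Set E) : Monotone (openExhaustion U) := by
  intro i j hij
  apply inter_subset_inter
  · apply Metric.ball_subset_ball
    have : (i : ℝ) ≤ j := by exact_mod_cast hij
    linarith
  · intro z hz
    refine lt_of_le_of_lt ?_ (mem_ofPred_eq ▸ hz)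
    gcongr

theorem closure_openExhaustion_subset (U : Set E) (j : ℕ) :
    closure (openExhaustion U j) ⊆ Metric.closedBall 0 (j + 1) ∩
      {z | ((j : ℝ≥0∞) + 1)⁻¹ ≤ Metric.infEDist z Uᶜ} := by
  apply closure_minimal
  · exact inter_subset_inter Metric.ball_subset_closedBall fun z hz => by
      rw [mem_ofPred_eq] at hz ⊢
      exact hz.le
  · exact Metric.isClosed_closedBall.inter
      (isClosed_le continuous_const Metric.continuous_infEDist)

theorem isCompact_closure_openExhaustion (U : Set E) (j : ℕ) :
    IsCompact (closure (openExhaustion U j)) :=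
  (isCompact_closedBall 0 ((j : ℝ) + 1)).of_isClosed_subset isClosed_closure
    ((closure_openExhaustion_subset U j).trans inter_subset_left)

theorem closure_openExhaustion_subset' (U : Set E) (j : ℕ) :
    closure (openExhaustion U j) ⊆ U := by
  intro z hz
  have h1 := (closure_openExhaustion_subset U j hz).2
  by_contra hn
  have h2 : Metric.infEDist z Uᶜ = 0 := Metric.infEDist_zero_of_mem hn
  rw [mem_ofPred_eq, h2] at h1
  simp at h1

theorem exists_subset_openExhaustion {U K : Set E} (hU : IsOpen U) (hK : IsCompact K)
    (hKU : K ⊆ U) : ∃ j, K ⊆ openExhaustion U j := by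
  apply hK.elim_directed_cover _ (isOpen_openExhaustion U) _
    (directed_of_isDirected_le (openExhaustion_mono U))
  intro z hz
  have h1 : 0 < Metric.infEDist z Uᶜ := by
    rw [pos_iff_ne_zero]
    intro h0
    rw [← Metric.mem_closure_iff_infEDist_zero, hU.isClosed_compl.closure_eq] at h0
    exact h0 (hKU hz)
  obtain ⟨a, ha⟩ := ENNReal.exists_inv_nat_lt h1.ne'
  obtain ⟨b, hb⟩ := exists_nat_gt ‖z‖
  refine mem_iUnion.2 ⟨max a b, ?_, ?_⟩
  · rw [mem_ball_zero_iff]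
    have : (b : ℝ) ≤ (max a b : ℕ) := by exact_mod_cast le_max_right a b
    linarith
  · refine lt_of_le_of_lt ?_ ha
    rw [ENNReal.inv_le_inv]
    have : (a : ℝ≥0∞) ≤ (max a b : ℕ) := by exact_mod_cast le_max_left a b
    exact this.trans le_self_add

/-- Local weak derivatives can be glued. -/
theorem exists_isWeakDeriv_of_local {U : Set E} (hU : IsOpen U) {e : E} {f : E → ℝ}
    (h : ∀ W, IsOpen W → IsCompact (closure W) → closure W ⊆ U →
      ∃ g : E → ℝ, MemLp g 2 ∧ IsWeakDeriv W e f g) :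
    ∃ g : E → ℝ, IsWeakDeriv U e f g ∧
      ∀ W, IsCompact (closure W) → closure W ⊆ U → MemLp g 2 (volume.restrict W) := by
  classical
  choose g hg1 hg2 using fun j => h (openExhaustion U j) (isOpen_openExhaustion U j)
    (isCompact_closure_openExhaustion U j) (closure_openExhaustion_subset' U j)
  have hli : ∀ j, LocallyIntegrable (g j) := fun j => (hg1 j).locallyIntegrable (by norm_num)
  have hcon : ∀ i j, i ≤ j → ∀ᵐ z, z ∈ openExhaustion U i → g i z = g j z := fun i j hij =>
    (hg2 i).ae_eq (isOpen_openExhaustion U i)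
      (fun ζ hζ => hg2 j ζ (hζ.mono (openExhaustion_mono U hij))) (hli i) (hli j)
  have hcon' : ∀ᵐ z, ∀ i j, i ≤ j → z ∈ openExhaustion U i → g i z = g j z := by
    rw [ae_all_iff]; intro i
    rw [ae_all_iff]; intro j
    by_cases hij : i ≤ j
    · filter_upwards [hcon i j hij] with z hz _ using hz
    · exact Eventually.of_forall fun z hz => absurd hz hij
  -- At each point the derivative from the first set of the exhaustion that contains it is taken; by
  -- uniqueness all later ones agree with it almost everywhere.
  let G : E → ℝ := fun z =>
    if hz : ∃ j, z ∈ openExhaustion U j then g (Nat.find hz) z else 0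
  have hG : ∀ᵐ z, ∀ j, z ∈ openExhaustion U j → g j z = G z := by
    filter_upwards [hcon'] with z hz j hj
    have hex : ∃ j, z ∈ openExhaustion U j := ⟨j, hj⟩
    simp only [G, dif_pos hex]
    exact (hz _ _ (Nat.find_min' hex hj) (Nat.find_spec hex)).symm
  refine ⟨G, ?_, ?_⟩
  · intro ζ hζ
    obtain ⟨j, hj⟩ := exists_subset_openExhaustion hU hζ.2.1 hζ.2.2
    refine (hg2 j).congr (g' := G) (f' := f) (Eventually.of_forall fun _ _ => rfl) ?_ ζ
      ⟨hζ.1, hζ.2.1, hj⟩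
    filter_upwards [hG] with z hz using hz j
  · intro W hW hWU
    obtain ⟨j, hj⟩ := exists_subset_openExhaustion hU hW hWU
    have h1 : MemLp G 2 (volume.restrict (openExhaustion U j)) := by
      refine ((hg1 j).restrict _).ae_eq ?_
      rw [EventuallyEq, ae_restrict_iff' (isOpen_openExhaustion U j).measurableSet]
      filter_upwards [hG] with z hz using hz j
    exact h1.mono_measure (Measure.restrict_mono (subset_closure.trans hj) le_rfl)

end WeakDerivExistence

/-- The diagonal is a null set of the product, so `y = y'` cannot be inserted directly; the bound is
obtained as a limit of the bound for mollifications. -/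
theorem ae_abs_mul_le_of_ae_ae {E : Type*} [NormedAddCommGroup E] [NormedSpace ℝ E]
    [FiniteDimensional ℝ E] [MeasureSpace E] [BorelSpace E] [(volume : Measure E).IsAddHaarMeasure]
    {f g Γ : E → ℝ} (hf : Integrable f) (hg : Integrable g)
    (hΓ : Integrable Γ) (hfg : ∀ᵐ y, ∀ᵐ y', |f y| * |g y'| ≤ Γ y + Γ y') :
    ∀ᵐ z, |f z * g z| ≤ 2 * Γ z := by
  filter_upwards [ae_tendsto_mollify hf.locallyIntegrable,
    ae_tendsto_mollify hg.locallyIntegrable, ae_tendsto_mollify hΓ.locallyIntegrable] with z h1 h2 h3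
  exact le_of_tendsto_of_tendsto' (h1.mul h2).abs (h3.const_mul 2)
    fun k => abs_mollify_mul_mollify_le k hf hg hΓ hfg z

theorem exists_open_forall_add_smul_mem {E : Type*} [NormedAddCommGroup E] [NormedSpace ℝ E]
    {K W : Set E} (hK : IsCompact K) (hW : IsOpen W) (hKW : K ⊆ W) {e : E} (he : ‖e‖ ≤ 1) :
    ∃ W₀, IsOpen W₀ ∧ K ⊆ W₀ ∧ ∃ δ > 0, ∀ z ∈ W₀, ∀ s ∈ Icc (0 : ℝ) δ, z + s • e ∈ W := by
  obtain ⟨δ, hδ, h⟩ := hK.exists_thickening_subset_open hW hKW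
  refine ⟨Metric.thickening (δ / 2) K, Metric.isOpen_thickening,
    Metric.self_subset_thickening (by positivity) K, δ / 3, by positivity, ?_⟩
  intro z hz s hs
  apply h
  rw [Metric.mem_thickening_iff] at hz ⊢
  obtain ⟨y, hy, hzy⟩ := hz
  refine ⟨y, hy, ?_⟩
  have h1 : dist (z + s • e) z ≤ δ / 3 := by
    rw [dist_eq_norm, add_sub_cancel_left, norm_smul, Real.norm_of_nonneg hs.1]
    calc s * ‖e‖ ≤ (δ / 3) * 1 := mul_le_mul hs.2 he (norm_nonneg _) (by positivity)
      _ = δ / 3 := mul_one _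
  linarith [dist_triangle (z + s • e) z y]

/-! ### Solutions extended to the whole space, and their increments -/

section Localized

variable {n N : ℕ}

instance instIsAddHaarMeasureSpaceTime : (volume : Measure (SpaceTime n)).IsAddHaarMeasure :=
  inferInstanceAs
    ((volume : Measure ℝ).prod (volume : Measure (EuclideanSpace ℝ (Fin n)))).IsAddHaarMeasure

/-- The unit vector in the `j`-th space direction. -/
def dirX (j : Fin n) : SpaceTime n := (0, EuclideanSpace.single j 1)

/-- The unit vector in time direction. -/
def dirT : SpaceTime n := (1, 0)

theorem norm_dirX_le (j : Fin n) : ‖dirX j‖ ≤ 1 := by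
  simp [dirX, Prod.norm_def]

theorem measurable_fluxA (φ : ℝ → ℝ) : Measurable (fluxA φ : Mat (Fin N) n → Mat (Fin N) n) := by
  have := measurable_deriv φ
  unfold fluxA
  fun_prop

theorem measurable_fieldV (φ : ℝ → ℝ) : Measurable (fieldV φ : Mat (Fin N) n → Mat (Fin N) n) := by
  have := measurable_deriv φ
  unfold fieldV
  fun_prop

/-- A weak solution on `W` all of whose relevant quantities are integrable on the whole space. -/
structure IsIntegrableSolution (φ : ℝ → ℝ) (W : Set (SpaceTime n))
    (u : SpaceTime n → EuclideanSpace ℝ (Fin N)) (G : SpaceTime n → Mat (Fin N) n) : Prop where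
  integrable_u : Integrable u
  memLp_u : MemLp u 2
  integrable_grad : Integrable G
  memLp_grad : MemLp G 2
  integrable_flux : Integrable fun z => fluxA φ (G z)
  integrable_field : Integrable fun z => fieldV φ (G z)
  memLp_field : MemLp (fun z => fieldV φ (G z)) 2
  weakGrad : ∀ i j, IsWeakDeriv W (dirX j) (fun z => u z i) (fun z => G z (i, j))
  weakEq : ∀ i (ζ : SpaceTime n → ℝ), IsTest W ζ →
    ∑ j, ∫ z, fluxA φ (G z) (i, j) * fderiv ℝ ζ z (dirX j) = ∫ z, u z i * fderiv ℝ ζ z dirT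

/-- The increment `f(z + s) - f(z)`. -/
def increment {F : Type*} [AddCommGroup F] (s : SpaceTime n) (f : SpaceTime n → F)
    (z : SpaceTime n) : F := f (z + s) - f z

theorem integrable_increment {F : Type*} [NormedAddCommGroup F] {f : SpaceTime n → F}
    (hf : Integrable f) (s : SpaceTime n) : Integrable (increment s f) :=
  (hf.comp_add_right s).sub hf

theorem memLp_increment {F : Type*} [NormedAddCommGroup F] {f : SpaceTime n → F}
    (hf : MemLp f 2) (s : SpaceTime n) : MemLp (increment s f) 2 :=
  (hf.comp_measurePreserving (measurePreserving_add_right volume s)).sub hf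

theorem integrable_apply {ι : Type*} [Fintype ι] {f : SpaceTime n → EuclideanSpace ℝ ι}
    (hf : Integrable f) (i : ι) : Integrable fun z => f z i :=
  (EuclideanSpace.proj (𝕜 := ℝ) i : EuclideanSpace ℝ ι →L[ℝ] ℝ).integrable_comp hf

theorem memLp_apply {ι : Type*} [Fintype ι] {f : SpaceTime n → EuclideanSpace ℝ ι} {p : ℝ≥0∞}
    (hf : MemLp f p) (i : ι) : MemLp (fun z => f z i) p :=
  (EuclideanSpace.proj (𝕜 := ℝ) i : EuclideanSpace ℝ ι →L[ℝ] ℝ).comp_memLp' hf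

theorem abs_apply_le {ι : Type*} [Fintype ι] (x : EuclideanSpace ℝ ι) (i : ι) : |x i| ≤ ‖x‖ :=
  PiLp.norm_apply_le x i

/-- The matrix `a ⊗ b`. -/
def tensor (a : EuclideanSpace ℝ (Fin N)) (b : EuclideanSpace ℝ (Fin n)) : Mat (Fin N) n :=
  WithLp.toLp 2 fun p => a p.1 * b p.2

theorem norm_tensor (a : EuclideanSpace ℝ (Fin N)) (b : EuclideanSpace ℝ (Fin n)) :
    ‖tensor a b‖ = ‖a‖ * ‖b‖ := by
  rw [← sq_eq_sq₀ (norm_nonneg _) (by positivity), mul_pow, EuclideanSpace.norm_sq_eq,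
    EuclideanSpace.norm_sq_eq, EuclideanSpace.norm_sq_eq, Fintype.sum_prod_type,
    Finset.sum_mul_sum]
  simp [tensor, mul_pow]

theorem inner_mat (P Q : Mat (Fin N) n) : inner ℝ P Q = ∑ i, ∑ j, P (i, j) * Q (i, j) := by
  rw [PiLp.inner_apply, Fintype.sum_prod_type]
  simp [mul_comm]

variable {φ : ℝ → ℝ} {W W₀ : Set (SpaceTime n)} {u : SpaceTime n → EuclideanSpace ℝ (Fin N)}
  {G : SpaceTime n → Mat (Fin N) n}

/-- Projection of a matrix to its `k`-th column. -/
def column {ι : Type} [Fintype ι] (k : Fin n) : Mat ι n →L[ℝ] EuclideanSpace ℝ ι :=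
  LinearMap.toContinuousLinearMap
    { toFun := fun P => WithLp.toLp 2 fun i => P (i, k)
      map_add' := fun P Q => by ext i; simp
      map_smul' := fun c P => by ext i; simp }

theorem column_apply {ι : Type} [Fintype ι] (k : Fin n) (P : Mat ι n) (i : ι) :
    column k P i = P (i, k) := rfl

theorem sum_norm_column_sq {ι : Type} [Fintype ι] (P : Mat ι n) :
    ∑ k, ‖column k P‖ ^ 2 = ‖P‖ ^ 2 := by
  simp only [EuclideanSpace.norm_sq_eq, column_apply]
  rw [Finset.sum_comm, Fintype.sum_prod_type]

theorem norm_column_le {ι : Type} [Fintype ι] (k : Fin n) (P : Mat ι n) :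
    ‖column k P‖ ≤ ‖P‖ := by
  rw [← sq_le_sq₀ (norm_nonneg _) (norm_nonneg _), ← sum_norm_column_sq]
  exact Finset.single_le_sum (f := fun k => ‖column k P‖ ^ 2) (fun _ _ => sq_nonneg _)
    (Finset.mem_univ k)

/-- This makes the increment of `u` accessible to pointwise estimates in terms of `∇u` on the
segment, where the algebra of `A` and `V` applies. -/
theorem IsIntegrableSolution.norm_increment_le (L : IsIntegrableSolution φ W u G)
    (hW₀ : IsOpen W₀) {k : Fin n} {r : ℝ} (hr : 0 ≤ r)
    (hs : ∀ z ∈ W₀, ∀ s ∈ Icc (0 : ℝ) r, z + s • dirX k ∈ W) :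
    ∀ᵐ z, z ∈ W₀ → ‖increment (r • dirX k) u z‖ ≤ ∫ s in Ioc 0 r, ‖G (z + s • dirX k)‖ := by
  have h1 : ∀ᵐ z, ∀ i, z ∈ W₀ → u (z + r • dirX k) i - u z i =
      ∫ s in Ioc 0 r, G (z + s • dirX k) (i, k) := by
    rw [ae_all_iff]
    exact fun i => (L.weakGrad i k).ae_sub_eq (integrable_apply L.integrable_u i)
      (integrable_apply L.integrable_grad (i, k)) hW₀ hr hs
  have h2 : ∀ᵐ z, ∀ p, Integrable (fun s => G (z + s • dirX k) p) (volume.restrict (Ioc 0 r)) := by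
    rw [ae_all_iff]
    exact fun p => (integrable_shear (integrable_apply L.integrable_grad p) (dirX k)
      (volume.restrict (Ioc 0 r))).prod_left_ae
  filter_upwards [h1, h2] with z hz1 hz2 hzW
  have hint : Integrable (fun s => G (z + s • dirX k)) (volume.restrict (Ioc 0 r)) :=
    Integrable.of_eval_piLp hz2
  have e : increment (r • dirX k) u z = ∫ s in Ioc 0 r, column k (G (z + s • dirX k)) := by
    ext i
    have : ∫ s in Ioc 0 r, G (z + s • dirX k) (i, k) =
        (∫ s in Ioc 0 r, column k (G (z + s • dirX k))) i :=
      (EuclideanSpace.proj (𝕜 := ℝ) i : EuclideanSpace ℝ (Fin N) →L[ℝ] ℝ).integral_comp_comm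
        ((column k).integrable_comp hint)
    rw [← this, ← hz1 i hzW]
    simp [increment]
  rw [e]
  refine (norm_integral_le_integral_norm _).trans ?_
  exact integral_mono_of_nonneg (Eventually.of_forall fun s => norm_nonneg _) hint.norm
    (Eventually.of_forall fun s => norm_column_le k _)

end Localized

/-! ### Energy identity and inequality for space increments -/

section EnergyInequality

variable {n N : ℕ} {c₁ c₂ : ℝ} {φ : ℝ → ℝ} {W W₀ : Set (SpaceTime n)}
  {u : SpaceTime n → EuclideanSpace ℝ (Fin N)} {G : SpaceTime n → Mat (Fin N) n}

theorem spaceGrad_apply (ζ : SpaceTime n → ℝ) (z : SpaceTime n) (j : Fin n) :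
    spaceGrad ζ z j = fderiv ℝ ζ z (dirX j) := rfl

theorem IsIntegrableSolution.integrable_field_sq (L : IsIntegrableSolution φ W u G) :
    Integrable fun z => ‖fieldV φ (G z)‖ ^ 2 :=
  (memLp_two_iff_integrable_sq_norm L.memLp_field.1).1 L.memLp_field

theorem memLp_norm_sq {F : Type*} [NormedAddCommGroup F] {f : SpaceTime n → F}
    (hf : MemLp f 2) : Integrable fun z => ‖f z‖ ^ 2 :=
  (memLp_two_iff_integrable_sq_norm hf.1).1 hf

theorem integrable_norm_sub_shear_sq {F : Type*} [NormedAddCommGroup F] {f : SpaceTime n → F}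
    (hf : MemLp f 2) (e : SpaceTime n) (ν : Measure ℝ) [IsFiniteMeasure ν] :
    Integrable (fun p : ℝ × SpaceTime n => ‖f (p.2 + p.1 • e) - f p.2‖ ^ 2) (ν.prod volume) := by
  have h1 : MemLp (fun p : ℝ × SpaceTime n => f (p.2 + p.1 • e)) 2 (ν.prod volume) :=
    (hf.comp_snd ν).comp_measurePreserving (measurePreserving_shear e ν)
  have h2 := h1.sub (hf.comp_snd ν)
  exact (memLp_two_iff_integrable_sq_norm h2.1).1 h2

theorem integrable_mul_of_ae_ae {f g Γ : SpaceTime n → ℝ} (hf : Integrable f) (hg : Integrable g)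
    (hΓ : Integrable Γ) (hfg : ∀ᵐ y, ∀ᵐ y', |f y| * |g y'| ≤ Γ y + Γ y') {ζ : SpaceTime n → ℝ}
    (hζ : Continuous ζ) (hζc : HasCompactSupport ζ) : Integrable fun z => f z * g z * ζ z := by
  obtain ⟨C, hC⟩ := hζc.exists_bound_of_continuous hζ
  have h1 : Integrable fun z => f z * g z :=
    (hΓ.const_mul 2).mono' (hf.aestronglyMeasurable.mul hg.aestronglyMeasurable)
      (ae_abs_mul_le_of_ae_ae hf hg hΓ hfg)
  exact h1.mul_bdd (c := C) hζ.aestronglyMeasurable (Eventually.of_forall hC)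

/-- The energy identity for increments of a solution. -/
theorem IsIntegrableSolution.increment_energy_identity (L : IsIntegrableSolution φ W u G)
    (h : OrliczAssumption c₁ c₂ φ) (hc₂ : 0 < c₂) (hW₀ : IsOpen W₀) {k : Fin n} {r : ℝ}
    (hr : 0 < r) (hs : ∀ z ∈ W₀, ∀ s ∈ Icc (0 : ℝ) r, z + s • dirX k ∈ W) {ζ : SpaceTime n → ℝ}
    (hζ : ContDiff ℝ 1 ζ) (hζc : HasCompactSupport ζ) (hζW : tsupport ζ ⊆ W₀) :
    Integrable (fun z => inner ℝ (increment (r • dirX k) (fun z => fluxA φ (G z)) z)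
        (increment (r • dirX k) G z) * ζ z) ∧
      Integrable (fun z => inner ℝ (increment (r • dirX k) (fun z => fluxA φ (G z)) z)
        (tensor (increment (r • dirX k) u z) (spaceGrad ζ z))) ∧
      (∫ z, inner ℝ (increment (r • dirX k) (fun z => fluxA φ (G z)) z)
        (increment (r • dirX k) G z) * ζ z) +
      ∫ z, inner ℝ (increment (r • dirX k) (fun z => fluxA φ (G z)) z)
        (tensor (increment (r • dirX k) u z) (spaceGrad ζ z)) =
      1 / 2 * ∫ z, ‖increment (r • dirX k) u z‖ ^ 2 * fderiv ℝ ζ z dirT := by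
  set ν : Measure ℝ := volume.restrict (Ioc 0 r) with hν
  have hνr : ν.real univ = r := by simp [hν, hr.le]
  set e := r • dirX k with he
  set DA := increment e (fun z => fluxA φ (G z)) with hDA
  set DG := increment e G with hDG
  set Du := increment e u with hDu
  set v : SpaceTime n → ℝ := fun z => ‖fieldV φ (G (z + e))‖ ^ 2 + ‖fieldV φ (G z)‖ ^ 2 with hv
  have iV2 := L.integrable_field_sq
  have iv : Integrable v := (iV2.comp_add_right e).add iV2
  have v0 : ∀ z, 0 ≤ v z := fun z => by positivity
  have iDA : Integrable DA := integrable_increment L.integrable_flux e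
  have iDG : Integrable DG := integrable_increment L.integrable_grad e
  have iDu : Integrable Du := integrable_increment L.integrable_u e
  have iDu2 : Integrable fun z => ‖Du z‖ ^ 2 := memLp_norm_sq (memLp_increment L.memLp_u e)
  have ish := integrable_shear iV2 (dirX k) ν
  have ishG := integrable_shear L.integrable_grad.norm (dirX k) ν
  set w2 : SpaceTime n → ℝ := fun z => ∫ s, ‖fieldV φ (G (z + s • dirX k))‖ ^ 2 ∂ν with hw2
  have iw2 : Integrable w2 := ish.integral_prod_right
  have w20 : ∀ z, 0 ≤ w2 z := fun z => integral_nonneg fun s => sq_nonneg _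
  -- One `Γ` for all three products: `|Du|²` serves the time term, `2v` the product of the
  -- increments of flux and gradient, and `r v + 2 w2` the product of flux increment and `Du`, the
  -- latter estimated along the segment.
  set Γ : SpaceTime n → ℝ := fun z => ‖Du z‖ ^ 2 + (2 + r) * v z + 2 * w2 z with hΓdef
  have iΓ : Integrable Γ := (iDu2.add (iv.const_mul _)).add (iw2.const_mul 2)
  have hDAb : ∀ y (Q : Mat (Fin N) n), ‖DA y‖ * ‖Q‖ ≤ v y + 2 * ‖fieldV φ Q‖ ^ 2 := by
    intro y Q
    have h1 := h.norm_fluxA_mul_norm_le hc₂ (G (y + e)) Q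
    have h2 := h.norm_fluxA_mul_norm_le hc₂ (G y) Q
    have h3 : ‖DA y‖ ≤ ‖fluxA φ (G (y + e))‖ + ‖fluxA φ (G y)‖ := norm_sub_le _ _
    have h4 := mul_le_mul_of_nonneg_right h3 (norm_nonneg Q)
    simp only [hv]
    linarith
  have hww : ∀ y y', ‖Du y‖ * ‖Du y'‖ ≤ Γ y + Γ y' := by
    intro y y'
    have : ‖Du y‖ * ‖Du y'‖ ≤ ‖Du y‖ ^ 2 + ‖Du y'‖ ^ 2 := by
      nlinarith [sq_nonneg (‖Du y‖ - ‖Du y'‖), norm_nonneg (Du y), norm_nonneg (Du y')]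
    have a1 : 0 ≤ (2 + r) * v y := mul_nonneg (by positivity) (v0 y)
    have a2 : 0 ≤ (2 + r) * v y' := mul_nonneg (by positivity) (v0 y')
    have a3 := w20 y
    have a4 := w20 y'
    simp only [hΓdef]
    linarith
  have hBg : ∀ y y', ‖DA y‖ * ‖DG y'‖ ≤ Γ y + Γ y' := by
    intro y y'
    have h1 := hDAb y (G (y' + e))
    have h2 := hDAb y (G y')
    have h3 : ‖DG y'‖ ≤ ‖G (y' + e)‖ + ‖G y'‖ := norm_sub_le _ _
    have h4 := mul_le_mul_of_nonneg_left h3 (norm_nonneg (DA y))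
    have a1 : 0 ≤ r * v y := mul_nonneg hr.le (v0 y)
    have a2 : 0 ≤ r * v y' := mul_nonneg hr.le (v0 y')
    have a3 := w20 y
    have a4 := w20 y'
    have a5 := sq_nonneg ‖Du y‖
    have a6 := sq_nonneg ‖Du y'‖
    simp only [hΓdef]
    have e1 : v y' = ‖fieldV φ (G (y' + e))‖ ^ 2 + ‖fieldV φ (G y')‖ ^ 2 := rfl
    linarith
  have hBw : ∀ y, ∀ᵐ y', y' ∈ W₀ → ‖DA y‖ * ‖Du y'‖ ≤ Γ y + Γ y' := by
    intro y
    filter_upwards [L.norm_increment_le hW₀ hr.le hs, ish.prod_left_ae, ishG.prod_left_ae]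
      with y' h1 h2 h3 hy'
    have h4 := mul_le_mul_of_nonneg_left (h1 hy') (norm_nonneg (DA y))
    have h5 : ‖DA y‖ * ∫ s in Ioc 0 r, ‖G (y' + s • dirX k)‖ ≤ r * v y + 2 * w2 y' := by
      rw [← integral_const_mul]
      calc ∫ s, ‖DA y‖ * ‖G (y' + s • dirX k)‖ ∂ν
          ≤ ∫ s, (v y + 2 * ‖fieldV φ (G (y' + s • dirX k))‖ ^ 2) ∂ν :=
            integral_mono (h3.const_mul _) ((integrable_const _).add (h2.const_mul 2))
              fun s => hDAb y _
        _ = r * v y + 2 * w2 y' := by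
            rw [integral_add (integrable_const _) (h2.const_mul 2), integral_const, hνr,
              integral_const_mul, smul_eq_mul]
    have a1 : 0 ≤ 2 * v y := mul_nonneg (by positivity) (v0 y)
    have a2 : 0 ≤ (2 + r) * v y' := mul_nonneg (by positivity) (v0 y')
    have a3 := w20 y
    have a5 := sq_nonneg ‖Du y‖
    have a6 := sq_nonneg ‖Du y'‖
    simp only [hΓdef]
    linarith
  have hsr : ∀ z ∈ W₀, z + e ∈ W := fun z hz => hs z hz r (right_mem_Icc.2 hr.le)
  have hWW : W₀ ⊆ W := fun z hz => by simpa using hs z hz 0 (left_mem_Icc.2 hr.le)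
  -- The bound of `Du` by the gradient on the segment is available only in `W₀`. Cutting off there
  -- makes the two-point bound global and changes nothing for test functions supported in `W₀`.
  set w : Fin N → SpaceTime n → ℝ := fun i => W₀.indicator fun z => Du z i with hw
  have iw : ∀ i, Integrable (w i) := fun i => (integrable_apply iDu i).indicator hW₀.measurableSet
  have hwb : ∀ i z, |w i z| ≤ ‖Du z‖ := by
    intro i z
    by_cases hz : z ∈ W₀
    · simp only [hw, indicator_of_mem hz]; exact abs_apply_le _ _
    · simp only [hw, indicator_of_notMem hz, abs_zero]; positivity
  have bww : ∀ i, ∀ᵐ y, ∀ᵐ y', |w i y| * |w i y'| ≤ Γ y + Γ y' := fun i =>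
    Eventually.of_forall fun y => Eventually.of_forall fun y' =>
      (mul_le_mul (hwb i y) (hwb i y') (abs_nonneg _) (norm_nonneg _)).trans (hww y y')
  have bBg : ∀ i j, ∀ᵐ y, ∀ᵐ y', |DA y (i, j)| * |DG y' (i, j)| ≤ Γ y + Γ y' := fun i j =>
    Eventually.of_forall fun y => Eventually.of_forall fun y' =>
      (mul_le_mul (abs_apply_le _ _) (abs_apply_le _ _) (abs_nonneg _) (norm_nonneg _)).trans
        (hBg y y')
  have Γ0 : ∀ z, 0 ≤ Γ z := fun z => by
    have := v0 z; have := w20 z; positivity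
  have bBw : ∀ i j, ∀ᵐ y, ∀ᵐ y', |DA y (i, j)| * |w i y'| ≤ Γ y + Γ y' := by
    intro i j
    refine Eventually.of_forall fun y => ?_
    filter_upwards [hBw y] with y' hy'
    by_cases hz : y' ∈ W₀
    · exact (mul_le_mul (abs_apply_le _ _) (hwb i y') (abs_nonneg _) (norm_nonneg _)).trans
        (hy' hz)
    · simp only [hw, indicator_of_notMem hz, abs_zero, mul_zero]
      exact add_nonneg (Γ0 _) (Γ0 _)
  have hwg : ∀ i j, IsWeakDeriv W₀ (dirX j) (w i) (fun z => DG z (i, j)) := by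
    intro i j
    refine ((L.weakGrad i j).sub_shift (integrable_apply L.integrable_u i)
      (integrable_apply L.integrable_grad (i, j)) hWW hsr).congr ?_ ?_
    · exact Eventually.of_forall fun z hz => by
        simp [hw, indicator_of_mem hz, hDu, increment]
    · exact Eventually.of_forall fun z _ => rfl
  have heq : ∀ i (ξ : SpaceTime n → ℝ), IsTest W₀ ξ →
      ∑ j, ∫ z, DA z (i, j) * fderiv ℝ ξ z (dirX j) = ∫ z, w i z * fderiv ℝ ξ z dirT := by
    intro i ξ hξ
    have a1 := L.weakEq i _ (hξ.comp_sub hsr)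
    have a2 := L.weakEq i _ (hξ.mono hWW)
    have a3 : ∀ j, ∫ z, DA z (i, j) * fderiv ℝ ξ z (dirX j) =
        (∫ z, fluxA φ (G z) (i, j) * fderiv ℝ (fun z => ξ (z - e)) z (dirX j)) -
          ∫ z, fluxA φ (G z) (i, j) * fderiv ℝ ξ z (dirX j) := fun j =>
      hξ.integral_sub_shift_mul_fderiv (f := fun z => fluxA φ (G z) (i, j))
        (integrable_apply L.integrable_flux (i, j)) hsr (dirX j)
    have a4 : ∫ z, w i z * fderiv ℝ ξ z dirT = ∫ z, (u (z + e) i - u z i) * fderiv ℝ ξ z dirT := by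
      congr 1; ext z
      by_cases hz : z ∈ W₀
      · simp [hw, indicator_of_mem hz, hDu, increment]
      · have : fderiv ℝ ξ z = 0 := image_eq_zero_of_notMem_tsupport
          fun hh => hz (hξ.2.2 (tsupport_fderiv_subset ℝ hh))
        simp [this]
    rw [a4, hξ.integral_sub_shift_mul_fderiv (f := fun z => u z i)
      (integrable_apply L.integrable_u i) hsr dirT, ← a1, ← a2, ← Finset.sum_sub_distrib]
    exact Finset.sum_congr rfl fun j _ => a3 j
  have main : ∀ i, _ := fun i => energy_identity hW₀ (iw i)
    (fun j => integrable_apply iDG (i, j)) (fun j => integrable_apply iDA (i, j)) iΓ (bww i)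
    (bBg i) (bBw i) (hwg i) (heq i) hζ hζc hζW
  have cd : ∀ d, Continuous fun z => fderiv ℝ ζ z d := fun d =>
    (hζ.continuous_fderiv one_ne_zero).clm_apply continuous_const
  have sd : ∀ d, HasCompactSupport fun z => fderiv ℝ ζ z d := fun d =>
    hζc.fderiv_apply (𝕜 := ℝ) d
  have iBg : ∀ i j, Integrable fun z => DA z (i, j) * DG z (i, j) * ζ z := fun i j =>
    integrable_mul_of_ae_ae (integrable_apply iDA _) (integrable_apply iDG _) iΓ (bBg i j)
      hζ.continuous hζc
  have iBw : ∀ i j, Integrable fun z => DA z (i, j) * w i z * fderiv ℝ ζ z (dirX j) := fun i j =>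
    integrable_mul_of_ae_ae (integrable_apply iDA _) (iw i) iΓ (bBw i j) (cd _) (sd _)
  have iww : ∀ i, Integrable fun z => w i z * w i z * fderiv ℝ ζ z dirT := fun i =>
    integrable_mul_of_ae_ae (iw i) (iw i) iΓ (bww i) (cd _) (sd _)
  have hoff : ∀ z, z ∉ W₀ → fderiv ℝ ζ z = 0 := fun z hz => image_eq_zero_of_notMem_tsupport
    fun hh => hz (hζW (tsupport_fderiv_subset ℝ hh))
  have e1 : (fun z => inner ℝ (DA z) (DG z) * ζ z) =
      fun z => ∑ i, ∑ j, DA z (i, j) * DG z (i, j) * ζ z := by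
    ext z; simp only [inner_mat, Finset.sum_mul]
  have e2 : (fun z => inner ℝ (DA z) (tensor (Du z) (spaceGrad ζ z))) =
      fun z => ∑ i, ∑ j, DA z (i, j) * w i z * fderiv ℝ ζ z (dirX j) := by
    ext z; rw [inner_mat]
    refine Finset.sum_congr rfl fun i _ => Finset.sum_congr rfl fun j _ => ?_
    rw [mul_assoc]
    congr 1
    by_cases hz : z ∈ W₀
    · simp [hw, indicator_of_mem hz, tensor, spaceGrad_apply]
    · simp [tensor, spaceGrad_apply, hoff z hz]
  have e3 : (fun z => ‖Du z‖ ^ 2 * fderiv ℝ ζ z dirT) =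
      fun z => ∑ i, w i z * w i z * fderiv ℝ ζ z dirT := by
    ext z
    rw [← Finset.sum_mul]
    by_cases hz : z ∈ W₀
    · congr 1
      rw [EuclideanSpace.norm_sq_eq]
      exact Finset.sum_congr rfl fun i _ => by simp [hw, indicator_of_mem hz, sq]
    · simp [hoff z hz]
  rw [e1, e2, e3]
  refine ⟨integrable_finsetSum _ fun i _ => integrable_finsetSum _ fun j _ => iBg i j,
    integrable_finsetSum _ fun i _ => integrable_finsetSum _ fun j _ => iBw i j, ?_⟩
  rw [integral_finsetSum _ fun i _ => integrable_finsetSum _ fun j _ => iBg i j,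
    integral_finsetSum _ fun i _ => integrable_finsetSum _ fun j _ => iBw i j,
    integral_finsetSum _ fun i _ => iww i, ← Finset.sum_add_distrib, Finset.mul_sum]
  refine Finset.sum_congr rfl fun i _ => ?_
  rw [integral_finsetSum _ fun j _ => iBg i j, integral_finsetSum _ fun j _ => iBw i j,
    ← Finset.sum_add_distrib]
  exact main i

/-- The constant of strong monotonicity. -/
def monoConst (c₁ c₂ : ℝ) : ℝ := 1 + (1 + c₂) ^ 2 / (4 * c₁)

theorem monoConst_pos (hc₁ : 0 < c₁) : 0 < monoConst c₁ c₂ := by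
  unfold monoConst; positivity

/-- Young's inequality. The summand containing the increment `d` of `V` keeps the weight `√t`, so
half of `d² t` absorbs it; the summand `w` has no such factor, and there `√t ≤ 1` is used. -/
theorem cross_term_le {κ F M r t d x y w X : ℝ} (hκ : 0 ≤ κ) (hF : 0 ≤ F) (hM : 0 ≤ M)
    (ht : 0 ≤ t) (ht1 : t ≤ 1) (hw : 0 ≤ w)
    (hX : X ≤ F * (r * (d * (x + y)) + w) * (M * Real.sqrt t)) :
    κ * X ≤ 1 / 2 * (d ^ 2 * t) + (κ * F) ^ 2 * M ^ 2 * r ^ 2 * (x ^ 2 + y ^ 2) +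
      κ * F * M * w := by
  have h1 : κ * F * M * w * Real.sqrt t ≤ κ * F * M * w :=
    mul_le_of_le_one_right (by positivity) (Real.sqrt_le_one.2 ht1)
  have e2 : (d * Real.sqrt t) ^ 2 = d ^ 2 * t := by rw [mul_pow, Real.sq_sqrt ht]
  have h3 : 0 ≤ (κ * F * M * r) ^ 2 * (x - y) ^ 2 := by positivity
  have h4 := sq_nonneg (d * Real.sqrt t - κ * F * M * r * (x + y))
  have h5 := mul_le_mul_of_nonneg_left hX hκ
  rw [← e2]
  linear_combination h5 + h1 + 1 / 2 * h4 + 1 / 2 * h3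

/-- The energy inequality for increments of a solution. -/
theorem IsIntegrableSolution.increment_energy_le (L : IsIntegrableSolution φ W u G)
    (h : OrliczAssumption c₁ c₂ φ) (hc₁ : 0 < c₁) (hc₂ : 0 < c₂) (hW₀ : IsOpen W₀) {k : Fin n}
    {r : ℝ} (hr : 0 < r) (hs : ∀ z ∈ W₀, ∀ s ∈ Icc (0 : ℝ) r, z + s • dirX k ∈ W)
    {ζ : SpaceTime n → ℝ} (hζ : ContDiff ℝ 1 ζ) (hζc : HasCompactSupport ζ)
    (hζW : tsupport ζ ⊆ W₀) (hζ0 : ∀ z, 0 ≤ ζ z) (hζ1 : ∀ z, ζ z ≤ 1) {M : ℝ} (hM : 0 ≤ M)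
    (hζM : ∀ z, ‖spaceGrad ζ z‖ ^ 2 ≤ M ^ 2 * ζ z) {B : ℝ}
    (hB : ∀ s ∈ Ioc 0 r, ∫ z in tsupport ζ,
      ‖increment (s • dirX k) (fun z => fieldV φ (G z)) z‖ ^ 2 ≤ B) :
    ∫ z, ‖increment (r • dirX k) (fun z => fieldV φ (G z)) z‖ ^ 2 * ζ z ≤
      2 * (monoConst c₁ c₂ * OrliczAssumption.fluxConst c₁) ^ 2 * M ^ 2 * r ^ 2 *
        (∫ z in Function.support ζ,
          (‖fieldV φ (G (z + r • dirX k))‖ ^ 2 + ‖fieldV φ (G z)‖ ^ 2)) +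
      2 * (monoConst c₁ c₂ * OrliczAssumption.fluxConst c₁) * M * (r * B) +
      monoConst c₁ c₂ * ∫ z, ‖increment (r • dirX k) u z‖ ^ 2 * fderiv ℝ ζ z dirT := by
  obtain ⟨i1, i2, hid⟩ := L.increment_energy_identity h hc₂ hW₀ hr hs hζ hζc hζW
  set ν : Measure ℝ := volume.restrict (Ioc 0 r) with hν
  have hνr : ν.real univ = r := by simp [hν, hr.le]
  set κ := monoConst c₁ c₂ with hκ
  have hκ0 : 0 < κ := monoConst_pos hc₁
  set F := OrliczAssumption.fluxConst c₁ with hF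
  have hF0 : 0 < F := OrliczAssumption.fluxConst_pos hc₁
  set e := r • dirX k with he
  set V : SpaceTime n → Mat (Fin N) n := fun z => fieldV φ (G z) with hV
  set DA := increment e (fun z => fluxA φ (G z)) with hDA
  set DG := increment e G with hDG
  set Du := increment e u with hDu
  set DV := increment e V with hDV
  have iDV2 : Integrable fun z => ‖DV z‖ ^ 2 := memLp_norm_sq (memLp_increment L.memLp_field e)
  have iV2 := L.integrable_field_sq
  have iv : Integrable fun z => ‖V (z + e)‖ ^ 2 + ‖V z‖ ^ 2 := (iV2.comp_add_right e).add iV2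
  have mS : MeasurableSet (Function.support ζ) := hζ.continuous.isOpen_support.measurableSet
  have mT : MeasurableSet (tsupport ζ) := (isClosed_tsupport ζ).measurableSet
  have iDVζ : Integrable fun z => ‖DV z‖ ^ 2 * ζ z := by
    refine iDV2.mul_bdd (c := 1) hζ.continuous.aestronglyMeasurable (Eventually.of_forall fun z => ?_)
    rw [Real.norm_of_nonneg (hζ0 z)]; exact hζ1 z
  -- the increments of `V` in intermediate directions
  have ish : Integrable (fun p : ℝ × SpaceTime n => ‖V (p.2 + p.1 • dirX k) - V p.2‖ ^ 2)
      (ν.prod volume) := integrable_norm_sub_shear_sq L.memLp_field (dirX k) ν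
  have ishG := integrable_shear L.integrable_grad.norm (dirX k) ν
  set w2 : SpaceTime n → ℝ := fun z => ∫ s, ‖V (z + s • dirX k) - V z‖ ^ 2 ∂ν with hw2
  have iw2 : Integrable w2 := ish.integral_prod_right
  have w20 : ∀ z, 0 ≤ w2 z := fun z => integral_nonneg fun s => sq_nonneg _
  -- By Fubini this is the integral over `0 < s ≤ r` of the squared `L²` norms of the shorter
  -- increments. It is the source of the term `r B` that drives the bootstrap.
  have iw2T : ∫ z in tsupport ζ, w2 z ≤ r * B := by
    have ish' : Integrable (fun p : ℝ × SpaceTime n => ‖V (p.2 + p.1 • dirX k) - V p.2‖ ^ 2)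
        (ν.prod (volume.restrict (tsupport ζ))) :=
      ish.mono_measure (Measure.prod_mono le_rfl Measure.restrict_le_self)
    rw [hw2, ← integral_integral_swap
      (f := fun s z => ‖V (z + s • dirX k) - V z‖ ^ 2) ish']
    have : ∫ s, (∫ z in tsupport ζ, ‖V (z + s • dirX k) - V z‖ ^ 2) ∂ν ≤ ∫ s, B ∂ν := by
      refine integral_mono_of_nonneg (Eventually.of_forall fun s =>
        integral_nonneg fun z => sq_nonneg _) (integrable_const _) ?_
      filter_upwards [ae_restrict_mem measurableSet_Ioc] with s hs' using hB s hs'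
    rwa [integral_const, hνr, smul_eq_mul] at this
  -- the pointwise estimate of the cross term
  have hpt : ∀ᵐ z, κ * |inner ℝ (DA z) (tensor (Du z) (spaceGrad ζ z))| ≤
      1 / 2 * (‖DV z‖ ^ 2 * ζ z) + (Function.support ζ).indicator
        (fun z => (κ * F) ^ 2 * M ^ 2 * r ^ 2 * (‖V (z + e)‖ ^ 2 + ‖V z‖ ^ 2)) z +
        (tsupport ζ).indicator (fun z => κ * F * M * w2 z) z := by
    filter_upwards [L.norm_increment_le hW₀ hr.le hs, ish.prod_left_ae, ishG.prod_left_ae]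
      with z h1 h2 h3
    -- Zeros of `ζ` are harmless, since `|∇ζ|² ≤ M² ζ` makes the gradient vanish there; therefore
    -- `V` is only integrated over the support before closure.
    by_cases hz : ζ z = 0
    · have hg0 : ‖spaceGrad ζ z‖ = 0 := by
        have := hζM z
        rw [hz, mul_zero] at this
        exact pow_eq_zero_iff two_ne_zero |>.1 (le_antisymm this (sq_nonneg _))
      have hin : |inner ℝ (DA z) (tensor (Du z) (spaceGrad ζ z))| ≤ 0 := by
        refine (abs_real_inner_le_norm _ _).trans ?_
        rw [norm_tensor, hg0]; simp
      have hzs : z ∉ Function.support ζ := by simpa using hz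
      have : 0 ≤ (tsupport ζ).indicator (fun z => κ * F * M * w2 z) z :=
        indicator_nonneg (fun z _ => mul_nonneg (by positivity) (w20 z)) z
      rw [indicator_of_notMem hzs, hz]
      have := mul_le_mul_of_nonneg_left hin hκ0.le
      linarith
    have hzs : z ∈ Function.support ζ := hz
    have hzt : z ∈ tsupport ζ := subset_tsupport _ hzs
    rw [indicator_of_mem hzs, indicator_of_mem hzt]
    set g := ‖spaceGrad ζ z‖ with hg
    have hg1 : g ≤ M * Real.sqrt (ζ z) := by
      apply (pow_le_pow_iff_left₀ (norm_nonneg _) (by positivity) two_ne_zero).1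
      rw [mul_pow, Real.sq_sqrt (hζ0 z)]
      exact hζM z
    have hsq1 : Real.sqrt (ζ z) ≤ 1 := Real.sqrt_le_one.2 (hζ1 z)
    have hsq0 : 0 ≤ Real.sqrt (ζ z) := Real.sqrt_nonneg _
    -- The three-matrix inequality with `P`, `Q`, `R` the gradients at `z + r e_k`, at `z` and at
    -- the intermediate point, integrated over the segment.
    have h5 : ‖DA z‖ * ∫ s in Ioc 0 r, ‖G (z + s • dirX k)‖ ≤
        F * (r * (‖DV z‖ * (‖V (z + e)‖ + ‖V z‖)) + w2 z) := by
      rw [← integral_const_mul]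
      calc ∫ s, ‖DA z‖ * ‖G (z + s • dirX k)‖ ∂ν
          ≤ ∫ s, F * (‖DV z‖ * (‖V (z + e)‖ + ‖V z‖) + ‖V (z + s • dirX k) - V z‖ ^ 2) ∂ν :=
            integral_mono (h3.const_mul _) (((integrable_const _).add h2).const_mul F)
              fun s => h.norm_fluxA_sub_mul_norm_le hc₁ hc₂ _ _ _
        _ = _ := by
            rw [integral_const_mul, integral_add (integrable_const _) h2, integral_const, hνr,
              smul_eq_mul]
    have h6 : ‖DA z‖ * ‖Du z‖ ≤ F * (r * (‖DV z‖ * (‖V (z + e)‖ + ‖V z‖)) + w2 z) :=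
      (mul_le_mul_of_nonneg_left (h1 (hζW hzt)) (norm_nonneg _)).trans h5
    have h7 : |inner ℝ (DA z) (tensor (Du z) (spaceGrad ζ z))| ≤
        F * (r * (‖DV z‖ * (‖V (z + e)‖ + ‖V z‖)) + w2 z) * (M * Real.sqrt (ζ z)) := by
      refine (abs_real_inner_le_norm _ _).trans ?_
      rw [norm_tensor, ← mul_assoc]
      exact mul_le_mul h6 hg1 (norm_nonneg _) ((by positivity : 0 ≤ ‖DA z‖ * ‖Du z‖).trans h6)
    exact cross_term_le hκ0.le hF0.le hM (hζ0 z) (hζ1 z) (w20 z) h7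
  have iS : Integrable ((Function.support ζ).indicator
      (fun z => (κ * F) ^ 2 * M ^ 2 * r ^ 2 * (‖V (z + e)‖ ^ 2 + ‖V z‖ ^ 2))) :=
    (iv.const_mul _).indicator mS
  have iT : Integrable ((tsupport ζ).indicator (fun z => κ * F * M * w2 z)) :=
    (iw2.const_mul _).indicator mT
  have hcross : κ * |∫ z, inner ℝ (DA z) (tensor (Du z) (spaceGrad ζ z))| ≤
      1 / 2 * (∫ z, ‖DV z‖ ^ 2 * ζ z) + (κ * F) ^ 2 * M ^ 2 * r ^ 2 *
        (∫ z in Function.support ζ, (‖V (z + e)‖ ^ 2 + ‖V z‖ ^ 2)) +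
        κ * F * M * (r * B) := by
    calc κ * |∫ z, inner ℝ (DA z) (tensor (Du z) (spaceGrad ζ z))|
        ≤ κ * ∫ z, |inner ℝ (DA z) (tensor (Du z) (spaceGrad ζ z))| := by
          gcongr; exact abs_integral_le_integral_abs
      _ = ∫ z, κ * |inner ℝ (DA z) (tensor (Du z) (spaceGrad ζ z))| := by
          rw [integral_const_mul]
      _ ≤ _ := integral_mono_ae (i2.abs.const_mul κ) (((iDVζ.const_mul (1 / 2)).add iS).add iT) hpt
      _ = 1 / 2 * (∫ z, ‖DV z‖ ^ 2 * ζ z) + (κ * F) ^ 2 * M ^ 2 * r ^ 2 *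
            (∫ z in Function.support ζ, (‖V (z + e)‖ ^ 2 + ‖V z‖ ^ 2)) +
            κ * F * M * (∫ z in tsupport ζ, w2 z) := by
          rw [integral_add' ((iDVζ.const_mul (1 / 2)).add iS) iT,
            integral_add' (iDVζ.const_mul (1 / 2)) iS, integral_indicator mS, integral_indicator mT,
            integral_const_mul, integral_const_mul, integral_const_mul]
      _ ≤ _ := by gcongr
  have hmono : ∫ z, ‖DV z‖ ^ 2 * ζ z ≤ κ * ∫ z, inner ℝ (DA z) (DG z) * ζ z := by
    rw [← integral_const_mul]
    refine integral_mono iDVζ (i1.const_mul κ) fun z => ?_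
    have := mul_le_mul_of_nonneg_right
      (h.norm_fieldV_sub_sq_le hc₁ hc₂ (G (z + e)) (G z)) (hζ0 z)
    simp only [← mul_assoc]
    exact this
  -- Half of `∫ |DV|² ζ` from the cross term is absorbed on the left; multiplying by `2` then turns
  -- `κ/2` in front of the time term into `κ`.
  have habs := neg_abs_le (∫ z, inner ℝ (DA z) (tensor (Du z) (spaceGrad ζ z)))
  have := mul_le_mul_of_nonneg_left habs hκ0.le
  have hid' := congrArg (κ * ·) hid
  simp only [mul_add] at hid'
  linarith

end EnergyInequality

theorem exists_isTest_eq_one {E : Type*} [NormedAddCommGroup E] [NormedSpace ℝ E]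
    [FiniteDimensional ℝ E] {K W : Set E} (hK : IsCompact K) (hW : IsOpen W) (hKW : K ⊆ W) :
    ∃ θ : E → ℝ, IsTest W θ ∧ (∀ z, θ z ∈ Icc (0 : ℝ) 1) ∧ ∀ z ∈ K, θ z = 1 := by
  obtain ⟨K', hK', h1, h2⟩ := exists_compact_between hK hW hKW
  obtain ⟨f, hf0, hf1, hf⟩ := exists_contMDiffMap_zero_one_of_isClosed (n := (⊤ : ℕ∞))
    (modelWithCornersSelf ℝ E) (isOpen_interior (s := K')).isClosed_compl hK.isClosed
    (disjoint_left.2 fun x hx hx' => hx (h1 hx'))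
  have hs : tsupport f ⊆ K' := by
    refine closure_minimal (fun x hx => ?_) hK'.isClosed
    by_contra hx'
    exact hx (hf0 fun h => hx' (interior_subset h))
  exact ⟨f, ⟨f.contMDiff.contDiff, hK'.of_isClosed_subset (isClosed_tsupport _) hs, hs.trans h2⟩,
    hf, fun z hz => hf1 hz⟩

/-! ### Differentiability of `V(∇u)` and the limit of the energy inequality -/

section Regularity

variable {n N : ℕ} {c₁ c₂ : ℝ} {φ : ℝ → ℝ} {W W₀ : Set (SpaceTime n)}
  {u : SpaceTime n → EuclideanSpace ℝ (Fin N)} {G : SpaceTime n → Mat (Fin N) n}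

theorem IsIntegrableSolution.setIntegral_increment_sq_le (L : IsIntegrableSolution φ W u G)
    (hW₀ : IsOpen W₀) {k : Fin n} {r : ℝ} (hr : 0 ≤ r)
    (hs : ∀ z ∈ W₀, ∀ s ∈ Icc (0 : ℝ) r, z + s • dirX k ∈ W) :
    ∫ z in W₀, ‖increment (r • dirX k) u z‖ ^ 2 ≤ r ^ 2 * ∫ z, ‖G z‖ ^ 2 := by
  set ν : Measure ℝ := volume.restrict (Ioc 0 r) with hν
  have hνr : ν.real univ = r := by simp [hν, hr]
  have i1 := integrable_shear L.integrable_grad.norm (dirX k) ν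
  have i2 := integrable_shear (memLp_norm_sq L.memLp_grad) (dirX k) ν
  have i3 : Integrable fun z => ‖increment (r • dirX k) u z‖ ^ 2 :=
    memLp_norm_sq (memLp_increment L.memLp_u _)
  have i4 : Integrable fun z => r * ∫ s, ‖G (z + s • dirX k)‖ ^ 2 ∂ν :=
    i2.integral_prod_right.const_mul r
  calc ∫ z in W₀, ‖increment (r • dirX k) u z‖ ^ 2
      ≤ ∫ z in W₀, r * ∫ s, ‖G (z + s • dirX k)‖ ^ 2 ∂ν := by
        refine integral_mono_ae i3.integrableOn i4.integrableOn ?_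
        filter_upwards [ae_restrict_mem hW₀.measurableSet,
          ae_restrict_of_ae (L.norm_increment_le hW₀ hr hs), ae_restrict_of_ae i1.prod_left_ae,
          ae_restrict_of_ae i2.prod_left_ae] with z hz h1 h2 h3
        have h4 := sq_integral_le h2 h3
        rw [hνr] at h4
        exact (pow_le_pow_left₀ (norm_nonneg _) (h1 hz) 2).trans h4
    _ ≤ ∫ z, r * ∫ s, ‖G (z + s • dirX k)‖ ^ 2 ∂ν :=
        setIntegral_le_integral i4 (Eventually.of_forall fun z =>
          mul_nonneg hr (integral_nonneg fun s => sq_nonneg _))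
    _ = r * ∫ s, (∫ z, ‖G (z + s • dirX k)‖ ^ 2) ∂ν := by
        rw [integral_const_mul, ← integral_integral_swap
          (f := fun s z => ‖G (z + s • dirX k)‖ ^ 2) i2]
    _ = r ^ 2 * ∫ z, ‖G z‖ ^ 2 := by
        have : ∀ s : ℝ, ∫ z, ‖G (z + s • dirX k)‖ ^ 2 = ∫ z, ‖G z‖ ^ 2 := fun s =>
          integral_add_right_eq_self (fun z => ‖G z‖ ^ 2) _
        simp only [this, integral_const, hνr, smul_eq_mul]
        ring

theorem setIntegral_increment_sq_le_four {F : Type*} [NormedAddCommGroup F] {f : SpaceTime n → F}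
    (hf : MemLp f 2) (s : SpaceTime n) (K : Set (SpaceTime n)) :
    ∫ z in K, ‖increment s f z‖ ^ 2 ≤ 4 * ∫ z, ‖f z‖ ^ 2 := by
  have i1 := memLp_norm_sq hf
  calc ∫ z in K, ‖increment s f z‖ ^ 2 ≤ ∫ z, ‖increment s f z‖ ^ 2 :=
        setIntegral_le_integral (memLp_norm_sq (memLp_increment hf s))
          (Eventually.of_forall fun z => sq_nonneg _)
    _ ≤ ∫ z, (2 * ‖f (z + s)‖ ^ 2 + 2 * ‖f z‖ ^ 2) := by
        refine integral_mono (memLp_norm_sq (memLp_increment hf s))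
          (((i1.comp_add_right s).const_mul 2).add (i1.const_mul 2)) fun z => ?_
        have h1 : ‖increment s f z‖ ≤ ‖f (z + s)‖ + ‖f z‖ := norm_sub_le _ _
        have := pow_le_pow_left₀ (norm_nonneg _) h1 2
        simp only
        linarith [sq_nonneg (‖f (z + s)‖ - ‖f z‖)]
    _ = 4 * ∫ z, ‖f z‖ ^ 2 := by
        rw [integral_add ((i1.comp_add_right s).const_mul 2) (i1.const_mul 2), integral_const_mul,
          integral_const_mul, integral_add_right_eq_self (fun z => ‖f z‖ ^ 2) s]
        ring

/-- Increments of `f` are locally of order `r ^ m` in the squared `L²`-norm. -/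
def IncrementBound {F : Type*} [NormedAddCommGroup F] (W : Set (SpaceTime n)) (e : SpaceTime n)
    (f : SpaceTime n → F) (m : ℕ) : Prop :=
  ∀ K ⊆ W, IsCompact K → ∃ C δ : ℝ, 0 < δ ∧
    ∀ s ∈ Ioc 0 δ, ∫ z in K, ‖increment (s • e) f z‖ ^ 2 ≤ C * s ^ m

theorem spaceGrad_sq {θ : SpaceTime n → ℝ} (hθ : ContDiff ℝ 1 θ) (z : SpaceTime n) :
    spaceGrad (fun z => θ z ^ 2) z = (2 * θ z) • spaceGrad θ z := by
  ext j
  have := ((hθ.differentiable one_ne_zero z).hasFDerivAt.pow 2).fderiv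
  simp only [spaceGrad_apply, PiLp.smul_apply, smul_eq_mul]
  rw [this]
  simp

theorem exists_norm_spaceGrad_le {θ : SpaceTime n → ℝ} (hθ : ContDiff ℝ 1 θ)
    (hθc : HasCompactSupport θ) : ∃ M, 0 ≤ M ∧ ∀ z, ‖spaceGrad θ z‖ ≤ M := by
  have h1 : Continuous (spaceGrad θ) := by
    unfold spaceGrad spaceDeriv
    have := hθ.continuous_fderiv one_ne_zero
    fun_prop
  have h2 : HasCompactSupport (spaceGrad θ) := by
    refine (hθc.fderiv (𝕜 := ℝ)).mono fun z hz => ?_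
    by_contra hz'
    rw [Function.mem_support, not_not] at hz'
    refine hz ?_
    ext j
    simp [hz', spaceGrad, spaceDeriv]
  obtain ⟨M, hM⟩ := h2.exists_bound_of_continuous h1
  exact ⟨M, (norm_nonneg _).trans (hM 0), hM⟩

/-- One step of the bootstrap: with `B` of order `r^m` the intermediate increments contribute `r B`,
of order `r^(m+1)`. All other terms are of order `r²`, which is why the gain stops at `m + 1 = 2`.
-/
theorem IsIntegrableSolution.incrementBound_succ (L : IsIntegrableSolution φ W u G)
    (h : OrliczAssumption c₁ c₂ φ) (hc₁ : 0 < c₁) (hc₂ : 0 < c₂) (hW : IsOpen W) {k : Fin n}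
    {m : ℕ} (hm : m ≤ 1) (hV : IncrementBound W (dirX k) (fun z => fieldV φ (G z)) m) :
    IncrementBound W (dirX k) (fun z => fieldV φ (G z)) (m + 1) := by
  intro K hKW hK
  obtain ⟨θ, hθ, hθ01, hθK⟩ := exists_isTest_eq_one hK hW hKW
  have hθ1 : ContDiff ℝ 1 θ := hθ.1.of_le (by simp)
  obtain ⟨M, hM0, hM⟩ := exists_norm_spaceGrad_le hθ1 hθ.2.1
  -- The square ensures `|∇ζ|² ≤ (2M)² ζ`.
  set ζ : SpaceTime n → ℝ := fun z => θ z ^ 2 with hζdef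
  have hts : tsupport ζ ⊆ tsupport θ := closure_mono fun z hz => by
    simpa [hζdef] using hz
  have hζ : ContDiff ℝ 1 ζ := hθ1.pow 2
  have hζc : HasCompactSupport ζ := hθ.2.1.of_isClosed_subset (isClosed_tsupport _) hts
  have hζ0 : ∀ z, 0 ≤ ζ z := fun z => sq_nonneg _
  have hζ1 : ∀ z, ζ z ≤ 1 := fun z => pow_le_one₀ (hθ01 z).1 (hθ01 z).2
  have hζM : ∀ z, ‖spaceGrad ζ z‖ ^ 2 ≤ (2 * M) ^ 2 * ζ z := fun z => by
    rw [hζdef, spaceGrad_sq hθ1, norm_smul, mul_pow, Real.norm_eq_abs, sq_abs, mul_pow, mul_pow]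
    have := mul_le_mul_of_nonneg_left (pow_le_pow_left₀ (norm_nonneg _) (hM z) 2)
      (by positivity : 0 ≤ 2 ^ 2 * θ z ^ 2)
    linarith
  obtain ⟨T, hT⟩ := (hζc.fderiv_apply (𝕜 := ℝ) (dirT (n := n))).exists_bound_of_continuous
    ((hζ.continuous_fderiv one_ne_zero).clm_apply continuous_const)
  have hT0 : 0 ≤ T := (norm_nonneg _).trans (hT 0)
  obtain ⟨W₀, hW₀, hζW₀, δ₁, hδ₁, hs⟩ := exists_open_forall_add_smul_mem hζc hW
    (hts.trans hθ.2.2) (norm_dirX_le k)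
  obtain ⟨C, δ₂, hδ₂, hC⟩ := hV (tsupport ζ) (hts.trans hθ.2.2) hζc
  set κ := monoConst c₁ c₂ with hκ
  have hκ0 : 0 < κ := monoConst_pos hc₁
  set F := OrliczAssumption.fluxConst c₁ with hF
  have hF0 : 0 < F := OrliczAssumption.fluxConst_pos hc₁
  set SV := ∫ z, ‖fieldV φ (G z)‖ ^ 2 with hSV
  have hSV0 : 0 ≤ SV := integral_nonneg fun z => sq_nonneg _
  set SG := ∫ z, ‖G z‖ ^ 2 with hSG
  have hSG0 : 0 ≤ SG := integral_nonneg fun z => sq_nonneg _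
  have iV2 := L.integrable_field_sq
  refine ⟨2 * (κ * F) ^ 2 * (2 * M) ^ 2 * (2 * SV) + 2 * (κ * F) * (2 * M) * |C| + κ * (T * SG),
    min (min δ₁ δ₂) 1, by positivity, ?_⟩
  intro r hr
  have hr0 : 0 < r := hr.1
  have hr1 : r ≤ δ₁ := hr.2.trans ((min_le_left _ _).trans (min_le_left _ _))
  have hr2 : r ≤ δ₂ := hr.2.trans ((min_le_left _ _).trans (min_le_right _ _))
  have hr3 : r ≤ 1 := hr.2.trans (min_le_right _ _)
  have hs' : ∀ z ∈ W₀, ∀ s ∈ Icc (0 : ℝ) r, z + s • dirX k ∈ W :=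
    fun z hz s hs1 => hs z hz s ⟨hs1.1, hs1.2.trans hr1⟩
  have main := L.increment_energy_le h hc₁ hc₂ hW₀ hr0 hs' hζ hζc hζW₀ hζ0 hζ1
    (by positivity : 0 ≤ 2 * M) hζM (B := |C| * r ^ m) (fun s hs1 =>
      (hC s ⟨hs1.1, hs1.2.trans hr2⟩).trans (mul_le_mul (le_abs_self _)
        (pow_le_pow_left₀ hs1.1.le hs1.2 m) (pow_nonneg hs1.1.le m) (abs_nonneg _)))
  set DV := increment (r • dirX k) fun z => fieldV φ (G z) with hDV
  set Du := increment (r • dirX k) u with hDu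
  have iDV2 : Integrable fun z => ‖DV z‖ ^ 2 := memLp_norm_sq (memLp_increment L.memLp_field _)
  have iDu2 : Integrable fun z => ‖Du z‖ ^ 2 := memLp_norm_sq (memLp_increment L.memLp_u _)
  have e1 : ∫ z in K, ‖DV z‖ ^ 2 ≤ ∫ z, ‖DV z‖ ^ 2 * ζ z := by
    rw [← integral_indicator hK.measurableSet]
    refine integral_mono (iDV2.indicator hK.measurableSet)
      (iDV2.mul_bdd (c := 1) hζ.continuous.aestronglyMeasurable (Eventually.of_forall fun z => by
        rw [Real.norm_of_nonneg (hζ0 z)]; exact hζ1 z)) fun z => ?_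
    by_cases hz : z ∈ K
    · simp [indicator_of_mem hz, hζdef, hθK z hz]
    · simp only [indicator_of_notMem hz]
      exact mul_nonneg (sq_nonneg _) (hζ0 z)
  have e2 : ∫ z in Function.support ζ, (‖fieldV φ (G (z + r • dirX k))‖ ^ 2 +
      ‖fieldV φ (G z)‖ ^ 2) ≤ 2 * SV := by
    refine (setIntegral_le_integral ((iV2.comp_add_right _).add iV2)
      (Eventually.of_forall fun z => add_nonneg (sq_nonneg _) (sq_nonneg _))).trans ?_
    rw [integral_add' (iV2.comp_add_right _) iV2,
      integral_add_right_eq_self (fun z => ‖fieldV φ (G z)‖ ^ 2)]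
    linarith
  have e3 : ∫ z, ‖Du z‖ ^ 2 * fderiv ℝ ζ z dirT ≤ T * (r ^ 2 * SG) := by
    have a1 := L.setIntegral_increment_sq_le hW₀ hr0.le hs'
    refine le_trans ?_ (mul_le_mul_of_nonneg_left a1 hT0)
    rw [← integral_const_mul, ← integral_indicator hW₀.measurableSet]
    refine integral_mono (iDu2.mul_bdd (c := T) ((hζ.continuous_fderiv one_ne_zero).clm_apply
      continuous_const).aestronglyMeasurable (Eventually.of_forall hT))
      ((iDu2.const_mul T).indicator hW₀.measurableSet) fun z => ?_
    by_cases hz : z ∈ W₀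
    · simp only [indicator_of_mem hz]
      rw [mul_comm]
      exact mul_le_mul_of_nonneg_right ((le_abs_self _).trans (hT z)) (sq_nonneg _)
    · have : fderiv ℝ ζ z = 0 := image_eq_zero_of_notMem_tsupport
        fun hh => hz (hζW₀ (tsupport_fderiv_subset ℝ hh))
      simp [indicator_of_notMem hz, this]
  have hrm : r ^ 2 ≤ r ^ (m + 1) := pow_le_pow_of_le_one hr0.le hr3 (by omega)
  calc ∫ z in K, ‖DV z‖ ^ 2
      ≤ 2 * (κ * F) ^ 2 * (2 * M) ^ 2 * r ^ 2 * (2 * SV) +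
        2 * (κ * F) * (2 * M) * (r * (|C| * r ^ m)) + κ * (T * (r ^ 2 * SG)) := by
        refine (e1.trans main).trans ?_
        gcongr
    _ = (2 * (κ * F) ^ 2 * (2 * M) ^ 2 * (2 * SV) + κ * (T * SG)) * r ^ 2 +
        2 * (κ * F) * (2 * M) * |C| * r ^ (m + 1) := by ring
    _ ≤ (2 * (κ * F) ^ 2 * (2 * M) ^ 2 * (2 * SV) + κ * (T * SG)) * r ^ (m + 1) +
        2 * (κ * F) * (2 * M) * |C| * r ^ (m + 1) := by gcongr
    _ = _ := by ring

/-- Two steps of the bootstrap, starting from the trivial order `0` given by translation invariance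
of the `L²` norm. -/
theorem IsIntegrableSolution.incrementBound_two (L : IsIntegrableSolution φ W u G)
    (h : OrliczAssumption c₁ c₂ φ) (hc₁ : 0 < c₁) (hc₂ : 0 < c₂) (hW : IsOpen W) (k : Fin n) :
    IncrementBound W (dirX k) (fun z => fieldV φ (G z)) 2 := by
  have h0 : IncrementBound W (dirX k) (fun z => fieldV φ (G z)) 0 := fun K _ _ =>
    ⟨4 * ∫ z, ‖fieldV φ (G z)‖ ^ 2, 1, one_pos, fun s _ => by
      simpa using setIntegral_increment_sq_le_four L.memLp_field (s • dirX k) K⟩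
  exact L.incrementBound_succ h hc₁ hc₂ hW le_rfl (L.incrementBound_succ h hc₁ hc₂ hW zero_le_one h0)

theorem IsIntegrableSolution.exists_isWeakDeriv_field (L : IsIntegrableSolution φ W u G)
    (h : OrliczAssumption c₁ c₂ φ) (hc₁ : 0 < c₁) (hc₂ : 0 < c₂) (hW : IsOpen W)
    (hW₀ : IsOpen W₀) (hW₀c : IsCompact (closure W₀)) (hW₀W : closure W₀ ⊆ W) (k : Fin n)
    (p : Fin N × Fin n) :
    ∃ g : SpaceTime n → ℝ, MemLp g 2 ∧ IsWeakDeriv W₀ (dirX k) (fun z => fieldV φ (G z) p) g := by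
  obtain ⟨C, δ, hδ, hC⟩ := L.incrementBound_two h hc₁ hc₂ hW k _ hW₀W hW₀c
  refine exists_isWeakDeriv_of_bounded hW₀.measurableSet
    (f := fun z => fieldV φ (G z) p) (integrable_apply L.integrable_field p)
    (memLp_apply L.memLp_field p) (C := C) ?_
  filter_upwards [Ioc_mem_nhdsGT hδ] with r hr
  refine le_trans ?_ (hC r hr)
  have iDV2 : Integrable fun z => ‖increment (r • dirX k) (fun z => fieldV φ (G z)) z‖ ^ 2 :=
    memLp_norm_sq (memLp_increment L.memLp_field _)
  have iDp := memLp_norm_sq (memLp_increment (memLp_apply L.memLp_field p) (r • dirX k))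
  refine le_trans (integral_mono (g := fun z =>
    ‖increment (r • dirX k) (fun z => fieldV φ (G z)) z‖ ^ 2) ?_ iDV2.integrableOn fun z => ?_)
    (setIntegral_mono_set iDV2.integrableOn (Eventually.of_forall fun z => sq_nonneg _)
      subset_closure.eventuallyLE)
  · refine iDp.integrableOn.congr (Eventually.of_forall fun z => ?_)
    simp [increment]
  · have := abs_apply_le (increment (r • dirX k) (fun z => fieldV φ (G z)) z) p
    have := pow_le_pow_left₀ (abs_nonneg _) this 2
    rw [sq_abs] at this
    exact this

/-- Difference quotients converge in `L²`. -/
theorem tendsto_integral_increment_sq_mul {ι : Type*} [Fintype ι] {e : SpaceTime n}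
    {f g : SpaceTime n → EuclideanSpace ℝ ι} (hf : Integrable f) (hf2 : MemLp f 2)
    (hg : Integrable g) (hg2 : MemLp g 2)
    (hfg : ∀ i, IsWeakDeriv W e (fun z => f z i) (fun z => g z i)) (hW₀ : IsOpen W₀) {δ : ℝ}
    (hδ : 0 < δ) (hs : ∀ z ∈ W₀, ∀ s ∈ Icc (0 : ℝ) δ, z + s • e ∈ W) {ψ : SpaceTime n → ℝ}
    (hψ : Continuous ψ) (hψc : HasCompactSupport ψ) (hψW : ∀ z, z ∉ W₀ → ψ z = 0) :
    Tendsto (fun r : ℝ => (∫ z, ‖increment (r • e) f z‖ ^ 2 * ψ z) / r ^ 2) (𝓝[>] 0)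
      (𝓝 (∫ z, ‖g z‖ ^ 2 * ψ z)) := by
  obtain ⟨C, hC⟩ := hψc.exists_bound_of_continuous hψ
  have m1 : ∀ i (r : ℝ), MemLp (fun z => (f (z + r • e) i - f z i) / r) 2 := fun i r => by
    have := (memLp_increment (memLp_apply hf2 i) (r • e)).const_mul r⁻¹
    refine this.ae_eq (Eventually.of_forall fun z => ?_)
    simp only [increment]; ring
  have i1 : ∀ i (r : ℝ), Integrable fun z => ((f (z + r • e) i - f z i) / r) ^ 2 := fun i r =>
    (memLp_two_iff_integrable_sq (m1 i r).1).1 (m1 i r)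
  have i2 : ∀ i, Integrable fun z => g z i ^ 2 := fun i =>
    (memLp_two_iff_integrable_sq (memLp_apply hg2 i).1).1 (memLp_apply hg2 i)
  have key : ∀ i, Tendsto (fun r : ℝ => ∫ z, ((f (z + r • e) i - f z i) / r) ^ 2 * ψ z) (𝓝[>] 0)
      (𝓝 (∫ z, g z i ^ 2 * ψ z)) := fun i =>
    tendsto_integral_sq_mul_of_tendsto hW₀.measurableSet
      (a := fun r z => (f (z + r • e) i - f z i) / r) (i1 i) (fun r => (m1 i r).1)
      (memLp_apply hg2 i)
      ((hfg i).tendsto_integral_sq (integrable_apply hf i) (integrable_apply hg i)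
        (memLp_apply hg2 i) hW₀ hδ hs) hψ hψc hψW
  have h2 := tendsto_finsetSum Finset.univ fun i _ => key i
  have e1 : ∀ r : ℝ, (∫ z, ‖increment (r • e) f z‖ ^ 2 * ψ z) / r ^ 2 =
      ∑ i, ∫ z, ((f (z + r • e) i - f z i) / r) ^ 2 * ψ z := fun r => by
    rw [← integral_finsetSum _ fun i _ =>
      (i1 i r).mul_bdd (c := C) hψ.aestronglyMeasurable (Eventually.of_forall hC),
      ← integral_div]
    congr 1; ext z
    rw [EuclideanSpace.norm_sq_eq, ← Finset.sum_mul]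
    simp only [div_pow, ← Finset.sum_div, increment, PiLp.sub_apply, Real.norm_eq_abs, sq_abs]
    ring
  have e2 : ∫ z, ‖g z‖ ^ 2 * ψ z = ∑ i, ∫ z, g z i ^ 2 * ψ z := by
    rw [← integral_finsetSum _ fun i _ =>
      (i2 i).mul_bdd (c := C) hψ.aestronglyMeasurable (Eventually.of_forall hC)]
    congr 1; ext z
    rw [EuclideanSpace.norm_sq_eq, ← Finset.sum_mul]
    simp only [Real.norm_eq_abs, sq_abs]
  rw [e2]
  exact h2.congr fun r => (e1 r).symm

/-- The constant in the energy estimate for a solution. -/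
def energyConst (c₁ c₂ : ℝ) : ℝ := 6 * (monoConst c₁ c₂ * OrliczAssumption.fluxConst c₁) ^ 2

/-- The shifted field is removed by `|V(z + re)|² ≤ 2|V(z)|² + 2|ΔV(z)|²`, so that only `V` on the
support of `ζ` remains. The known order `r²` of the increments makes every extra term vanish as `r →
0`. -/
theorem IsIntegrableSolution.increment_energy_div_le (L : IsIntegrableSolution φ W u G)
    (h : OrliczAssumption c₁ c₂ φ) (hc₁ : 0 < c₁) (hc₂ : 0 < c₂) (hW₀ : IsOpen W₀) {k : Fin n}
    {r : ℝ} (hr : 0 < r) (hs : ∀ z ∈ W₀, ∀ s ∈ Icc (0 : ℝ) r, z + s • dirX k ∈ W)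
    {ζ : SpaceTime n → ℝ} (hζ : ContDiff ℝ 1 ζ) (hζc : HasCompactSupport ζ)
    (hζW : tsupport ζ ⊆ W₀) (hζ0 : ∀ z, 0 ≤ ζ z) (hζ1 : ∀ z, ζ z ≤ 1) {M : ℝ} (hM : 0 ≤ M)
    (hζM : ∀ z, ‖spaceGrad ζ z‖ ^ 2 ≤ M ^ 2 * ζ z) {C : ℝ} (hC0 : 0 ≤ C)
    (hC : ∀ s ∈ Ioc 0 r, ∫ z in tsupport ζ,
      ‖increment (s • dirX k) (fun z => fieldV φ (G z)) z‖ ^ 2 ≤ C * s ^ 2) :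
    (∫ z, ‖increment (r • dirX k) (fun z => fieldV φ (G z)) z‖ ^ 2 * ζ z) / r ^ 2 ≤
      2 * (monoConst c₁ c₂ * OrliczAssumption.fluxConst c₁) ^ 2 * M ^ 2 *
        (3 * (∫ z in Function.support ζ, ‖fieldV φ (G z)‖ ^ 2) + 2 * (C * r ^ 2)) +
      2 * (monoConst c₁ c₂ * OrliczAssumption.fluxConst c₁) * M * (r * C) +
      monoConst c₁ c₂ *
        ((∫ z, ‖increment (r • dirX k) u z‖ ^ 2 * fderiv ℝ ζ z dirT) / r ^ 2) := by
  have main := L.increment_energy_le h hc₁ hc₂ hW₀ hr hs hζ hζc hζW hζ0 hζ1 hM hζM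
    (B := C * r ^ 2) (fun s hs1 => (hC s hs1).trans
      (mul_le_mul_of_nonneg_left (pow_le_pow_left₀ hs1.1.le hs1.2 2) hC0))
  set SV := ∫ z in Function.support ζ, ‖fieldV φ (G z)‖ ^ 2 with hSV
  have iV2 := L.integrable_field_sq
  have iDV2 : Integrable fun z => ‖increment (r • dirX k) (fun z => fieldV φ (G z)) z‖ ^ 2 :=
    memLp_norm_sq (memLp_increment L.memLp_field _)
  have e2 : ∫ z in Function.support ζ, (‖fieldV φ (G (z + r • dirX k))‖ ^ 2 +
      ‖fieldV φ (G z)‖ ^ 2) ≤ 3 * SV + 2 * (C * r ^ 2) := by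
    calc ∫ z in Function.support ζ, (‖fieldV φ (G (z + r • dirX k))‖ ^ 2 +
          ‖fieldV φ (G z)‖ ^ 2)
        ≤ ∫ z in Function.support ζ, (3 * ‖fieldV φ (G z)‖ ^ 2 +
          2 * ‖increment (r • dirX k) (fun z => fieldV φ (G z)) z‖ ^ 2) := by
          refine integral_mono ((iV2.comp_add_right _).add iV2).integrableOn
            ((iV2.const_mul 3).add (iDV2.const_mul 2)).integrableOn fun z => ?_
          have a1 : ‖fieldV φ (G (z + r • dirX k))‖ ≤ ‖fieldV φ (G z)‖ +
              ‖increment (r • dirX k) (fun z => fieldV φ (G z)) z‖ :=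
            norm_le_norm_add_norm_sub' _ _
          have a2 := pow_le_pow_left₀ (norm_nonneg _) a1 2
          simp only
          linarith [sq_nonneg (‖fieldV φ (G z)‖ -
            ‖increment (r • dirX k) (fun z => fieldV φ (G z)) z‖)]
      _ = 3 * SV + 2 * ∫ z in Function.support ζ,
          ‖increment (r • dirX k) (fun z => fieldV φ (G z)) z‖ ^ 2 := by
          rw [integral_add (iV2.const_mul 3).integrableOn (iDV2.const_mul 2).integrableOn,
            integral_const_mul, integral_const_mul]
      _ ≤ _ := by
          gcongr
          refine (setIntegral_mono_set iDV2.integrableOn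
            (Eventually.of_forall fun z => sq_nonneg _) subset_closure.eventuallyLE).trans ?_
          exact hC r ⟨hr, le_rfl⟩
  have m2 := main.trans (add_le_add_left (add_le_add_left (mul_le_mul_of_nonneg_left e2
    (by positivity)) _) _)
  rw [div_le_iff₀ (by positivity)]
  refine m2.trans (le_of_eq ?_)
  field_simp

/-- Limit `r → 0` of the previous inequality, by `L²` convergence of the difference quotients of
`V(∇u)` and `u`. The `6` in `energyConst` is `2 · 3`, the `3` coming from the removal of the shift.
-/
theorem IsIntegrableSolution.column_energy_le (L : IsIntegrableSolution φ W u G)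
    (h : OrliczAssumption c₁ c₂ φ) (hc₁ : 0 < c₁) (hc₂ : 0 < c₂) (hW : IsOpen W)
    {H : SpaceTime n → Mat (Fin N × Fin n) n} (hH : Integrable H) (hH2 : MemLp H 2)
    (hVH : ∀ p k, IsWeakDeriv W (dirX k) (fun z => fieldV φ (G z) p) (fun z => H z (p, k)))
    {ζ : SpaceTime n → ℝ} (hζ : ContDiff ℝ 1 ζ) (hζc : HasCompactSupport ζ)
    (hζW : tsupport ζ ⊆ W) (hζ0 : ∀ z, 0 ≤ ζ z) (hζ1 : ∀ z, ζ z ≤ 1) {M : ℝ} (hM : 0 ≤ M)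
    (hζM : ∀ z, ‖spaceGrad ζ z‖ ^ 2 ≤ M ^ 2 * ζ z) (k : Fin n) :
    ∫ z, ‖column k (H z)‖ ^ 2 * ζ z ≤
      energyConst c₁ c₂ * M ^ 2 * (∫ z in Function.support ζ, ‖fieldV φ (G z)‖ ^ 2) +
      monoConst c₁ c₂ * ∫ z, ‖column k (G z)‖ ^ 2 * fderiv ℝ ζ z dirT := by
  set κ := monoConst c₁ c₂ with hκ
  have hκ0 : 0 < κ := monoConst_pos hc₁
  set F := OrliczAssumption.fluxConst c₁ with hF
  have hF0 : 0 < F := OrliczAssumption.fluxConst_pos hc₁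
  set SV := ∫ z in Function.support ζ, ‖fieldV φ (G z)‖ ^ 2 with hSV
  have iV2 := L.integrable_field_sq
  have mS : MeasurableSet (Function.support ζ) := hζ.continuous.isOpen_support.measurableSet
  have cT : Continuous fun z => fderiv ℝ ζ z dirT :=
    (hζ.continuous_fderiv one_ne_zero).clm_apply continuous_const
  have sT : HasCompactSupport fun z => fderiv ℝ ζ z dirT := hζc.fderiv_apply (𝕜 := ℝ) dirT
  obtain ⟨W₀, hW₀, hζW₀, δ₁, hδ₁, hs⟩ := exists_open_forall_add_smul_mem hζc hW hζW
    (norm_dirX_le k)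
  obtain ⟨C, δ₂, hδ₂, hC⟩ := L.incrementBound_two h hc₁ hc₂ hW k _ hζW hζc
  have l1 := tendsto_integral_increment_sq_mul L.integrable_field L.memLp_field
    ((column k).integrable_comp hH) ((column k).comp_memLp' hH2) (fun p => hVH p k) hW₀ hδ₁ hs
    hζ.continuous hζc (fun z hz => image_eq_zero_of_notMem_tsupport fun hh => hz (hζW₀ hh))
  have l2 := tendsto_integral_increment_sq_mul L.integrable_u L.memLp_u
    ((column k).integrable_comp L.integrable_grad) ((column k).comp_memLp' L.memLp_grad)
    (fun i => L.weakGrad i k) hW₀ hδ₁ hs cT sT (fun z hz => by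
      have : fderiv ℝ ζ z = 0 := image_eq_zero_of_notMem_tsupport
        fun hh => hz (hζW₀ (tsupport_fderiv_subset ℝ hh))
      simp [this])
  have l3 : Tendsto (fun r : ℝ => 2 * (κ * F) ^ 2 * M ^ 2 * (3 * SV + 2 * (|C| * r ^ 2)) +
      2 * (κ * F) * M * (r * |C|)) (𝓝[>] 0)
      (𝓝 (2 * (κ * F) ^ 2 * M ^ 2 * (3 * SV + 2 * (|C| * 0 ^ 2)) +
        2 * (κ * F) * M * (0 * |C|))) := by
    apply Tendsto.mono_left _ nhdsWithin_le_nhds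
    exact Continuous.tendsto (f := fun r : ℝ => 2 * (κ * F) ^ 2 * M ^ 2 *
      (3 * SV + 2 * (|C| * r ^ 2)) + 2 * (κ * F) * M * (r * |C|)) (by fun_prop) 0
  have l4 := l3.add (l2.const_mul κ)
  have := le_of_tendsto_of_tendsto l1 l4 (by
    filter_upwards [Ioc_mem_nhdsGT (lt_min hδ₁ hδ₂)] with r hr
    have hr1 : r ≤ δ₁ := hr.2.trans (min_le_left _ _)
    have hr2 : r ≤ δ₂ := hr.2.trans (min_le_right _ _)
    exact L.increment_energy_div_le h hc₁ hc₂ hW₀ hr.1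
      (fun z hz s hs1 => hs z hz s ⟨hs1.1, hs1.2.trans hr1⟩) hζ hζc hζW₀ hζ0 hζ1 hM hζM
      (abs_nonneg C) fun s hs1 => (hC s ⟨hs1.1, hs1.2.trans hr2⟩).trans
        (mul_le_mul_of_nonneg_right (le_abs_self _) (sq_nonneg _)))
  refine this.trans (le_of_eq ?_)
  simp only [energyConst, ← hκ, ← hF]
  ring

theorem integral_norm_sq_mul_eq_sum {ι : Type} [Fintype ι] {H : SpaceTime n → Mat ι n}
    (hH : MemLp H 2) {ψ : SpaceTime n → ℝ} (hψ : Continuous ψ) (hψc : HasCompactSupport ψ) :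
    ∫ z, ‖H z‖ ^ 2 * ψ z = ∑ k, ∫ z, ‖column k (H z)‖ ^ 2 * ψ z := by
  obtain ⟨T, hT⟩ := hψc.exists_bound_of_continuous hψ
  have h1 : ∀ k, MemLp (fun z => column k (H z)) 2 := fun k =>
    ContinuousLinearMap.comp_memLp' (column (ι := ι) k) hH
  have iH : ∀ k, Integrable fun z => ‖column k (H z)‖ ^ 2 * ψ z := fun k =>
    (memLp_norm_sq (h1 k)).mul_bdd (c := T) hψ.aestronglyMeasurable (Eventually.of_forall hT)
  rw [← integral_finsetSum _ fun k _ => iH k]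
  simp only [← Finset.sum_mul, sum_norm_column_sq]

/-- Sum over the space directions: the term with `V` is the same for each direction and picks up the
factor `n`, while the columns of `∇u` add up to the full Frobenius norm. -/
theorem IsIntegrableSolution.energy_le (L : IsIntegrableSolution φ W u G)
    (h : OrliczAssumption c₁ c₂ φ) (hc₁ : 0 < c₁) (hc₂ : 0 < c₂) (hW : IsOpen W)
    {H : SpaceTime n → Mat (Fin N × Fin n) n} (hH : Integrable H) (hH2 : MemLp H 2)
    (hVH : ∀ p k, IsWeakDeriv W (dirX k) (fun z => fieldV φ (G z) p) (fun z => H z (p, k)))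
    {ζ : SpaceTime n → ℝ} (hζ : ContDiff ℝ 1 ζ) (hζc : HasCompactSupport ζ)
    (hζW : tsupport ζ ⊆ W) (hζ0 : ∀ z, 0 ≤ ζ z) (hζ1 : ∀ z, ζ z ≤ 1) {M : ℝ} (hM : 0 ≤ M)
    (hζM : ∀ z, ‖spaceGrad ζ z‖ ^ 2 ≤ M ^ 2 * ζ z) :
    ∫ z, ‖H z‖ ^ 2 * ζ z ≤
      n * (energyConst c₁ c₂ * M ^ 2 * ∫ z in Function.support ζ, ‖fieldV φ (G z)‖ ^ 2) +
      monoConst c₁ c₂ * ∫ z, ‖G z‖ ^ 2 * fderiv ℝ ζ z dirT := by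
  have sT : HasCompactSupport fun z => fderiv ℝ ζ z dirT := hζc.fderiv_apply (𝕜 := ℝ) dirT
  have cT : Continuous fun z => fderiv ℝ ζ z dirT :=
    (hζ.continuous_fderiv one_ne_zero).clm_apply continuous_const
  rw [integral_norm_sq_mul_eq_sum hH2 hζ.continuous hζc,
    integral_norm_sq_mul_eq_sum L.memLp_grad cT sT]
  refine (Finset.sum_le_sum fun k _ =>
    L.column_energy_le h hc₁ hc₂ hW hH hH2 hVH hζ hζc hζW hζ0 hζ1 hM hζM k).trans (le_of_eq ?_)
  rw [Finset.sum_add_distrib, Finset.sum_const, Finset.card_univ, Fintype.card_fin, nsmul_eq_mul,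
    Finset.mul_sum]

end Regularity

/-! ### From local weak solutions to integrable ones -/

section Localization

variable {n N : ℕ} {c₁ c₂ : ℝ} {φ : ℝ → ℝ} {J : Set ℝ} {Ω : Set (EuclideanSpace ℝ (Fin n))}
  {U W : Set (SpaceTime n)} {u : SpaceTime n → EuclideanSpace ℝ (Fin N)}
  {G : SpaceTime n → Mat (Fin N) n}

theorem fluxA_indicator (W : Set (SpaceTime n)) (G : SpaceTime n → Mat (Fin N) n) :
    (fun z => fluxA φ (W.indicator G z)) = W.indicator fun z => fluxA φ (G z) := by
  ext z : 1
  by_cases hz : z ∈ W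
  · simp [indicator_of_mem hz]
  · simp [indicator_of_notMem hz, fluxA]

theorem fieldV_indicator (W : Set (SpaceTime n)) (G : SpaceTime n → Mat (Fin N) n) :
    (fun z => fieldV φ (W.indicator G z)) = W.indicator fun z => fieldV φ (G z) := by
  ext z : 1
  by_cases hz : z ∈ W
  · simp [indicator_of_mem hz]
  · simp [indicator_of_notMem hz, fieldV]

theorem IsLocalWeakSolution.memLp_restrict (S : IsLocalWeakSolution φ J Ω u G)
    (hWc : IsCompact (closure W)) (hWU : closure W ⊆ J ×ˢ Ω) :
    MemLp u 2 (volume.restrict W) := by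
  set I := Prod.fst '' closure W with hI
  set K := Prod.snd '' closure W with hK
  have cI : IsCompact I := hWc.image continuous_fst
  have cK : IsCompact K := hWc.image continuous_snd
  have hIJ : I ⊆ J := by
    rintro _ ⟨z, hz, rfl⟩; exact (hWU hz).1
  have hKΩ : K ⊆ Ω := by
    rintro _ ⟨z, hz, rfl⟩; exact (hWU hz).2
  have hWIK : W ⊆ I ×ˢ K := fun z hz =>
    ⟨⟨z, subset_closure hz, rfl⟩, ⟨z, subset_closure hz, rfl⟩⟩
  obtain ⟨M, hM⟩ := S.bounded_sq I K cI cK hIJ hKΩ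
  have iu : IntegrableOn u (I ×ˢ K) :=
    S.weakGradient.1.integrableOn_compact_subset (prod_mono hIJ hKΩ) (cI.prod cK)
  refine MemLp.mono_measure (Measure.restrict_mono hWIK le_rfl) ⟨iu.aestronglyMeasurable, ?_⟩
  rw [eLpNorm_lt_top_iff_lintegral_rpow_enorm_lt_top two_ne_zero ENNReal.ofNat_ne_top]
  have hr : (volume : Measure (SpaceTime n)).restrict (I ×ˢ K) =
      (volume.restrict I).prod (volume.restrict K) := (Measure.prod_restrict I K).symm
  have hm : AEMeasurable (fun z => ‖u z‖ₑ ^ 2) ((volume.restrict I).prod (volume.restrict K)) := by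
    rw [← hr]; exact iu.aestronglyMeasurable.enorm.pow_const 2
  simp only [ENNReal.toReal_ofNat, ENNReal.rpow_ofNat]
  rw [hr, lintegral_prod _ hm]
  calc ∫⁻ s in I, ∫⁻ x in K, ‖u (s, x)‖ₑ ^ 2 ≤ ∫⁻ _ in I, M := lintegral_mono_ae hM
    _ < ⊤ := by
      rw [setLIntegral_const]
      exact ENNReal.mul_lt_top ENNReal.coe_lt_top cI.measure_lt_top

theorem SqLocallyIntegrableOn.memLp_restrict {F : Type} [NormedAddCommGroup F]
    {g : SpaceTime n → F} (hg : SqLocallyIntegrableOn g U) (hg1 : LocallyIntegrableOn g U)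
    (hWc : IsCompact (closure W)) (hWU : closure W ⊆ U) : MemLp g 2 (volume.restrict W) := by
  have i1 := (hg1.integrableOn_compact_subset hWU hWc).mono_set subset_closure
  have i2 := (hg.integrableOn_compact_subset hWU hWc).mono_set subset_closure
  exact (memLp_two_iff_integrable_sq_norm i1.aestronglyMeasurable).2 i2

theorem IsLocalWeakSolution.memLp_field_restrict (S : IsLocalWeakSolution φ J Ω u G)
    (h : OrliczAssumption c₁ c₂ φ) (hc₁ : 0 < c₁) (hc₂ : 0 < c₂)
    (hWc : IsCompact (closure W)) (hWU : closure W ⊆ J ×ˢ Ω) :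
    MemLp (fun z => fieldV φ (G z)) 2 (volume.restrict W) := by
  have i1 := (S.weakGradient.2.1.integrableOn_compact_subset hWU hWc).mono_set subset_closure
  have i2 := (S.energy.integrableOn_compact_subset hWU hWc).mono_set subset_closure
  have hm : AEStronglyMeasurable (fun z => fieldV φ (G z)) (volume.restrict W) :=
    ((measurable_fieldV φ).comp_aemeasurable i1.aestronglyMeasurable.aemeasurable).aestronglyMeasurable
  refine (memLp_two_iff_integrable_sq_norm hm).2 ((i2.const_mul (1 + 1 / c₁)).mono' (hm.norm.pow 2)
    (Eventually.of_forall fun z => ?_))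
  rw [Real.norm_of_nonneg (sq_nonneg _), h.norm_fieldV_sq]
  exact h.deriv_mul_self_le hc₁ hc₂ (norm_nonneg _)

theorem isFiniteMeasure_restrict_of_closure (hWc : IsCompact (closure W)) :
    IsFiniteMeasure ((volume : Measure (SpaceTime n)).restrict W) :=
  ⟨by rw [Measure.restrict_apply_univ]
      exact (measure_mono subset_closure).trans_lt hWc.measure_lt_top⟩

theorem IsTest.fderiv_eq_zero {ζ : SpaceTime n → ℝ} (hζ : IsTest W ζ) {z : SpaceTime n}
    (hz : z ∉ W) : fderiv ℝ ζ z = 0 :=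
  image_eq_zero_of_notMem_tsupport fun hh => hz (hζ.2.2 (tsupport_fderiv_subset ℝ hh))

theorem IsTest.eq_zero {ζ : SpaceTime n → ℝ} (hζ : IsTest W ζ) {z : SpaceTime n}
    (hz : z ∉ W) : ζ z = 0 :=
  image_eq_zero_of_notMem_tsupport fun hh => hz (hζ.2.2 hh)

theorem IsWeakSpaceGradient.isWeakDeriv {ι : Type} [Fintype ι]
    {w : SpaceTime n → EuclideanSpace ℝ ι} {G : SpaceTime n → Mat ι n}
    (hw : IsWeakSpaceGradient U w G) (hWU : W ⊆ U) (i : ι) (j : Fin n) :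
    IsWeakDeriv W (dirX j) (fun z => W.indicator w z i) (fun z => W.indicator G z (i, j)) := by
  intro ζ hζ
  have h1 := hw.2.2 ζ (hζ.mono hWU) i j
  rw [setIntegral_eq_integral_of_forall_compl_eq_zero, setIntegral_eq_integral_of_forall_compl_eq_zero]
    at h1
  · convert h1 using 2
    · ext z
      by_cases hz : z ∈ W
      · simp [indicator_of_mem hz, spaceDeriv, dirX]
      · simp [spaceDeriv, hζ.fderiv_eq_zero hz]
    · congr 1; ext z
      by_cases hz : z ∈ W
      · simp [indicator_of_mem hz]
      · simp [hζ.eq_zero hz]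
  · intro z hz
    rw [hζ.eq_zero fun h => hz (hWU h), mul_zero]
  · intro z hz
    rw [spaceDeriv, hζ.fderiv_eq_zero fun h => hz (hWU h)]; simp

theorem fderiv_euclideanSpace_single {ζ : SpaceTime n → ℝ} (hζ : ContDiff ℝ ∞ ζ) (i : Fin N)
    (z v : SpaceTime n) :
    fderiv ℝ (fun z => EuclideanSpace.single i (ζ z)) z v =
      EuclideanSpace.single i (fderiv ℝ ζ z v) := by
  have e : (fun z => EuclideanSpace.single i (ζ z)) =
      fun z => ζ z • EuclideanSpace.single i (1 : ℝ) := by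
    ext z j; simp
  have h1 := ((hζ.differentiable (by simp) z).hasFDerivAt.smul_const
    (EuclideanSpace.single i (1 : ℝ))).fderiv
  rw [e, h1]
  ext j; simp

/-- Since `A` and `V` vanish at `0`, extending `∇u` by zero outside a relatively compact open set
commutes with both, and test functions supported in that set see no difference. The scalar equations
come from test functions with a single nonzero component. -/
theorem IsLocalWeakSolution.isIntegrableSolution (S : IsLocalWeakSolution φ J Ω u G)
    (h : OrliczAssumption c₁ c₂ φ) (hc₁ : 0 < c₁) (hc₂ : 0 < c₂)
    (hG : SqLocallyIntegrableOn G (J ×ˢ Ω)) (hW : IsOpen W) (hWc : IsCompact (closure W))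
    (hWU : closure W ⊆ J ×ˢ Ω) :
    IsIntegrableSolution φ W (W.indicator u) (W.indicator G) := by
  have := isFiniteMeasure_restrict_of_closure hWc
  have hWU' : W ⊆ J ×ˢ Ω := subset_closure.trans hWU
  have hWm := hW.measurableSet
  have iu := (S.weakGradient.1.integrableOn_compact_subset hWU hWc).mono_set
    (subset_closure (s := W))
  have iG := (S.weakGradient.2.1.integrableOn_compact_subset hWU hWc).mono_set
    (subset_closure (s := W))
  have mV := S.memLp_field_restrict h hc₁ hc₂ hWc hWU
  have iV : IntegrableOn (fun z => fieldV φ (G z)) W := mV.integrable one_le_two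
  have hAm : AEStronglyMeasurable (fun z => fluxA φ (G z)) (volume.restrict W) :=
    ((measurable_fluxA φ).comp_aemeasurable iG.aestronglyMeasurable.aemeasurable).aestronglyMeasurable
  have iA : IntegrableOn (fun z => fluxA φ (G z)) W :=
    ((integrable_const (deriv φ 1)).add ((memLp_two_iff_integrable_sq_norm mV.1).1 mV)).mono' hAm
      (Eventually.of_forall fun z => h.norm_fluxA_le hc₂ (G z))
  have iAW : Integrable (W.indicator fun z => fluxA φ (G z)) := iA.integrable_indicator hWm
  refine ⟨iu.integrable_indicator hWm, (memLp_indicator_iff_restrict hWm).2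
    (S.memLp_restrict hWc hWU), iG.integrable_indicator hWm, (memLp_indicator_iff_restrict hWm).2
    (hG.memLp_restrict S.weakGradient.2.1 hWc hWU), ?_, ?_, ?_,
    fun i j => S.weakGradient.isWeakDeriv hWU' i j, ?_⟩
  · rw [fluxA_indicator]; exact iAW
  · rw [fieldV_indicator]; exact iV.integrable_indicator hWm
  · rw [fieldV_indicator]; exact (memLp_indicator_iff_restrict hWm).2 mV
  · intro i ζ hζ
    have ht : IsTestFunction (J ×ˢ Ω) fun z => EuclideanSpace.single i (ζ z) := by
      have hs : tsupport (fun z => EuclideanSpace.single i (ζ z)) ⊆ tsupport ζ :=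
        closure_mono fun z hz => by
          contrapose! hz
          simp only [Function.mem_support, not_not] at hz ⊢
          rw [hz]; simp
      refine ⟨?_, hζ.2.1.of_isClosed_subset (isClosed_tsupport _) hs, hs.trans (hζ.2.2.trans hWU')⟩
      have e : (fun z => EuclideanSpace.single i (ζ z)) =
          fun z => ζ z • EuclideanSpace.single i (1 : ℝ) := by
        ext z j; simp
      rw [e]
      exact hζ.1.smul contDiff_const
    have h1 := S.equation _ ht
    have e1 : ∀ z, inner ℝ (fluxA φ (G z)) (spaceJac (fun z => EuclideanSpace.single i (ζ z)) z) =
        ∑ j, fluxA φ (W.indicator G z) (i, j) * fderiv ℝ ζ z (dirX j) := by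
      intro z
      have e2 : ∀ i' j, spaceJac (fun z => EuclideanSpace.single i (ζ z)) z (i', j) =
          if i' = i then fderiv ℝ ζ z (dirX j) else 0 := fun i' j => by
        simp [spaceJac, spaceDeriv, fderiv_euclideanSpace_single hζ.1, dirX]
      rw [inner_mat, Finset.sum_eq_single i]
      · refine Finset.sum_congr rfl fun j _ => ?_
        rw [e2, if_pos rfl]
        by_cases hz : z ∈ W
        · rw [indicator_of_mem hz]
        · simp [hζ.fderiv_eq_zero hz]
      · intro i' _ hi'
        refine Finset.sum_eq_zero fun j _ => ?_
        rw [e2, if_neg hi', mul_zero]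
      · simp
    have e3 : ∀ z, inner ℝ (u z) (timeDeriv (fun z => EuclideanSpace.single i (ζ z)) z) =
        W.indicator u z i * fderiv ℝ ζ z dirT := by
      intro z
      rw [timeDeriv, fderiv_euclideanSpace_single hζ.1, EuclideanSpace.inner_single_right]
      by_cases hz : z ∈ W
      · simp [indicator_of_mem hz, dirT, mul_comm]
      · simp [hζ.fderiv_eq_zero hz]
    simp only [e1, e3] at h1
    rw [setIntegral_eq_integral_of_forall_compl_eq_zero,
      setIntegral_eq_integral_of_forall_compl_eq_zero, integral_finsetSum] at h1
    · exact h1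
    · intro j _
      refine hζ.integrable_mul_fderiv (f := fun z => fluxA φ (W.indicator G z) (i, j)) ?_ _
      have := integrable_apply iAW (i, j)
      rwa [← fluxA_indicator] at this
    · intro z hz
      simp [hζ.fderiv_eq_zero fun h => hz (hWU' h)]
    · intro z hz
      simp [hζ.fderiv_eq_zero fun h => hz (hWU' h)]

/-- On each relatively compact set the solution is truncated to a slightly larger one, leaving room
for the shifts. The local derivatives of the components are then glued. -/
theorem IsLocalWeakSolution.exists_gradient_field (S : IsLocalWeakSolution φ J Ω u G)
    (h : OrliczAssumption c₁ c₂ φ) (hc₁ : 0 < c₁) (hc₂ : 0 < c₂) (hU : IsOpen (J ×ˢ Ω))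
    (hG : SqLocallyIntegrableOn G (J ×ˢ Ω)) :
    ∃ H : SpaceTime n → Mat (Fin N × Fin n) n,
      IsWeakSpaceGradient (J ×ˢ Ω) (fun z => fieldV φ (G z)) H ∧
        SqLocallyIntegrableOn H (J ×ˢ Ω) := by
  have key : ∀ (p : Fin N × Fin n) (k : Fin n), ∃ g : SpaceTime n → ℝ,
      IsWeakDeriv (J ×ˢ Ω) (dirX k) (fun z => fieldV φ (G z) p) g ∧
        ∀ W, IsCompact (closure W) → closure W ⊆ J ×ˢ Ω → MemLp g 2 (volume.restrict W) := by
    intro p k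
    refine exists_isWeakDeriv_of_local hU fun W hW hWc hWU => ?_
    obtain ⟨W', hW', hWW', hW'U, hW'c⟩ := exists_open_between_and_isCompact_closure hWc hU hWU
    have L := S.isIntegrableSolution h hc₁ hc₂ hG hW' hW'c hW'U
    obtain ⟨g, hg, hg'⟩ := L.exists_isWeakDeriv_field h hc₁ hc₂ hW' hW hWc hWW' k p
    refine ⟨g, hg, hg'.congr (Eventually.of_forall fun z hz => ?_)
      (Eventually.of_forall fun z _ => rfl)⟩
    rw [indicator_of_mem (hWW' (subset_closure hz))]
  choose g hg hg2 using key
  set H : SpaceTime n → Mat (Fin N × Fin n) n := fun z => WithLp.toLp 2 fun q => g q.1 q.2 z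
    with hH
  have hHm : ∀ W, IsCompact (closure W) → closure W ⊆ J ×ˢ Ω → MemLp H 2 (volume.restrict W) :=
    fun W hWc hWU => MemLp.of_eval_piLp fun q => hg2 q.1 q.2 W hWc hWU
  have hlc := hU.isLocallyClosed
  have hcl : ∀ K : Set (SpaceTime n), IsCompact K → K ⊆ J ×ˢ Ω →
      IsCompact (closure K) ∧ closure K ⊆ J ×ˢ Ω := fun K hK hKU => by
    rw [hK.isClosed.closure_eq]; exact ⟨hK, hKU⟩
  refine ⟨H, ⟨?_, ?_, ?_⟩, ?_⟩
  · rw [locallyIntegrableOn_iff hlc]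
    intro K hKU hK
    obtain ⟨a, b⟩ := hcl K hK hKU
    have := isFiniteMeasure_restrict_of_closure a
    exact (S.memLp_field_restrict h hc₁ hc₂ a b).integrable one_le_two
  · rw [locallyIntegrableOn_iff hlc]
    intro K hKU hK
    obtain ⟨a, b⟩ := hcl K hK hKU
    have := isFiniteMeasure_restrict_of_closure a
    exact (hHm K a b).integrable one_le_two
  · intro ζ hζ p k
    rw [setIntegral_eq_integral_of_forall_compl_eq_zero,
      setIntegral_eq_integral_of_forall_compl_eq_zero]
    · exact hg p k ζ hζ
    · intro z hz
      rw [IsTest.eq_zero (W := J ×ˢ Ω) hζ hz, mul_zero]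
    · intro z hz
      rw [spaceDeriv, IsTest.fderiv_eq_zero (W := J ×ˢ Ω) hζ hz]; simp
  · rw [SqLocallyIntegrableOn, locallyIntegrableOn_iff hlc]
    intro K hKU hK
    obtain ⟨a, b⟩ := hcl K hK hKU
    exact (memLp_two_iff_integrable_sq_norm (hHm K a b).1).1 (hHm K a b)

end Localization

/-! ### Smooth steps in time -/

section Step

theorem mollifier_eq_zero {k : ℕ} {x : ℝ} (hx : 1 / ((k : ℝ) + 1) ≤ |x|) : mollifier ℝ k x = 0 := by
  have h1 : Function.support (mollifier ℝ k) = Metric.ball 0 (bumpSeq ℝ k).rOut :=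
    (bumpSeq ℝ k).support_normed_eq
  have h2 : x ∉ Function.support (mollifier ℝ k) := by
    rw [h1, mem_ball_zero_iff, not_lt]
    exact hx
  simpa using h2

/-- A smooth decreasing transition from `1` to `0` around the time `s`. -/
def stepDown (k : ℕ) (s t : ℝ) : ℝ := ∫ τ in t..(s + 1), mollifier ℝ k (s - τ)

variable {k : ℕ} {s t : ℝ}

theorem continuous_mollifier_sub (k : ℕ) (s : ℝ) : Continuous fun τ => mollifier ℝ k (s - τ) :=
  (contDiff_mollifier k).continuous.comp (by fun_prop)

theorem integrable_mollifier_sub (k : ℕ) (s : ℝ) : Integrable fun τ => mollifier ℝ k (s - τ) :=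
  ((contDiff_mollifier k).continuous.integrable_of_hasCompactSupport
    (hasCompactSupport_mollifier k)).comp_sub_left s

theorem hasDerivAt_stepDown (k : ℕ) (s t : ℝ) :
    HasDerivAt (stepDown k s) (-mollifier ℝ k (s - t)) t :=
  intervalIntegral.integral_hasDerivAt_left
    ((continuous_mollifier_sub k s).intervalIntegrable _ _)
    ((continuous_mollifier_sub k s).stronglyMeasurableAtFilter _ _)
    (continuous_mollifier_sub k s).continuousAt

theorem contDiff_stepDown (k : ℕ) (s : ℝ) : ContDiff ℝ 1 (stepDown k s) := by
  rw [contDiff_one_iff_deriv]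
  refine ⟨fun t => (hasDerivAt_stepDown k s t).differentiableAt, ?_⟩
  have : deriv (stepDown k s) = fun t => -mollifier ℝ k (s - t) :=
    funext fun t => (hasDerivAt_stepDown k s t).deriv
  rw [this]
  exact (continuous_mollifier_sub k s).neg

theorem stepDown_eq_zero (ht : s + 1 / ((k : ℝ) + 1) ≤ t) : stepDown k s t = 0 := by
  have hk : 1 / ((k : ℝ) + 1) ≤ 1 := by
    rw [div_le_one (by positivity)]; linarith [(Nat.cast_nonneg k : (0 : ℝ) ≤ k)]
  rw [stepDown, intervalIntegral.integral_congr (g := fun _ => (0 : ℝ)),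
    intervalIntegral.integral_zero]
  intro τ hτ
  apply mollifier_eq_zero
  -- Covers a reversed interval as well, when `t > s + 1`; the endpoint `s + 1` is beyond the
  -- support of the kernel because its radius is at most `1`.
  have h1 : s + 1 / ((k : ℝ) + 1) ≤ τ := (le_min ht (by linarith)).trans hτ.1
  rw [abs_sub_comm]
  exact le_trans (by linarith) (le_abs_self _)

theorem stepDown_nonneg : 0 ≤ stepDown k s t := by
  rcases le_total t (s + 1) with h | h
  · exact intervalIntegral.integral_nonneg h fun τ _ => mollifier_nonneg k _
  · refine (stepDown_eq_zero (le_trans ?_ h)).ge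
    have : 1 / ((k : ℝ) + 1) ≤ 1 := by
      rw [div_le_one (by positivity)]; linarith [(Nat.cast_nonneg k : (0 : ℝ) ≤ k)]
    linarith

theorem integral_mollifier_sub (k : ℕ) (s : ℝ) : ∫ τ, mollifier ℝ k (s - τ) = 1 := by
  rw [integral_sub_left_eq_self (mollifier ℝ k), integral_mollifier]

theorem stepDown_le_one : stepDown k s t ≤ 1 := by
  rcases le_total t (s + 1) with h | h
  · rw [stepDown, intervalIntegral.integral_of_le h, ← integral_mollifier_sub k s]
    exact setIntegral_le_integral (integrable_mollifier_sub k s)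
      (Eventually.of_forall fun τ => mollifier_nonneg k _)
  · have : 1 / ((k : ℝ) + 1) ≤ 1 := by
      rw [div_le_one (by positivity)]; linarith [(Nat.cast_nonneg k : (0 : ℝ) ≤ k)]
    rw [stepDown_eq_zero (by linarith)]
    exact zero_le_one

theorem stepDown_eq_one (ht : t ≤ s - 1 / ((k : ℝ) + 1)) : stepDown k s t = 1 := by
  have hk : 1 / ((k : ℝ) + 1) ≤ 1 := by
    rw [div_le_one (by positivity)]; linarith [(Nat.cast_nonneg k : (0 : ℝ) ≤ k)]
  have hk0 : 0 < 1 / ((k : ℝ) + 1) := by positivity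
  rw [stepDown, intervalIntegral.integral_of_le (by linarith)]
  refine (setIntegral_eq_integral_of_forall_compl_eq_zero ?_).trans (integral_mollifier_sub k s)
  intro τ hτ
  apply mollifier_eq_zero
  rw [mem_Ioc, not_and_or, not_lt, not_le] at hτ
  rcases hτ with h | h
  · exact le_trans (by linarith) (le_abs_self _)
  · rw [abs_sub_comm]
    exact le_trans (by linarith) (le_abs_self _)

end Step

/-! ### The test functions built from a parabolic cut-off -/

section Cutoff

variable {n N : ℕ} {c₁ c₂ : ℝ} {φ : ℝ → ℝ} {t₀ α R q s m : ℝ} {x₀ : EuclideanSpace ℝ (Fin n)}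
  {η : SpaceTime n → ℝ} {k : ℕ} {z : SpaceTime n}

theorem isOpen_cyl : IsOpen (cyl t₀ x₀ α R) := isOpen_Ioo.prod Metric.isOpen_ball

theorem isCompact_closure_cyl : IsCompact (closure (cyl t₀ x₀ α R)) :=
  ((Metric.isBounded_Ioo _ _).prod Metric.isBounded_ball).isCompact_closure

theorem closure_cyl_subset : closure (cyl t₀ x₀ α R) ⊆ Iic t₀ ×ˢ univ :=
  closure_minimal (fun _ hz => ⟨hz.1.2.le, mem_univ _⟩) (isClosed_Iic.prod isClosed_univ)

theorem IsParabolicCutoff.contDiffAt (hη : IsParabolicCutoff t₀ x₀ α R η) (hz : z.1 < t₀) :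
    ContDiffAt ℝ ∞ η z :=
  hη.smooth.contDiffAt (prod_mem_nhds (Iic_mem_nhds hz) univ_mem)

theorem IsParabolicCutoff.hasFDerivAt (hη : IsParabolicCutoff t₀ x₀ α R η) (hz : z.1 < t₀) :
    HasFDerivAt η (fderiv ℝ η z) z :=
  ((hη.contDiffAt hz).differentiableAt (by simp)).hasFDerivAt

theorem IsParabolicCutoff.eq_zero (hη : IsParabolicCutoff t₀ x₀ α R η) (hz : z.1 < t₀)
    (hzQ : z ∉ cyl t₀ x₀ α R) : η z = 0 := by
  obtain ⟨K, -, hK, h⟩ := hη.support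
  exact h z hz.le fun hzK => hzQ ⟨⟨(hK hzK).1.1, hz⟩, (hK hzK).2⟩

/-- Smoothness up to `t₀` makes the derivative within the closed half space continuous on the
compact closure of the cylinder, and inside it agrees with the full derivative. -/
theorem IsParabolicCutoff.exists_bound (hη : IsParabolicCutoff t₀ x₀ α R η) :
    ∃ D, ∀ z ∈ cyl t₀ x₀ α R, ‖spaceGrad η z‖ ≤ D ∧ |timeDeriv η z| ≤ D := by
  have hud : UniqueDiffOn ℝ (Iic t₀ ×ˢ (univ : Set (EuclideanSpace ℝ (Fin n)))) :=
    (uniqueDiffOn_Iic t₀).prod uniqueDiffOn_univ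
  have hc := (hη.smooth.continuousOn_fderivWithin hud (by simp)).mono
    (closure_cyl_subset (x₀ := x₀) (α := α) (R := R))
  have hd : ∀ v, ContinuousOn (fun z => fderivWithin ℝ η (Iic t₀ ×ˢ univ) z v)
      (closure (cyl t₀ x₀ α R)) := fun v => hc.clm_apply continuousOn_const
  have hg : ContinuousOn (fun z => WithLp.toLp 2 fun j =>
      fderivWithin ℝ η (Iic t₀ ×ˢ univ) z (dirX j)) (closure (cyl t₀ x₀ α R)) :=
    (PiLp.continuous_toLp 2 _).comp_continuousOn (continuousOn_pi.2 fun j => hd _)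
  obtain ⟨D₁, h₁⟩ := isCompact_closure_cyl.exists_bound_of_continuousOn hg
  obtain ⟨D₂, h₂⟩ := isCompact_closure_cyl.exists_bound_of_continuousOn (hd dirT)
  refine ⟨max D₁ D₂, fun z hz => ?_⟩
  have e : fderivWithin ℝ η (Iic t₀ ×ˢ univ) z = fderiv ℝ η z :=
    fderivWithin_of_mem_nhds (prod_mem_nhds (Iic_mem_nhds hz.1.2) univ_mem)
  have a₁ := h₁ z (subset_closure hz)
  have a₂ := h₂ z (subset_closure hz)
  rw [e] at a₁ a₂
  exact ⟨a₁.trans (le_max_left _ _), a₂.trans (le_max_right _ _)⟩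

/-- The test function `η ^ q`, cut off in time around `s`. -/
def timeCutoff (t₀ q : ℝ) (η : SpaceTime n → ℝ) (k : ℕ) (s : ℝ) (z : SpaceTime n) : ℝ :=
  if z.1 < t₀ then η z ^ q * stepDown k s z.1 else 0

theorem timeCutoff_eq (hz : z.1 < t₀) :
    timeCutoff t₀ q η k s z = η z ^ q * stepDown k s z.1 := if_pos hz

theorem eventually_fst_lt (hz : z.1 < t₀) : ∀ᶠ y in 𝓝 z, y.1 < t₀ :=
  continuous_fst.continuousAt.eventually_lt continuousAt_const hz

theorem timeCutoff_eventuallyEq (hz : z.1 < t₀) :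
    timeCutoff t₀ q η k s =ᶠ[𝓝 z] fun z => η z ^ q * stepDown k s z.1 := by
  filter_upwards [eventually_fst_lt hz] with y hy using timeCutoff_eq hy

/-- The step has already reached `0` before `t₀`, so setting the function to `0` from `t₀` on
creates no jump, although `η` itself need not vanish at `t₀`. -/
theorem timeCutoff_eventuallyEq_zero (hks : s + 1 / ((k : ℝ) + 1) < t₀) (hz : t₀ ≤ z.1) :
    timeCutoff t₀ q η k s =ᶠ[𝓝 z] fun _ => 0 := by
  filter_upwards [continuousAt_const.eventually_lt continuous_fst.continuousAt
    (hks.trans_le hz)] with y hy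
  rw [timeCutoff]
  split_ifs
  · rw [stepDown_eq_zero hy.le, mul_zero]
  · rfl

theorem IsParabolicCutoff.timeCutoff_eq_zero (hη : IsParabolicCutoff t₀ x₀ α R η) (hq : 2 ≤ q)
    (hz : z ∉ cyl t₀ x₀ α R) : timeCutoff t₀ q η k s z = 0 := by
  rw [timeCutoff]
  split_ifs with h
  · rw [hη.eq_zero h hz, Real.zero_rpow (by linarith), zero_mul]
  · rfl

theorem IsParabolicCutoff.timeCutoff_nonneg (hη : IsParabolicCutoff t₀ x₀ α R η) :
    0 ≤ timeCutoff t₀ q η k s z := by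
  rw [timeCutoff]
  split_ifs with h
  · exact mul_nonneg (Real.rpow_nonneg (hη.nonneg z h.le) q) stepDown_nonneg
  · exact le_rfl

theorem IsParabolicCutoff.timeCutoff_le_one (hη : IsParabolicCutoff t₀ x₀ α R η) (hq : 2 ≤ q) :
    timeCutoff t₀ q η k s z ≤ 1 := by
  rw [timeCutoff]
  split_ifs with h
  · exact mul_le_one₀ (Real.rpow_le_one (hη.nonneg z h.le) (hη.le_one z h.le) (by linarith))
      stepDown_nonneg stepDown_le_one
  · exact zero_le_one

theorem IsParabolicCutoff.contDiff_timeCutoff (hη : IsParabolicCutoff t₀ x₀ α R η) (hq : 2 ≤ q)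
    (hks : s + 1 / ((k : ℝ) + 1) < t₀) : ContDiff ℝ 1 (timeCutoff t₀ q η k s) := by
  rw [contDiff_iff_contDiffAt]
  intro z
  rcases lt_or_ge z.1 t₀ with hz | hz
  · refine ContDiffAt.congr_of_eventuallyEq ?_ (timeCutoff_eventuallyEq hz)
    have h1 : ContDiffAt ℝ 1 η z := (hη.contDiffAt hz).of_le (by simp)
    exact (h1.rpow_const_of_le (m := 1) (by push_cast; linarith)).mul
      ((contDiff_stepDown k s).comp contDiff_fst).contDiffAt
  · exact contDiffAt_const.congr_of_eventuallyEq (timeCutoff_eventuallyEq_zero hks hz)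

theorem IsParabolicCutoff.fderiv_timeCutoff (hη : IsParabolicCutoff t₀ x₀ α R η) (hq : 2 ≤ q)
    (hz : z.1 < t₀) (v : SpaceTime n) : fderiv ℝ (timeCutoff t₀ q η k s) z v =
      q * η z ^ (q - 1) * stepDown k s z.1 * fderiv ℝ η z v -
        η z ^ q * mollifier ℝ k (s - z.1) * v.1 := by
  have h1 := (hη.hasFDerivAt hz).rpow_const (p := q) (Or.inr (by linarith))
  have h2 : HasFDerivAt (fun z : SpaceTime n => stepDown k s z.1) _ z :=
    (hasDerivAt_stepDown k s z.1).comp_hasFDerivAt z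
      (hasFDerivAt_fst (𝕜 := ℝ) (E := ℝ) (F := EuclideanSpace ℝ (Fin n)) (p := z))
  have h3 : HasFDerivAt (fun z => η z ^ q * stepDown k s z.1) _ z := h1.mul h2
  rw [(timeCutoff_eventuallyEq hz).fderiv_eq, h3.fderiv]
  simp
  ring

theorem IsParabolicCutoff.fderiv_timeCutoff_eq_zero (hη : IsParabolicCutoff t₀ x₀ α R η)
    (hq : 2 ≤ q) (hks : s + 1 / ((k : ℝ) + 1) < t₀) (hz : z ∉ cyl t₀ x₀ α R) :
    fderiv ℝ (timeCutoff t₀ q η k s) z = 0 := by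
  rcases lt_or_ge z.1 t₀ with h | h
  · refine ContinuousLinearMap.ext fun v => ?_
    rw [hη.fderiv_timeCutoff hq h, hη.eq_zero h hz, Real.zero_rpow (by linarith),
      Real.zero_rpow (by linarith)]
    simp
  · rw [(timeCutoff_eventuallyEq_zero hks h).fderiv_eq]
    simp

/-- Here `q ≥ 2` is decisive: the square of `∇(η^q) = q η^(q-1) ∇η` carries `η^(2(q-1)) ≤ η^q`. -/
theorem IsParabolicCutoff.norm_spaceGrad_timeCutoff_sq_le (hη : IsParabolicCutoff t₀ x₀ α R η)
    (hq : 2 ≤ q) (hks : s + 1 / ((k : ℝ) + 1) < t₀)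
    (hm : ∀ z ∈ cyl t₀ x₀ α R, ‖spaceGrad η z‖ ≤ m) (z : SpaceTime n) :
    ‖spaceGrad (timeCutoff t₀ q η k s) z‖ ^ 2 ≤ (q * m) ^ 2 * timeCutoff t₀ q η k s z := by
  by_cases hz : z ∈ cyl t₀ x₀ α R
  · have hz1 : z.1 < t₀ := hz.1.2
    have h0 := hη.nonneg z hz1.le
    have e1 : spaceGrad (timeCutoff t₀ q η k s) z =
        (q * η z ^ (q - 1) * stepDown k s z.1) • spaceGrad η z := by
      ext j
      rw [spaceGrad_apply, hη.fderiv_timeCutoff hq hz1]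
      simp [dirX, spaceGrad, spaceDeriv]
    have e2 : (η z ^ (q - 1)) ^ 2 ≤ η z ^ q := by
      rw [← Real.rpow_natCast, ← Real.rpow_mul h0]
      exact Real.rpow_le_rpow_of_exponent_ge_of_imp h0 (hη.le_one z hz1.le)
        (by push_cast; linarith) (fun _ h => by push_cast at h; linarith)
    have e3 : stepDown k s z.1 ^ 2 ≤ stepDown k s z.1 :=
      pow_le_of_le_one stepDown_nonneg stepDown_le_one two_ne_zero
    rw [e1, norm_smul, mul_pow, Real.norm_eq_abs, sq_abs, mul_pow, mul_pow, timeCutoff_eq hz1]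
    calc q ^ 2 * (η z ^ (q - 1)) ^ 2 * stepDown k s z.1 ^ 2 * ‖spaceGrad η z‖ ^ 2
        ≤ q ^ 2 * η z ^ q * stepDown k s z.1 * m ^ 2 := by
          have := hm z hz
          have := Real.rpow_nonneg h0 q
          have := stepDown_nonneg (k := k) (s := s) (t := z.1)
          gcongr
      _ = _ := by ring
  · have : spaceGrad (timeCutoff t₀ q η k s) z = 0 := by
      ext j
      rw [spaceGrad_apply, hη.fderiv_timeCutoff_eq_zero hq hks hz]
      simp
    rw [this, hη.timeCutoff_eq_zero hq hz]
    simp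

theorem IsParabolicCutoff.tsupport_timeCutoff_subset (hη : IsParabolicCutoff t₀ x₀ α R η)
    (hq : 2 ≤ q) : tsupport (timeCutoff t₀ q η k s) ⊆ closure (cyl t₀ x₀ α R) :=
  closure_mono fun z hz => by
    by_contra hz'
    exact hz (hη.timeCutoff_eq_zero hq hz')

end Cutoff

/-! ### Energy estimate on a cylinder and its time slices -/

section Estimate

variable {n N : ℕ} {c₁ c₂ : ℝ} {φ : ℝ → ℝ} {J : Set ℝ} {Ω : Set (EuclideanSpace ℝ (Fin n))}
  {u : SpaceTime n → EuclideanSpace ℝ (Fin N)} {G : SpaceTime n → Mat (Fin N) n}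
  {H : SpaceTime n → Mat (Fin N × Fin n) n} {t₀ α R q s m : ℝ} {x₀ : EuclideanSpace ℝ (Fin n)}
  {η : SpaceTime n → ℝ} {k : ℕ}

theorem IsParabolicCutoff.continuousOn (hη : IsParabolicCutoff t₀ x₀ α R η) :
    ContinuousOn η (cyl t₀ x₀ α R) := fun _ hz =>
  (hη.contDiffAt hz.1.2).continuousAt.continuousWithinAt

theorem IsParabolicCutoff.continuousOn_rpow (hη : IsParabolicCutoff t₀ x₀ α R η) {p : ℝ}
    (hp : 0 ≤ p) : ContinuousOn (fun z => η z ^ p) (cyl t₀ x₀ α R) :=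
  hη.continuousOn.rpow_const fun _ _ => Or.inr hp

theorem IsParabolicCutoff.rpow_mem (hη : IsParabolicCutoff t₀ x₀ α R η) {p : ℝ} (hp : 0 ≤ p)
    {z : SpaceTime n} (hz : z ∈ cyl t₀ x₀ α R) : 0 ≤ η z ^ p ∧ η z ^ p ≤ 1 :=
  ⟨Real.rpow_nonneg (hη.nonneg z hz.1.2.le) p,
    Real.rpow_le_one (hη.nonneg z hz.1.2.le) (hη.le_one z hz.1.2.le) hp⟩

theorem IsParabolicCutoff.continuousOn_timeDeriv (hη : IsParabolicCutoff t₀ x₀ α R η) :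
    ContinuousOn (timeDeriv η) (cyl t₀ x₀ α R) := by
  have h1 : ContinuousOn (fderiv ℝ η) (cyl t₀ x₀ α R) := by
    refine ContDiffOn.continuousOn_fderiv_of_isOpen (n := ∞) ?_ isOpen_cyl (by simp)
    exact fun z hz => (hη.contDiffAt hz.1.2).contDiffWithinAt
  exact h1.clm_apply continuousOn_const

/-- Integrability against bounded continuous factors. -/
theorem IntegrableOn.mul_continuousOn_of_bound {S : Set (SpaceTime n)} (hS : IsOpen S)
    {f g : SpaceTime n → ℝ} (hf : IntegrableOn f S) (hg : ContinuousOn g S) {D : ℝ}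
    (hD : ∀ z ∈ S, |g z| ≤ D) : IntegrableOn (fun z => f z * g z) S := by
  refine Integrable.mul_bdd (c := D) hf (hg.aestronglyMeasurable hS.measurableSet) ?_
  filter_upwards [ae_restrict_mem hS.measurableSet] with z hz using hD z hz

theorem IsParabolicCutoff.integrableOn_mul_rpow (hη : IsParabolicCutoff t₀ x₀ α R η) {p : ℝ}
    (hp : 0 ≤ p) {f : SpaceTime n → ℝ} (hf : IntegrableOn f (cyl t₀ x₀ α R)) :
    IntegrableOn (fun z => f z * η z ^ p) (cyl t₀ x₀ α R) :=
  IntegrableOn.mul_continuousOn_of_bound isOpen_cyl hf (hη.continuousOn_rpow hp) (D := 1)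
    fun z hz => by rw [abs_of_nonneg (hη.rpow_mem hp hz).1]; exact (hη.rpow_mem hp hz).2

theorem IsParabolicCutoff.integrableOn_mul_timeDeriv (hη : IsParabolicCutoff t₀ x₀ α R η) {p : ℝ}
    (hp : 0 ≤ p) {f : SpaceTime n → ℝ} (hf : IntegrableOn f (cyl t₀ x₀ α R)) :
    IntegrableOn (fun z => f z * (η z ^ p * |timeDeriv η z|)) (cyl t₀ x₀ α R) := by
  obtain ⟨D, hD⟩ := hη.exists_bound
  refine IntegrableOn.mul_continuousOn_of_bound isOpen_cyl hf
    ((hη.continuousOn_rpow hp).mul hη.continuousOn_timeDeriv.abs) (D := D) fun z hz => ?_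
  have h1 := hη.rpow_mem hp hz
  have h2 := (hD z hz).2
  rw [abs_mul, abs_abs, abs_of_nonneg h1.1]
  exact (mul_le_of_le_one_left (abs_nonneg _) h1.2).trans h2

theorem SqLocallyIntegrableOn.integrableOn_cyl {F : Type} [NormedAddCommGroup F]
    {g : SpaceTime n → F} {U : Set (SpaceTime n)} (hg : SqLocallyIntegrableOn g U)
    (hQ : closure (cyl t₀ x₀ α R) ⊆ U) : IntegrableOn (fun z => ‖g z‖ ^ 2) (cyl t₀ x₀ α R) :=
  (LocallyIntegrableOn.integrableOn_compact_subset hg hQ isCompact_closure_cyl).mono_set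
    subset_closure

/-- The time derivative of the cut-off has two parts. The one from `η^q` gives the term with `|∂_t
η|`; the one from the step is minus a mollifier at time `s`, a smoothed time slice, and moves to the
left side with a good sign. -/
theorem IsLocalWeakSolution.cutoff_energy_le (S : IsLocalWeakSolution φ J Ω u G)
    (h : OrliczAssumption c₁ c₂ φ) (hc₁ : 0 < c₁) (hc₂ : 0 < c₂) (hU : IsOpen (J ×ˢ Ω))
    (hG : SqLocallyIntegrableOn G (J ×ˢ Ω))
    (hH : IsWeakSpaceGradient (J ×ˢ Ω) (fun z => fieldV φ (G z)) H)
    (hH2 : SqLocallyIntegrableOn H (J ×ˢ Ω)) (hQ : closure (cyl t₀ x₀ α R) ⊆ J ×ˢ Ω)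
    (hη : IsParabolicCutoff t₀ x₀ α R η) (hq : 2 ≤ q) (hm0 : 0 ≤ m)
    (hm : ∀ z ∈ cyl t₀ x₀ α R, ‖spaceGrad η z‖ ≤ m) (hks : s + 1 / ((k : ℝ) + 1) < t₀) :
    (∫ z in cyl t₀ x₀ α R, ‖H z‖ ^ 2 * η z ^ q * stepDown k s z.1) +
      monoConst c₁ c₂ *
        ∫ z in cyl t₀ x₀ α R, ‖G z‖ ^ 2 * η z ^ q * mollifier ℝ k (s - z.1) ≤
    n * (energyConst c₁ c₂ * (q * m) ^ 2 * ∫ z in cyl t₀ x₀ α R, ‖fieldV φ (G z)‖ ^ 2) +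
      monoConst c₁ c₂ * (q * ∫ z in cyl t₀ x₀ α R,
        ‖G z‖ ^ 2 * (η z ^ (q - 1) * |timeDeriv η z|)) := by
  obtain ⟨W, hW, hQW, hWU, hWc⟩ :=
    exists_open_between_and_isCompact_closure isCompact_closure_cyl hU hQ
  have L := S.isIntegrableSolution h hc₁ hc₂ hG hW hWc hWU
  have := isFiniteMeasure_restrict_of_closure hWc
  have mH : MemLp H 2 (volume.restrict W) := hH2.memLp_restrict hH.2.1 hWc hWU
  have hκ0 : 0 < monoConst c₁ c₂ := monoConst_pos hc₁
  set Q := cyl t₀ x₀ α R with hQdef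
  have mQ : MeasurableSet Q := isOpen_cyl.measurableSet
  have hQW' : Q ⊆ W := subset_closure.trans hQW
  have hζ := hη.contDiff_timeCutoff hq hks
  have hts := hη.tsupport_timeCutoff_subset hq (k := k) (s := s)
  have hζc : HasCompactSupport (timeCutoff t₀ q η k s) :=
    isCompact_closure_cyl.of_isClosed_subset (isClosed_tsupport _) hts
  have key := L.energy_le h hc₁ hc₂ hW (H := W.indicator H)
    (IntegrableOn.integrable_indicator (mH.integrable one_le_two) hW.measurableSet)
    ((memLp_indicator_iff_restrict hW.measurableSet).2 mH)
    (fun p j => by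
      have := hH.isWeakDeriv (subset_closure.trans hWU) p j
      rwa [← fieldV_indicator] at this)
    hζ hζc (hts.trans hQW) (fun z => hη.timeCutoff_nonneg) (fun z => hη.timeCutoff_le_one hq)
    (by positivity : 0 ≤ q * m) (hη.norm_spaceGrad_timeCutoff_sq_le hq hks hm)
  have e1 : ∫ z, ‖W.indicator H z‖ ^ 2 * timeCutoff t₀ q η k s z =
      ∫ z in Q, ‖H z‖ ^ 2 * η z ^ q * stepDown k s z.1 := by
    rw [← setIntegral_eq_integral_of_forall_compl_eq_zero (s := Q)
      fun z hz => by rw [hη.timeCutoff_eq_zero hq hz, mul_zero]]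
    refine setIntegral_congr_fun mQ fun z hz => ?_
    simp only [indicator_of_mem (hQW' hz), timeCutoff_eq hz.1.2, mul_assoc]
  have e2 : ∫ z in Function.support (timeCutoff t₀ q η k s), ‖fieldV φ (W.indicator G z)‖ ^ 2 ≤
      ∫ z in Q, ‖fieldV φ (G z)‖ ^ 2 := by
    refine (setIntegral_mono_set L.integrable_field_sq.integrableOn
      (Eventually.of_forall fun z => sq_nonneg _) (LE.le.eventuallyLE
        fun z hz => ?_)).trans (setIntegral_congr_fun mQ fun z hz => ?_).le
    · by_contra hz'
      exact hz (hη.timeCutoff_eq_zero hq hz')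
    · simp only [indicator_of_mem (hQW' hz)]
  have iG : IntegrableOn (fun z => ‖G z‖ ^ 2) Q := hG.integrableOn_cyl hQ
  have i2 : IntegrableOn (fun z => ‖G z‖ ^ 2 * η z ^ q * mollifier ℝ k (s - z.1)) Q := by
    obtain ⟨D, hD⟩ := (hasCompactSupport_mollifier (E := ℝ) k).exists_bound_of_continuous
      (contDiff_mollifier k).continuous
    exact IntegrableOn.mul_continuousOn_of_bound isOpen_cyl
      (hη.integrableOn_mul_rpow (by linarith) iG)
      ((continuous_mollifier_sub k s).comp continuous_fst).continuousOn fun z _ => hD _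
  have i3 := hη.integrableOn_mul_timeDeriv (p := q - 1) (by linarith) iG
  have e3 : ∫ z, ‖W.indicator G z‖ ^ 2 * fderiv ℝ (timeCutoff t₀ q η k s) z dirT ≤
      (q * ∫ z in Q, ‖G z‖ ^ 2 * (η z ^ (q - 1) * |timeDeriv η z|)) -
        ∫ z in Q, ‖G z‖ ^ 2 * η z ^ q * mollifier ℝ k (s - z.1) := by
    rw [← integral_const_mul, ← integral_sub (i3.const_mul q) i2,
      ← setIntegral_eq_integral_of_forall_compl_eq_zero (s := Q)
      fun z hz => by rw [hη.fderiv_timeCutoff_eq_zero hq hks hz]; simp]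
    refine setIntegral_mono_on ?_ ((i3.const_mul q).sub i2) mQ fun z hz => ?_
    · obtain ⟨T, hT⟩ := (hζc.fderiv_apply (𝕜 := ℝ) dirT).exists_bound_of_continuous
        ((hζ.continuous_fderiv one_ne_zero).clm_apply continuous_const)
      exact ((memLp_norm_sq L.memLp_grad).mul_bdd (c := T)
        ((hζ.continuous_fderiv one_ne_zero).clm_apply continuous_const).aestronglyMeasurable
        (Eventually.of_forall hT)).integrableOn
    · have a1 := hη.rpow_mem (p := q - 1) (by linarith) hz
      have a2 : η z ^ (q - 1) * stepDown k s z.1 * timeDeriv η z ≤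
          η z ^ (q - 1) * |timeDeriv η z| := by
        refine (le_abs_self _).trans ?_
        rw [abs_mul, abs_of_nonneg (mul_nonneg a1.1 stepDown_nonneg)]
        exact mul_le_mul_of_nonneg_right (mul_le_of_le_one_right a1.1 stepDown_le_one)
          (abs_nonneg _)
      have a3 := mul_le_mul_of_nonneg_left a2 (by positivity : 0 ≤ q * ‖G z‖ ^ 2)
      rw [indicator_of_mem (hQW' hz), hη.fderiv_timeCutoff hq hz.1.2]
      simp only [timeDeriv, dirT] at a3 ⊢
      linarith
  rw [e1] at key
  have hE : 0 ≤ energyConst c₁ c₂ := by unfold energyConst; positivity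
  have k2 := mul_le_mul_of_nonneg_left (mul_le_mul_of_nonneg_left e2
    (by positivity : 0 ≤ energyConst c₁ c₂ * (q * m) ^ 2)) (Nat.cast_nonneg (α := ℝ) n)
  have k3 := mul_le_mul_of_nonneg_left e3 hκ0.le
  linarith

/-- By Fubini the smoothed slice is a one-dimensional mollification of the slice integrals, so
almost every slice is recovered by differentiation of integrals. -/
theorem setIntegral_cyl_mul_mollifier {f : SpaceTime n → ℝ}
    (hf : IntegrableOn f (cyl t₀ x₀ α R)) (k : ℕ) (s : ℝ) :
    ∫ z in cyl t₀ x₀ α R, f z * mollifier ℝ k (s - z.1) =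
      mollify k ((Ioo (t₀ - α * R ^ 2) t₀).indicator
        fun t => ∫ x in Metric.ball x₀ R, f (t, x)) s := by
  have hr : (volume : Measure (SpaceTime n)).restrict (cyl t₀ x₀ α R) =
      (volume.restrict (Ioo (t₀ - α * R ^ 2) t₀)).prod (volume.restrict (Metric.ball x₀ R)) :=
    (Measure.prod_restrict _ _).symm
  obtain ⟨D, hD⟩ := (hasCompactSupport_mollifier (E := ℝ) k).exists_bound_of_continuous
    (contDiff_mollifier k).continuous
  have i2 : IntegrableOn (fun z => f z * mollifier ℝ k (s - z.1)) (cyl t₀ x₀ α R) :=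
    IntegrableOn.mul_continuousOn_of_bound isOpen_cyl hf
      ((continuous_mollifier_sub k s).comp continuous_fst).continuousOn fun z _ => hD _
  rw [IntegrableOn, hr] at i2
  rw [hr, integral_prod _ i2, mollify_apply, ← integral_indicator measurableSet_Ioo]
  congr 1; ext t
  by_cases ht : t ∈ Ioo (t₀ - α * R ^ 2) t₀
  · rw [indicator_of_mem ht, indicator_of_mem ht, mul_comm, ← integral_mul_const]
  · rw [indicator_of_notMem ht, indicator_of_notMem ht, mul_zero]

theorem integrable_slice {f : SpaceTime n → ℝ} (hf : IntegrableOn f (cyl t₀ x₀ α R)) :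
    (∀ᵐ t ∂volume.restrict (Ioo (t₀ - α * R ^ 2) t₀),
      IntegrableOn (fun x => f (t, x)) (Metric.ball x₀ R)) ∧
      Integrable ((Ioo (t₀ - α * R ^ 2) t₀).indicator
        fun t => ∫ x in Metric.ball x₀ R, f (t, x)) := by
  have hr : (volume : Measure (SpaceTime n)).restrict (cyl t₀ x₀ α R) =
      (volume.restrict (Ioo (t₀ - α * R ^ 2) t₀)).prod (volume.restrict (Metric.ball x₀ R)) :=
    (Measure.prod_restrict _ _).symm
  rw [IntegrableOn, hr] at hf
  exact ⟨hf.prod_right_ae, IntegrableOn.integrable_indicator hf.integral_prod_left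
    measurableSet_Ioo⟩

/-- A bound for all mollified time slices bounds almost every time slice. -/
theorem ae_slice_le {f : SpaceTime n → ℝ} (hf : IntegrableOn f (cyl t₀ x₀ α R)) {A : ℝ}
    (hA : ∀ (k : ℕ) (s : ℝ), s + 1 / ((k : ℝ) + 1) < t₀ →
      ∫ z in cyl t₀ x₀ α R, f z * mollifier ℝ k (s - z.1) ≤ A) :
    ∀ᵐ t ∂volume.restrict (Ioo (t₀ - α * R ^ 2) t₀), ∫ x in Metric.ball x₀ R, f (t, x) ≤ A := by
  filter_upwards [ae_restrict_mem measurableSet_Ioo, ae_restrict_of_ae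
    (ae_tendsto_mollify (integrable_slice hf).2.locallyIntegrable)] with t ht h1
  rw [indicator_of_mem ht] at h1
  refine le_of_tendsto h1 ?_
  have h2 : Tendsto (fun k : ℕ => t + 1 / ((k : ℝ) + 1)) atTop (𝓝 (t + 0)) :=
    tendsto_const_nhds.add tendsto_one_div_add_atTop_nhds_zero_nat
  rw [add_zero] at h2
  filter_upwards [h2.eventually_lt_const ht.2] with k hk
  rw [← setIntegral_cyl_mul_mollifier hf]
  exact hA k t hk

/-- A bound for all truncations in time is a bound on the whole cylinder. -/
theorem setIntegral_cyl_le_of_stepDown {f : SpaceTime n → ℝ}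
    (hf : IntegrableOn f (cyl t₀ x₀ α R)) {A : ℝ}
    (hA : ∀ (k : ℕ) (s : ℝ), s + 1 / ((k : ℝ) + 1) < t₀ →
      ∫ z in cyl t₀ x₀ α R, f z * stepDown k s z.1 ≤ A) :
    ∫ z in cyl t₀ x₀ α R, f z ≤ A := by
  have h0 : Tendsto (fun k : ℕ => 1 / ((k : ℝ) + 1)) atTop (𝓝 0) :=
    tendsto_one_div_add_atTop_nhds_zero_nat
  -- The choice `s = t₀ - 2/(k+1)` is admissible, since `s + 1/(k+1) < t₀`, and the step equals `1`
  -- up to time `t₀ - 3/(k+1)`, hence eventually at each fixed point of the cylinder.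
  have key : Tendsto (fun k : ℕ => ∫ z in cyl t₀ x₀ α R,
      f z * stepDown k (t₀ - 2 * (1 / ((k : ℝ) + 1))) z.1) atTop
      (𝓝 (∫ z in cyl t₀ x₀ α R, f z)) := by
    refine tendsto_integral_of_dominated_convergence (fun z => ‖f z‖) (fun k => ?_) hf.norm
      (fun k => ?_) ?_
    · exact hf.aestronglyMeasurable.mul
        ((contDiff_stepDown k _).continuous.comp continuous_fst).aestronglyMeasurable
    · refine Eventually.of_forall fun z => ?_
      rw [norm_mul, Real.norm_of_nonneg (stepDown_nonneg (t := z.1))]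
      exact mul_le_of_le_one_right (norm_nonneg _) stepDown_le_one
    · filter_upwards [ae_restrict_mem isOpen_cyl.measurableSet] with z hz
      refine tendsto_const_nhds.congr' ?_
      have h2 := (h0.const_mul 3).const_sub t₀
      rw [mul_zero, sub_zero] at h2
      filter_upwards [h2.eventually_const_lt hz.1.2] with k hk
      rw [stepDown_eq_one (by linarith), mul_one]
  refine le_of_tendsto' key fun k => hA k _ ?_
  have : 0 < 1 / ((k : ℝ) + 1) := by positivity
  linarith

end Estimate

/-! ### The estimate in terms of mean values -/

section MeanValue

variable {n N : ℕ} {c₁ c₂ : ℝ} {φ : ℝ → ℝ} {J : Set ℝ} {Ω : Set (EuclideanSpace ℝ (Fin n))}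
  {u : SpaceTime n → EuclideanSpace ℝ (Fin N)} {G : SpaceTime n → Mat (Fin N) n}
  {H : SpaceTime n → Mat (Fin N × Fin n) n} {t₀ α R q : ℝ} {x₀ : EuclideanSpace ℝ (Fin n)}
  {η : SpaceTime n → ℝ}

theorem lintegral_enorm_sq_mul_ofReal {β F : Type*} [MeasurableSpace β] [NormedAddCommGroup F]
    {μ : Measure β} {g : β → F} {w : β → ℝ} (hg : Integrable (fun z => ‖g z‖ ^ 2 * w z) μ)
    (hw : ∀ᵐ z ∂μ, 0 ≤ w z) :
    ∫⁻ z, ‖g z‖ₑ ^ 2 * ENNReal.ofReal (w z) ∂μ = ENNReal.ofReal (∫ z, ‖g z‖ ^ 2 * w z ∂μ) := by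
  rw [ofReal_integral_eq_lintegral_ofReal hg
    (by filter_upwards [hw] with z hz using mul_nonneg (sq_nonneg _) hz)]
  refine lintegral_congr fun z => ?_
  rw [ENNReal.ofReal_mul (sq_nonneg _), ENNReal.ofReal_pow (norm_nonneg _), ofReal_norm]

theorem volume_cyl (t₀ : ℝ) (x₀ : EuclideanSpace ℝ (Fin n)) (α R : ℝ) :
    volume (cyl t₀ x₀ α R) = ENNReal.ofReal (α * R ^ 2) * volume (Metric.ball x₀ R) := by
  rw [cyl, Measure.volume_eq_prod, Measure.prod_prod, Real.volume_Ioo]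
  congr 2; ring

theorem volume_ball_two_mul (x₀ : EuclideanSpace ℝ (Fin n)) (R : ℝ) :
    volume (Metric.ball x₀ (2 * R)) = ENNReal.ofReal (2 ^ n) * volume (Metric.ball x₀ R) := by
  rw [Measure.addHaar_ball_mul_of_pos volume x₀ two_pos, Measure.addHaar_ball_center volume x₀ R,
    finrank_euclideanSpace_fin]

theorem cyl_subset_cyl_two_mul (hα : 0 < α) (hR : 0 < R) :
    cyl t₀ x₀ α R ⊆ cyl t₀ x₀ α (2 * R) := by
  refine prod_mono (Ioo_subset_Ioo_left ?_) (Metric.ball_subset_ball (by linarith))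
  nlinarith [mul_pos hα (pow_pos hR 2)]

theorem setLIntegral_le_indicator {S T U : Set (SpaceTime n)} (hS : MeasurableSet S) (hST : S ⊆ T)
    (hSU : S ⊆ U) (f : SpaceTime n → ℝ≥0∞) : ∫⁻ z in S, f z ≤ ∫⁻ z in T, U.indicator f z :=
  calc ∫⁻ z in S, f z = ∫⁻ z in S, U.indicator f z :=
        setLIntegral_congr_fun hS fun _ hz => (indicator_of_mem (hSU hz) f).symm
    _ ≤ _ := lintegral_mono_set hST

/-- The factor between the two sides of the energy estimate before averaging. -/
def cutoffConst (n : ℕ) (c₁ c₂ q : ℝ) : ℝ :=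
  n * energyConst c₁ c₂ * q ^ 2 + monoConst c₁ c₂ * q

/-- Both summands on the left are at most `A/(αβ)`, with `β` the volume of the ball, which gives the
factor `2`; the factor `2^(n+2)` is the ratio of the volumes of `Q_{2R}` and `Q_R`. On the right the
integrands are nonnegative, so restricting them to `Q_R` only decreases the integrals. -/
theorem IsLocalWeakSolution.energyEstimate (S : IsLocalWeakSolution φ J Ω u G)
    (h : OrliczAssumption c₁ c₂ φ) (hc₁ : 0 < c₁) (hc₂ : 0 < c₂) (hU : IsOpen (J ×ˢ Ω))
    (hG : SqLocallyIntegrableOn G (J ×ˢ Ω))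
    (hH : IsWeakSpaceGradient (J ×ˢ Ω) (fun z => fieldV φ (G z)) H)
    (hH2 : SqLocallyIntegrableOn H (J ×ˢ Ω)) (hα : 0 < α) (hR : 0 < R)
    (hQ : closure (cyl t₀ x₀ α R) ⊆ J ×ˢ Ω) (hη : IsParabolicCutoff t₀ x₀ α R η) (hq : 2 ≤ q) :
    EnergyEstimate (2 * 2 ^ (n + 2) * cutoffConst n c₁ c₂ q).toNNReal q φ (J ×ˢ Ω) G H
      t₀ x₀ α R η := by
  set Q := cyl t₀ x₀ α R with hQdef
  have mQ : MeasurableSet Q := isOpen_cyl.measurableSet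
  have hQU : Q ⊆ J ×ˢ Ω := subset_closure.trans hQ
  -- Allows the factor in front of the time slice to be dropped on the left side.
  have hκ1 : 1 ≤ monoConst c₁ c₂ := le_add_of_nonneg_right (by positivity)
  have hκ0 : 0 < monoConst c₁ c₂ := by linarith
  have hE : 0 ≤ energyConst c₁ c₂ := by unfold energyConst; positivity
  obtain ⟨D, hD⟩ := hη.exists_bound
  set M : ℝ≥0∞ := ⨆ y ∈ Q, ‖spaceGrad η y‖ₑ with hM
  -- The supremum of `|∇η|` is finite, so the argument can be carried out with the real number `m`.
  have hMtop : M ≠ ⊤ := by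
    refine ne_top_of_le_ne_top (ENNReal.ofReal_ne_top (r := D)) (iSup₂_le fun y hy => ?_)
    rw [← ofReal_norm]
    exact ENNReal.ofReal_le_ofReal (hD y hy).1
  set m := M.toReal with hm
  have hm0 : 0 ≤ m := ENNReal.toReal_nonneg
  have hMm : M = ENNReal.ofReal m := (ENNReal.ofReal_toReal hMtop).symm
  have hmQ : ∀ z ∈ Q, ‖spaceGrad η z‖ ≤ m := fun z hz => by
    have h1 : ‖spaceGrad η z‖ₑ ≤ M := le_iSup₂ (f := fun y (_ : y ∈ Q) => ‖spaceGrad η y‖ₑ) z hz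
    have := ENNReal.toReal_mono hMtop h1
    rwa [toReal_enorm] at this
  have iV : IntegrableOn (fun z => ‖fieldV φ (G z)‖ ^ 2) Q :=
    (S.memLp_field_restrict h hc₁ hc₂ isCompact_closure_cyl hQ).integrable_norm_pow two_ne_zero
  have iG : IntegrableOn (fun z => ‖G z‖ ^ 2) Q := hG.integrableOn_cyl hQ
  have iH : IntegrableOn (fun z => ‖H z‖ ^ 2) Q := hH2.integrableOn_cyl hQ
  have iGη := hη.integrableOn_mul_rpow (p := q) (by linarith) iG
  have iHη := hη.integrableOn_mul_rpow (p := q) (by linarith) iH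
  have iGt := hη.integrableOn_mul_timeDeriv (p := q - 1) (by linarith) iG
  set X := ∫ z in Q, ‖fieldV φ (G z)‖ ^ 2 with hX
  set Y := ∫ z in Q, ‖G z‖ ^ 2 * (η z ^ (q - 1) * |timeDeriv η z|) with hY
  have hX0 : 0 ≤ X := integral_nonneg fun z => sq_nonneg _
  have hY0 : 0 ≤ Y := setIntegral_nonneg mQ fun z hz =>
    mul_nonneg (sq_nonneg _) (mul_nonneg (hη.rpow_mem (by linarith) hz).1 (abs_nonneg _))
  set A := n * (energyConst c₁ c₂ * (q * m) ^ 2 * X) + monoConst c₁ c₂ * (q * Y) with hA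
  have hAle : A ≤ cutoffConst n c₁ c₂ q * (X * m ^ 2 + Y) := by
    have a1 : 0 ≤ n * energyConst c₁ c₂ * q ^ 2 * Y := by positivity
    have a2 : 0 ≤ monoConst c₁ c₂ * q * (X * m ^ 2) := by positivity
    rw [hA, cutoffConst]
    linarith
  have hA0 : 0 ≤ A := by positivity
  have key := fun (k : ℕ) (s : ℝ) hks => S.cutoff_energy_le h hc₁ hc₂ hU hG hH hH2 hQ hη hq hm0 hmQ
    (k := k) (s := s) hks
  have n1 : ∀ (k : ℕ) (s : ℝ),
      0 ≤ ∫ z in Q, ‖H z‖ ^ 2 * η z ^ q * stepDown k s z.1 := fun k s =>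
    setIntegral_nonneg mQ fun z hz => mul_nonneg (mul_nonneg (sq_nonneg _)
      (hη.rpow_mem (by linarith) hz).1) stepDown_nonneg
  have n2 : ∀ (k : ℕ) (s : ℝ),
      0 ≤ ∫ z in Q, ‖G z‖ ^ 2 * η z ^ q * mollifier ℝ k (s - z.1) := fun k s =>
    setIntegral_nonneg mQ fun z hz => mul_nonneg (mul_nonneg (sq_nonneg _)
      (hη.rpow_mem (by linarith) hz).1) (mollifier_nonneg k _)
  have bG := ae_slice_le iGη (A := A) fun k s hks => by
    have a1 := key k s hks
    have a2 := mul_le_mul_of_nonneg_right hκ1 (n2 k s)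
    have a3 := n1 k s
    linarith
  have bH := setIntegral_cyl_le_of_stepDown iHη (A := A) fun k s hks => by
    have a1 := key k s hks
    have a2 := mul_nonneg hκ0.le (n2 k s)
    linarith
  -- volumes
  set β := (volume (Metric.ball x₀ R)).toReal with hβ
  have hball : volume (Metric.ball x₀ R) = ENNReal.ofReal β :=
    (ENNReal.ofReal_toReal measure_ball_lt_top.ne).symm
  have hβ0 : 0 < β := ENNReal.toReal_pos (Metric.measure_ball_pos volume x₀ hR).ne'
    measure_ball_lt_top.ne
  have hvQ : volume Q = ENNReal.ofReal (α * R ^ 2 * β) := by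
    rw [hQdef, volume_cyl, hball, ← ENNReal.ofReal_mul (by positivity)]
  have hvQ2 : volume (cyl t₀ x₀ α (2 * R)) = ENNReal.ofReal (2 ^ (n + 2) * (α * R ^ 2 * β)) := by
    rw [volume_cyl, volume_ball_two_mul, hball, ← ENNReal.ofReal_mul (by positivity),
      ← ENNReal.ofReal_mul (by positivity)]
    congr 1; ring
  have hQ2 : Q ⊆ cyl t₀ x₀ α (2 * R) := cyl_subset_cyl_two_mul hα hR
  -- the left-hand side
  have l1 : essSup (fun s => ENNReal.ofReal (1 / α) *
        ⨍⁻ x in Metric.ball x₀ R, ‖G (s, x)‖ₑ ^ 2 * ENNReal.ofReal (η (s, x) ^ q) ∂volume)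
      (volume.restrict (Ioo (t₀ - α * R ^ 2) t₀)) ≤ ENNReal.ofReal (A / (α * β)) := by
    refine essSup_le_of_ae_le _ ?_
    filter_upwards [bG, (integrable_slice iGη).1, ae_restrict_mem measurableSet_Ioo]
      with s h1 h2 h3
    rw [setLAverage_eq, lintegral_enorm_sq_mul_ofReal h2
      (Eventually.of_forall fun x => Real.rpow_nonneg (hη.nonneg (s, x) h3.2.le) q), hball,
      ← ENNReal.ofReal_div_of_pos hβ0, ← ENNReal.ofReal_mul (by positivity)]
    refine ENNReal.ofReal_le_ofReal ?_
    rw [one_div_mul_eq_div, div_div, mul_comm β]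
    gcongr
  have l2 : ENNReal.ofReal (R ^ 2) * ⨍⁻ z in Q, ‖H z‖ₑ ^ 2 * ENNReal.ofReal (η z ^ q) ∂volume ≤
      ENNReal.ofReal (A / (α * β)) := by
    rw [setLAverage_eq, lintegral_enorm_sq_mul_ofReal iHη (by
        filter_upwards [ae_restrict_mem mQ] with z hz using (hη.rpow_mem (by linarith) hz).1), hvQ,
      ← ENNReal.ofReal_div_of_pos (by positivity), ← ENNReal.ofReal_mul (by positivity)]
    refine ENNReal.ofReal_le_ofReal ?_
    calc R ^ 2 * ((∫ z in Q, ‖H z‖ ^ 2 * η z ^ q) / (α * R ^ 2 * β))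
        ≤ R ^ 2 * (A / (α * R ^ 2 * β)) := by gcongr
      _ = A / (α * β) := by field_simp
  -- the right-hand side
  have r1 : ENNReal.ofReal (X * m ^ 2 / (2 ^ (n + 2) * (α * β))) ≤ ENNReal.ofReal (R ^ 2) *
      ⨍⁻ z in cyl t₀ x₀ α (2 * R), (J ×ˢ Ω).indicator (fun z => ‖fieldV φ (G z)‖ₑ ^ 2 * M ^ 2) z
        ∂volume := by
    have a1 := setLIntegral_le_indicator mQ hQ2 hQU fun z => ‖fieldV φ (G z)‖ₑ ^ 2 * M ^ 2
    have a2 : ∫⁻ z in Q, ‖fieldV φ (G z)‖ₑ ^ 2 * M ^ 2 = ENNReal.ofReal (X * m ^ 2) := by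
      rw [hMm, ← ENNReal.ofReal_pow hm0, lintegral_enorm_sq_mul_ofReal (w := fun _ => m ^ 2)
        (iV.mul_const _) (Eventually.of_forall fun _ => sq_nonneg _), integral_mul_const]
    rw [setLAverage_eq, hvQ2]
    refine le_trans (le_of_eq ?_) (mul_le_mul_right (ENNReal.div_le_div_right (a2.symm.trans_le a1) _) _)
    rw [← ENNReal.ofReal_div_of_pos (by positivity), ← ENNReal.ofReal_mul (by positivity)]
    congr 1; field_simp
  have r2 : ENNReal.ofReal (Y / (2 ^ (n + 2) * (α * β))) ≤ ENNReal.ofReal (R ^ 2) *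
      ⨍⁻ z in cyl t₀ x₀ α (2 * R), (J ×ˢ Ω).indicator (fun z => ‖G z‖ₑ ^ 2 *
        ENNReal.ofReal (η z ^ (q - 1) * |timeDeriv η z|)) z ∂volume := by
    have a1 := setLIntegral_le_indicator mQ hQ2 hQU fun z => ‖G z‖ₑ ^ 2 *
      ENNReal.ofReal (η z ^ (q - 1) * |timeDeriv η z|)
    rw [lintegral_enorm_sq_mul_ofReal iGt (by
      filter_upwards [ae_restrict_mem mQ] with z hz using
        mul_nonneg (hη.rpow_mem (by linarith) hz).1 (abs_nonneg _))] at a1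
    change ENNReal.ofReal Y ≤ _ at a1
    rw [setLAverage_eq, hvQ2]
    refine le_trans (le_of_eq ?_) (mul_le_mul_right (ENNReal.div_le_div_right a1 _) _)
    rw [← ENNReal.ofReal_div_of_pos (by positivity), ← ENNReal.ofReal_mul (by positivity)]
    congr 1; field_simp
  have hC0 : 0 ≤ cutoffConst n c₁ c₂ q := by unfold cutoffConst; positivity
  refine (add_le_add l1 l2).trans (le_trans ?_ (mul_le_mul_right (add_le_add r1 r2) _))
  rw [← ENNReal.ofReal_add (by positivity) (by positivity),
    ← ENNReal.ofReal_add (by positivity) (by positivity)]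
  change _ ≤ ENNReal.ofReal _ * _
  rw [← ENNReal.ofReal_mul (by positivity)]
  refine ENNReal.ofReal_le_ofReal ?_
  calc A / (α * β) + A / (α * β) = 2 * A / (α * β) := by ring
    _ ≤ 2 * (cutoffConst n c₁ c₂ q * (X * m ^ 2 + Y)) / (α * β) := by gcongr
    _ = _ := by field_simp

end MeanValue

end

/-! ### Conclusion -/

theorem theorem3p3 (n : ℕ) (c₁ c₂ : ℝ) (hc₁ : 0 < c₁) (hc₂ : 0 < c₂) :
    -- an exponent `q` as required below exists and depends only on the characteristics
    (∃ q : ℝ, 1 < q ∧ ∃ K : ℝ, ∀ φ : ℝ → ℝ, OrliczAssumption c₁ c₂ φ → ShiftedPowerBound K q φ) ∧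
    -- for every such `q` the estimate holds
    (∀ q : ℝ, 1 < q → ∃ C : ℝ≥0, ∀ φ : ℝ → ℝ, OrliczAssumption c₁ c₂ φ →
      (∃ K : ℝ, ShiftedPowerBound K q φ) →
      ∀ (N : ℕ) (J : Set ℝ) (Ω : Set (EuclideanSpace ℝ (Fin n))),
        IsOpen J → J.OrdConnected → IsOpen Ω →
      ∀ (u : SpaceTime n → EuclideanSpace ℝ (Fin N)) (G : SpaceTime n → Mat (Fin N) n),
        IsLocalWeakSolution φ J Ω u G → SqLocallyIntegrableOn G (J ×ˢ Ω) →
      ∃ H : SpaceTime n → Mat (Fin N × Fin n) n,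
        IsWeakSpaceGradient (J ×ˢ Ω) (fun z => fieldV φ (G z)) H ∧
        SqLocallyIntegrableOn H (J ×ˢ Ω) ∧
        ∀ (t₀ : ℝ) (x₀ : EuclideanSpace ℝ (Fin n)) (α R : ℝ), 0 < α → 0 < R →
          closure (cyl t₀ x₀ α R) ⊆ J ×ˢ Ω →
          ∀ η : SpaceTime n → ℝ, IsParabolicCutoff t₀ x₀ α R η →
            EnergyEstimate C q φ (J ×ˢ Ω) G H t₀ x₀ α R η) := by
  obtain ⟨q₀, hq₀, K₀, hK₀⟩ := exists_shiftedPowerBound hc₂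
  -- The constant is fixed before `φ` and `K` appear; the power bound enters below only through `2 ≤
  -- q`, so `K` does not influence it.
  refine ⟨⟨q₀, hq₀, K₀, hK₀ c₁⟩, fun q hq => ⟨(2 * 2 ^ (n + 2) * cutoffConst n c₁ c₂ q).toNNReal, ?_⟩⟩
  rintro φ h ⟨K, hK⟩ N J Ω hJ - hΩ u G S hG
  obtain ⟨H, hH, hH2⟩ := S.exists_gradient_field h hc₁ hc₂ (hJ.prod hΩ) hG
  exact ⟨H, hH, hH2, fun t₀ x₀ α R hα hR hQ η hη =>
    S.energyEstimate h hc₁ hc₂ (hJ.prod hΩ) hG hH hH2 hα hR hQ hη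
      (OrliczAssumption.two_le_of_shiftedPowerBound h hc₁ hc₂ hq hK)⟩
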